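/- Conventions. A problem is a finite set $X\subset\mathbb Z^d$: given $c\in\mathbb Z^d$, find $\max_{x\in X}c^Tx$. Its encoding size is $\mathrm{ES}(X)=\log_2\max_{x\in X}\|x\|_\infty$. $\mathrm{Lat}(P)$ is the set of faces of a polytope $P$ other than $\emptyset$ and $P$, ordered by inclusion, and $\mathrm{Lat}(P)\preceq \mathrm{Lat}(Q)$ means that there is a map $h:\mathrm{Lat}(P)\to \mathrm{Lat}(Q)$ with $F_1\subseteq F_2\iff h(F_1)\subseteq h(F_2)$. For a strictly increasing $g:\mathbb N\to\mathbb N$ put $C(d,N,g)=\{(t,t^2,\dots,t^d): t=g(i),\ 1\le i\le N\}$; its convex hull is a cyclic polytope. For $Z\subseteq\{0,1\}^d$ the cyclic perturbation of $Z$ is $\mathrm{CP}(Z)=\{2^{d^3}x+(n(x),n(x)^2,\dots,n(x)^d): x\in Z\}$, where $n(x)=\sum_{i=1}^d2^{i-1}x_i$. A monotone combinatorial characteristic of complexity is a function $f(X)=f(\mathrm{Lat}(\mathrm{conv}\,X),\mathrm{ES}(X))\in\mathbb N$ that depends only on the isomorphism type of the face lattice and on the encoding size, is nondecreasing in the encoding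 size, and satisfies $f(\mathrm{Lat}(P),s)\le f(\mathrm{Lat}(\mathrm{conv}\,C(2d,n,g)),s)$ for all $s$, all strictly increasing $g$ and every simplicial $d$-polytope $P\subset\mathbb R^d$ with $n$ vertices. Theorem. There are Boolean functions $b_d:\{0,1\}^d\to\{0,1\}$ ($d\in\mathbb N$) that require Boolean circuits of size $2^{\Omega(d)}$, and a strictly increasing function $g:\mathbb N\to\mathbb N$, computable in time polynomial in the number of bits of its argument, such that the problems $X_d=\mathrm{CP}(\{z: b_d(z)=1\})\subset\mathbb Z^d$ and $Y_d=C(2d,|X_d|,g)\subset\mathbb Z^{2d}$ have the following properties. (1) The family $(X_d)$ is intractable: already for the input vectors $c\in\{-1,1\}^d$, Boolean circuits that compute $\max_{x\in X_d}c^Tx$ need size $2^{\Omega(d)}$; in particular $(X_d)_{d\ge1}$ is not polynomially solvable in the sense of (3). (2) $\mathrm{ES}(X_d)=O(d^3)$ for $d\ge1$, and for every $d\ge 1$ the polytope $\mathrm{conv}\,X_d$ is a simplicial $d$-polytope with vertex set $X_d$, and $g(|X_d|)=2^{\mathrm{ES}(X_d)}$. (3) The family $(Y_d)_{d\ge1}$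 is polynomially solvable: a single algorithm computes $\max_{y\in Y_d}c^Ty$ from $d\ge1$ and $c\in\mathbb Z^{2d}$ in time polynomial in $d$ and the number of bits of $c$. (4) For every $d\ge1$, $f(X_d)\le f(Y_d)$ for every monotone combinatorial characteristic of complexity $f$; moreover $\mathrm{Lat}(\mathrm{conv}\,X_d)\preceq\mathrm{Lat}(\mathrm{conv}\,Y_d)$ and $\mathrm{ES}(X_d)\le\mathrm{ES}(Y_d)$. -/

import Mathlib

open scoped BigOperators

namespace PolyOpt

/-! ## Optimization problems, encoding size, polytopes and face lattices -/

/-- The real points given by a finite set of integer points. -/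
def realPoints {d : ℕ} (X : Finset (Fin d → ℤ)) : Set (Fin d → ℝ) :=
  (fun (x : Fin d → ℤ) (i : Fin d) => (x i : ℝ)) '' (X : Set (Fin d → ℤ))

/-- The polytope `conv X` of a problem `X`. -/
def conv {d : ℕ} (X : Finset (Fin d → ℤ)) : Set (Fin d → ℝ) :=
  convexHull ℝ (realPoints X)

/-- `max_{x ∈ X} ‖x‖_∞`. -/
def maxNorm {d : ℕ} (X : Finset (Fin d → ℤ)) : ℕ :=
  X.sup fun x => Finset.univ.sup fun i => (x i).natAbs

/-- The encoding size `log₂ (max_{x ∈ X} ‖x‖_∞)`. -/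
noncomputable def encSize {d : ℕ} (X : Finset (Fin d → ℤ)) : ℝ :=
  Real.logb 2 (maxNorm X)

/-- `v` is the optimal value of the problem `X` for the input vector `c`. -/
def IsOptValue {d : ℕ} (X : Finset (Fin d → ℤ)) (c : Fin d → ℤ) (v : ℤ) : Prop :=
  IsGreatest ((fun x : Fin d → ℤ => ∑ i, c i * x i) '' (X : Set (Fin d → ℤ))) v

/-- The face lattice of a polytope, without the improper faces `∅` and `P`, ordered by inclusion.
A face is the set of maximizers over `P` of a linear functional. -/
abbrev FaceLattice {d : ℕ} (P : Set (Fin d → ℝ)) : Type :=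
  {F : Set (Fin d → ℝ) // IsExposed ℝ P F ∧ F.Nonempty ∧ F ≠ P}

/-- `P` is a simplicial `d`-polytope in `ℝ^d`: the convex hull of its finitely many vertices,
of full dimension, and such that each proper face is a simplex. -/
structure IsSimplicialPolytope {d : ℕ} (P : Set (Fin d → ℝ)) : Prop where
  finite : (P.extremePoints ℝ).Finite
  hull : convexHull ℝ (P.extremePoints ℝ) = P
  full : affineSpan ℝ P = ⊤
  simplex : ∀ F : FaceLattice P,
    AffineIndependent ℝ (Subtype.val : (F.1.extremePoints ℝ) → (Fin d → ℝ))

/-- The set `C(d, N, g) = {(t, t², …, t^d) : t = g(i), 1 ≤ i ≤ N}`. -/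
def cyclicSet (d N : ℕ) (g : ℕ → ℕ) : Finset (Fin d → ℤ) :=
  (Finset.Icc 1 N).image fun i (j : Fin d) => ((g i : ℤ)) ^ ((j : ℕ) + 1)

/-- A monotone combinatorial characteristic of complexity: a natural number `val L s` depending on
(the isomorphism type of) a face lattice `L` and on an encoding size `s`. It is nondecreasing in `s`,
and its value on the face lattice of a simplicial `d`-polytope with `n` vertices does not exceed its
value on the face lattice of a cyclic polytope `C(2d, n)`. -/
structure MonotoneCharacteristic where
  val : (L : Type) → [PartialOrder L] → ℝ → ℕ
  iso : ∀ (L M : Type) [PartialOrder L] [PartialOrder M], Nonempty (L ≃o M) →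
    ∀ s : ℝ, val L s = val M s
  mono_lattice : ∀ (d : ℕ) (P : Set (Fin d → ℝ)), IsSimplicialPolytope P →
    ∀ g : ℕ → ℕ, StrictMono g → ∀ s : ℝ,
      val (FaceLattice P) s ≤
        val (FaceLattice (conv (cyclicSet (2 * d) (P.extremePoints ℝ).ncard g))) s
  mono_size : ∀ (L : Type) [PartialOrder L] (s t : ℝ), s ≤ t → val L s ≤ val L t

/-- The value `f(X) = f(Lat(conv X), ES(X))` of a characteristic on a problem. -/
noncomputable def MonotoneCharacteristic.onProblem (f : MonotoneCharacteristic) {d : ℕ}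
    (X : Finset (Fin d → ℤ)) : ℕ :=
  f.val (FaceLattice (conv X)) (encSize X)

/-! ## Cyclic perturbation -/

/-- `n(x) = ∑ 2^(i-1) x_i`. -/
def binNumber {d : ℕ} (x : Fin d → Bool) : ℕ :=
  ∑ i : Fin d, 2 ^ (i : ℕ) * (x i).toNat

/-- The cyclic perturbation `{K x + (n(x), n(x)², …, n(x)^d) : x ∈ Z}` with `K = 2^(d³)`. -/
def cyclicPerturbation {d : ℕ} (Z : Finset (Fin d → Bool)) : Finset (Fin d → ℤ) :=
  Z.image fun x (j : Fin d) =>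
    2 ^ (d ^ 3) * ((x j).toNat : ℤ) + (binNumber x : ℤ) ^ ((j : ℕ) + 1)

/-- The support of a Boolean function. -/
def support {d : ℕ} (b : (Fin d → Bool) → Bool) : Finset (Fin d → Bool) :=
  Finset.univ.filter fun x => b x = true

/-! ## Boolean circuits -/

/-- A Boolean circuit with `n` inputs and `s` gates. Wires `0, …, n-1` are the inputs; the gate added
as number `k` has an arbitrary binary operation as its label, reads two of the wires
`0, …, n+k-1`, and drives wire `n+k`. -/
inductive Circuit (n : ℕ) : ℕ → Type
  | nil : Circuit n 0
  | gate {s : ℕ} (C : Circuit n s) (op : Bool → Bool → Bool) (l r : Fin (n + s)) :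
      Circuit n (s + 1)

/-- The values of all wires on the input `x`. -/
def Circuit.eval {n : ℕ} : {s : ℕ} → Circuit n s → (Fin n → Bool) → Fin (n + s) → Bool
  | _, .nil, x => x
  | _, .gate C op l r, x => Fin.snoc (α := fun _ => Bool) (C.eval x) (op (C.eval x l) (C.eval x r))

/-- The integer with the given two's complement representation (least significant bit first). -/
def signedValue {m : ℕ} (w : Fin (m + 1) → Bool) : ℤ :=
  ∑ i : Fin m, 2 ^ (i : ℕ) * ((w i.castSucc).toNat : ℤ) - 2 ^ m * ((w (Fin.last m)).toNat : ℤ)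

/-- The vector `c(x) ∈ {-1, 1}^d`, `c(x)_i = 2 x_i - 1`. -/
def signVector {d : ℕ} (x : Fin d → Bool) : Fin d → ℤ :=
  fun i => 2 * ((x i).toNat : ℤ) - 1

/-- The family `b` of Boolean functions requires circuits of size `2^Ω(d)`. -/
def RequiresExpCircuits (b : ∀ d : ℕ, (Fin d → Bool) → Bool) : Prop :=
  ∃ δ : ℝ, 0 < δ ∧ ∀ᶠ d : ℕ in Filter.atTop,
    ∀ (s : ℕ) (C : Circuit d s) (o : Fin (d + s)),
      (∀ x, C.eval x o = b d x) → (2 : ℝ) ^ (δ * d) ≤ s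

/-- The family `X` of problems is intractable: already for the input vectors `c ∈ {-1, 1}^d`
(given by their `d` sign bits), circuits that output the optimal value in binary need
size `2^Ω(d)`. -/
def Intractable (X : ∀ d : ℕ, Finset (Fin d → ℤ)) : Prop :=
  ∃ δ : ℝ, 0 < δ ∧ ∀ᶠ d : ℕ in Filter.atTop,
    ∀ (s : ℕ) (C : Circuit d s) (m : ℕ) (out : Fin (m + 1) → Fin (d + s)),
      (∀ x, IsOptValue (X d) (signVector x) (signedValue fun k => C.eval x (out k))) →
        (2 : ℝ) ^ (δ * d) ≤ s

/-! ## Algorithms: random access programs with bit cost -/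

/-- Memory: cell `i` of array `a` holds the integer `σ a i`. -/
abbrev Memory : Type := ℕ → ℕ → ℤ

/-- Number of bits of an integer, with sign. -/
def bitLen (z : ℤ) : ℕ := z.natAbs.size + 1

/-- Arithmetic expressions. -/
inductive Expr : Type
  | const (z : ℤ) : Expr
  | read (a : ℕ) (i : Expr) : Expr
  | add (e f : Expr) : Expr
  | sub (e f : Expr) : Expr
  | mul (e f : Expr) : Expr
  | div (e f : Expr) : Expr

/-- Value of an expression. -/
def Expr.val (σ : Memory) : Expr → ℤ
  | .const z => z
  | .read a i => σ a (i.val σ).toNat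
  | .add e f => e.val σ + f.val σ
  | .sub e f => e.val σ - f.val σ
  | .mul e f => e.val σ * f.val σ
  | .div e f => e.val σ / f.val σ

/-- Bit cost of evaluating an expression: linear in the number of bits for addition, subtraction and
memory access (addresses included), quadratic for multiplication and division. -/
def Expr.cost (σ : Memory) : Expr → ℕ
  | .const z => bitLen z
  | .read a i => i.cost σ + bitLen (i.val σ) + bitLen (σ a (i.val σ).toNat)
  | .add e f => e.cost σ + f.cost σ + (bitLen (e.val σ) + bitLen (f.val σ))
  | .sub e f => e.cost σ + f.cost σ + (bitLen (e.val σ) + bitLen (f.val σ))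
  | .mul e f => e.cost σ + f.cost σ + bitLen (e.val σ) * bitLen (f.val σ)
  | .div e f => e.cost σ + f.cost σ + bitLen (e.val σ) * bitLen (f.val σ)

/-- Programs. `store a i e` writes the value of `e` to cell `i` of array `a`; the conditions of
`ite` and `loop` are of the form `e > 0`. -/
inductive Prog : Type
  | skip : Prog
  | store (a : ℕ) (i e : Expr) : Prog
  | seq (p q : Prog) : Prog
  | ite (e : Expr) (p q : Prog) : Prog
  | loop (e : Expr) (p : Prog) : Prog

/-- Writing to one memory cell. -/
def Memory.set (σ : Memory) (a i : ℕ) (z : ℤ) : Memory :=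
  fun a' i' => if a' = a ∧ i' = i then z else σ a' i'

/-- `Exec p σ τ t`: the program `p`, started on the memory `σ`, halts with the memory `τ`
after time (bit cost) `t`. -/
inductive Exec : Prog → Memory → Memory → ℕ → Prop
  | skip (σ : Memory) : Exec .skip σ σ 1
  | store (a : ℕ) (i e : Expr) (σ : Memory) :
      Exec (.store a i e) σ (σ.set a (i.val σ).toNat (e.val σ))
        (i.cost σ + e.cost σ + bitLen (i.val σ) + bitLen (e.val σ))
  | seq {p q : Prog} {σ τ υ : Memory} {t u : ℕ} (hp : Exec p σ τ t) (hq : Exec q τ υ u) :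
      Exec (.seq p q) σ υ (t + u)
  | ite_true {e : Expr} {p : Prog} (q : Prog) {σ τ : Memory} {t : ℕ} (he : 0 < e.val σ)
      (hp : Exec p σ τ t) : Exec (.ite e p q) σ τ (e.cost σ + bitLen (e.val σ) + t)
  | ite_false {e : Expr} (p : Prog) {q : Prog} {σ τ : Memory} {t : ℕ} (he : ¬ 0 < e.val σ)
      (hq : Exec q σ τ t) : Exec (.ite e p q) σ τ (e.cost σ + bitLen (e.val σ) + t)
  | loop_true {e : Expr} {p : Prog} {σ τ υ : Memory} {t u : ℕ} (he : 0 < e.val σ)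
      (hp : Exec p σ τ t) (hl : Exec (.loop e p) τ υ u) :
      Exec (.loop e p) σ υ (e.cost σ + bitLen (e.val σ) + t + u)
  | loop_false {e : Expr} (p : Prog) {σ : Memory} (he : ¬ 0 < e.val σ) :
      Exec (.loop e p) σ σ (e.cost σ + bitLen (e.val σ))

/-- Initial memory for the inputs `n` (in array `0`) and `c` (in array `1`). -/
def inputMemory {m : ℕ} (n : ℕ) (c : Fin m → ℤ) : Memory :=
  fun a i => if a = 0 ∧ i = 0 then (n : ℤ)
    else if h : a = 1 ∧ i < m then c ⟨i, h.2⟩ else 0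

/-- `g` is computable in time polynomial in the number of bits of its argument. -/
def PolyTimeComputable (g : ℕ → ℕ) : Prop :=
  ∃ (p : Prog) (q : Polynomial ℕ), ∀ n : ℕ, ∃ (τ : Memory) (t : ℕ),
    Exec p (inputMemory n (Fin.elim0 : Fin 0 → ℤ)) τ t ∧ τ 0 0 = (g n : ℤ) ∧ t ≤ q.eval n.size

/-- The family `X` of problems (with `X d ⊆ ℤ^(k d)`, `d ≥ 1`) is polynomially solvable: a single
program computes, from `d` and any input vector `c`, the optimal value of the problem `X d`
in time polynomial in `d` and the total number of bits of `c`. -/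
def PolySolvable (k : ℕ → ℕ) (X : ∀ d : ℕ, Finset (Fin (k d) → ℤ)) : Prop :=
  ∃ (p : Prog) (q : Polynomial ℕ), ∀ d : ℕ, 1 ≤ d → ∀ c : Fin (k d) → ℤ,
    ∃ (τ : Memory) (t : ℕ), Exec p (inputMemory d c) τ t ∧ IsOptValue (X d) c (τ 0 0) ∧
      t ≤ q.eval (d + ∑ i, bitLen (c i))

end PolyOpt

open PolyOpt

namespace PolyOpt

/-! ## Total correctness of programs with time bounds -/

/-! Hardness is a counting argument. On the objective `signVector x` the factor `2^(d^3)` outweighs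
the perturbation, so the perturbed point of `x` is the unique maximizer among all perturbed cube
vertices (`signVector_lt`). Hence the optimal values at sign vectors determine the set `Z`
(`eq_of_isOptValue`), and a given circuit or program solves the problem of at most one `Z`. There
are at least `2^2^(d-1)` candidate sets, but far fewer circuits with less than `2^(d/4+1)` gates,
even with `d^3 + d + 2` outputs, and more outputs carry no information about values of this size. So
for `d ≥ 160` a single candidate avoids all small circuits for its indicator function, all small
circuits for its optimization problem, and all programs with number at most `d`
(`exists_hard_candidate`). The last clause diagonalizes over programs, so that unsolvability needs
no simulation of programs by circuits.

The candidates are normalized. They all have `2^(d-1) + 1` elements, so the cyclic problem depends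
on `d` alone and cannot hide the hard set. They all contain `(1, …, 1)`, so the maximal norm is
exactly `2^(d^3) + (2^d - 1)^d`; `nodeValue` takes this value at `2^(d-1) + 1`.

Geometry: modulo `2^(d^3)` the homogenized points of a cyclic perturbation lie on the moment curve,
and the Vandermonde determinant of `d + 1` distinct ones is nonzero and smaller than the modulus. So
any `d + 1` points are affinely independent, the polytope is simplicial, and a proper face has at
most `d` vertices. The cyclic polytope in dimension `2d` is `d`-neighborly: every set of at most `d`
vertices spans a face. Any bijection of the vertices therefore induces an embedding of face
lattices.

Solving the cyclic problem means maximizing `p(g(i))` over exponentially many `i`, where `deg p ≤ D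
= 2d`. The divided differences `f_j(i)` of `p` at `g(i), …, g(i+j)` satisfy `f_j(i+1) - f_j(i) =
(g(i+j+1) - g(i)) f_(j+1)(i)` (`dividedDiff_succ_sub`), so `f_j` is monotone between consecutive
sign changes of `f_(j+1)`. Since `f_(D+1) = 0`, one descends from `j = D` to `j = 0`, locating by
bisection at most one sign change in each interval of monotonicity. The maximum of `f_0` is attained
at one of the `D + 2` final breakpoints. All numbers involved have polynomially many bits. -/

theorem bitLen_le_of_abs_le {z : ℤ} {M : ℕ} (h : |z| ≤ (M : ℤ)) : bitLen z ≤ M.size + 1 := by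
  unfold bitLen
  have : z.natAbs ≤ M := by rw [Int.abs_eq_natAbs] at h; exact_mod_cast h
  exact Nat.add_le_add_right (Nat.size_le_size this) 1

/-- All values that occur in the evaluation of the expression have absolute value at most `M`. -/
def Expr.Within (σ : Memory) (M : ℕ) : Expr → Prop
  | .const z => |z| ≤ (M : ℤ)
  | .read a i => i.Within σ M ∧ |σ a (i.val σ).toNat| ≤ (M : ℤ)
  | .add e f => e.Within σ M ∧ f.Within σ M ∧ |e.val σ + f.val σ| ≤ (M : ℤ)
  | .sub e f => e.Within σ M ∧ f.Within σ M ∧ |e.val σ - f.val σ| ≤ (M : ℤ)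
  | .mul e f => e.Within σ M ∧ f.Within σ M ∧ |e.val σ * f.val σ| ≤ (M : ℤ)
  | .div e f => e.Within σ M ∧ f.Within σ M ∧ |e.val σ / f.val σ| ≤ (M : ℤ)

theorem Expr.Within.abs_val_le {σ : Memory} {M : ℕ} {e : Expr} (h : e.Within σ M) :
    |e.val σ| ≤ (M : ℤ) := by
  cases e with
  | const z => exact h
  | read a i => exact h.2
  | add e f => exact h.2.2
  | sub e f => exact h.2.2
  | mul e f => exact h.2.2
  | div e f => exact h.2.2

/-- The number of nodes, counted twice. -/
def Expr.weight : Expr → ℕ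
  | .const _ => 1
  | .read _ i => i.weight + 2
  | .add e f => e.weight + f.weight + 2
  | .sub e f => e.weight + f.weight + 2
  | .mul e f => e.weight + f.weight + 2
  | .div e f => e.weight + f.weight + 2

/-- A bound for the cost of an arithmetic operation on numbers of absolute value at most `M`. -/
def unitCost (M : ℕ) : ℕ := (M.size + 1) ^ 2

theorem size_le_unitCost (M : ℕ) : M.size + 1 ≤ unitCost M := by
  unfold unitCost; nlinarith

/-- An addition or a memory access handles two numbers of at most `M.size + 1` bits, hence costs at
most two units; a multiplication or division costs at most one. This is why `weight` charges two for
each inner node. -/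
theorem Expr.Within.cost_le {σ : Memory} {M : ℕ} {e : Expr} (h : e.Within σ M) :
    e.cost σ ≤ e.weight * unitCost M := by
  have hu := size_le_unitCost M
  induction e with
  | const z =>
    have := bitLen_le_of_abs_le (show |z| ≤ (M : ℤ) from h)
    simp only [Expr.cost, Expr.weight]; omega
  | read a i ih =>
    have h1 := ih h.1
    have h2 := bitLen_le_of_abs_le h.1.abs_val_le
    have h3 := bitLen_le_of_abs_le h.2
    simp only [Expr.cost, Expr.weight, Nat.add_mul]; omega
  | add e f ihe ihf =>
    have h1 := ihe h.1
    have h2 := ihf h.2.1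
    have h3 := bitLen_le_of_abs_le h.1.abs_val_le
    have h4 := bitLen_le_of_abs_le h.2.1.abs_val_le
    simp only [Expr.cost, Expr.weight, Nat.add_mul]; omega
  | sub e f ihe ihf =>
    have h1 := ihe h.1
    have h2 := ihf h.2.1
    have h3 := bitLen_le_of_abs_le h.1.abs_val_le
    have h4 := bitLen_le_of_abs_le h.2.1.abs_val_le
    simp only [Expr.cost, Expr.weight, Nat.add_mul]; omega
  | mul e f ihe ihf =>
    have h1 := ihe h.1
    have h2 := ihf h.2.1
    have h3 := Nat.mul_le_mul (bitLen_le_of_abs_le h.1.abs_val_le)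
      (bitLen_le_of_abs_le h.2.1.abs_val_le)
    rw [← pow_two] at h3
    change _ ≤ unitCost M at h3
    simp only [Expr.cost, Expr.weight, Nat.add_mul]; omega
  | div e f ihe ihf =>
    have h1 := ihe h.1
    have h2 := ihf h.2.1
    have h3 := Nat.mul_le_mul (bitLen_le_of_abs_le h.1.abs_val_le)
      (bitLen_le_of_abs_le h.2.1.abs_val_le)
    rw [← pow_two] at h3
    change _ ≤ unitCost M at h3
    simp only [Expr.cost, Expr.weight, Nat.add_mul]; omega

/-- Started on `σ`, the program `p` halts after at most `n` units of time on a memory with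
property `Q`, the unit being the cost of an operation on numbers of absolute value at most `M`. -/
def Run (M : ℕ) (p : Prog) (σ : Memory) (n : ℕ) (Q : Memory → Prop) : Prop :=
  ∃ (τ : Memory) (t : ℕ), Exec p σ τ t ∧ t ≤ n * unitCost M ∧ Q τ

namespace Run

variable {M : ℕ} {p q : Prog} {σ : Memory} {n m : ℕ} {Q R : Memory → Prop}

theorem weaken (h : Run M p σ n Q) (hn : n ≤ m) (hQ : ∀ τ, Q τ → R τ) : Run M p σ m R := by
  obtain ⟨τ, t, h1, h2, h3⟩ := h
  exact ⟨τ, t, h1, h2.trans (Nat.mul_le_mul_right _ hn), hQ τ h3⟩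

theorem mono (h : Run M p σ n Q) (hn : n ≤ m) : Run M p σ m Q := h.weaken hn fun _ => id

theorem post (h : Run M p σ n Q) (hQ : ∀ τ, Q τ → R τ) : Run M p σ n R := h.weaken le_rfl hQ

theorem store {a : ℕ} {i e : Expr} (hi : i.Within σ M) (he : e.Within σ M)
    (hQ : Q (σ.set a (i.val σ).toNat (e.val σ))) :
    Run M (.store a i e) σ (i.weight + e.weight + 2) Q := by
  refine ⟨_, _, Exec.store a i e σ, ?_, hQ⟩
  have h1 := hi.cost_le
  have h2 := he.cost_le
  have h3 := bitLen_le_of_abs_le hi.abs_val_le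
  have h4 := bitLen_le_of_abs_le he.abs_val_le
  have hu := size_le_unitCost M
  simp only [Nat.add_mul]; omega

theorem seq (h : Run M p σ n fun τ => Run M q τ m Q) : Run M (.seq p q) σ (n + m) Q := by
  obtain ⟨τ, t, h1, h2, υ, u, h3, h4, h5⟩ := h
  exact ⟨υ, t + u, h1.seq h3, by rw [Nat.add_mul]; omega, h5⟩

theorem ite {e : Expr} (he : e.Within σ M) (hp : 0 < e.val σ → Run M p σ n Q)
    (hq : ¬ 0 < e.val σ → Run M q σ n Q) : Run M (.ite e p q) σ (e.weight + 1 + n) Q := by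
  have h1 := he.cost_le
  have h2 := bitLen_le_of_abs_le he.abs_val_le
  have hu := size_le_unitCost M
  by_cases h : 0 < e.val σ
  · obtain ⟨τ, t, h3, h4, h5⟩ := hp h
    exact ⟨τ, _, Exec.ite_true q h h3, by simp only [Nat.add_mul]; omega, h5⟩
  · obtain ⟨τ, t, h3, h4, h5⟩ := hq h
    exact ⟨τ, _, Exec.ite_false p h h3, by simp only [Nat.add_mul]; omega, h5⟩

/-- Loops: `Inv k` is an invariant under which at most `k` rounds remain. -/
theorem loop {e : Expr} (Inv : ℕ → Memory → Prop) (K : ℕ) (hσ : Inv K σ)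
    (hI : ∀ k τ, Inv k τ → e.Within τ M ∧ (0 < e.val τ → ∃ l, k = l + 1 ∧ Run M p τ n (Inv l)) ∧
      (¬ 0 < e.val τ → Q τ)) :
    Run M (.loop e p) σ (K * (e.weight + 1 + n) + (e.weight + 1)) Q := by
  induction K generalizing σ with
  | zero =>
    obtain ⟨h0, h1, h2⟩ := hI 0 σ hσ
    have h3 := h0.cost_le
    have h4 := bitLen_le_of_abs_le h0.abs_val_le
    have hu := size_le_unitCost M
    by_cases h : 0 < e.val σ
    · obtain ⟨l, hl, _⟩ := h1 h
      omega
    · exact ⟨σ, _, Exec.loop_false p h, by simp only [Nat.add_mul]; omega, h2 h⟩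
  | succ K ih =>
    obtain ⟨h0, h1, h2⟩ := hI (K + 1) σ hσ
    have h3 := h0.cost_le
    have h4 := bitLen_le_of_abs_le h0.abs_val_le
    have hu := size_le_unitCost M
    by_cases h : 0 < e.val σ
    · obtain ⟨l, hl, τ, t, h5, h6, h7⟩ := h1 h
      obtain rfl : l = K := by omega
      obtain ⟨υ, u, h8, h9, h10⟩ := ih h7
      refine ⟨υ, _, Exec.loop_true h h5 h8, ?_, h10⟩
      simp only [Nat.add_mul, Nat.mul_add, one_mul] at h9 ⊢
      omega
    · refine ⟨σ, _, Exec.loop_false p h, ?_, h2 h⟩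
      simp only [Nat.add_mul]; omega

end Run

/-! ### Notation for programs -/

instance : Add Expr := ⟨Expr.add⟩
instance : Sub Expr := ⟨Expr.sub⟩
instance : Mul Expr := ⟨Expr.mul⟩
instance : Div Expr := ⟨Expr.div⟩

/-- The scalar variable stored in cell `0` of array `a`. -/
def rd (a : ℕ) : Expr := .read a (.const 0)

/-- Assignment to the scalar variable stored in cell `0` of array `a`. -/
def st (a : ℕ) (e : Expr) : Prog := .store a (.const 0) e

/-- Sequential composition of a list of programs. -/
def block : List Prog → Prog
  | [] => .skip
  | p :: l => .seq p (block l)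

section simps
variable (σ : Memory) (M : ℕ) (e f : Expr) (a : ℕ) (z : ℤ)

@[simp] theorem val_const : (Expr.const z).val σ = z := rfl
@[simp] theorem val_rd : (rd a).val σ = σ a 0 := rfl
@[simp] theorem val_read : (Expr.read a e).val σ = σ a (e.val σ).toNat := rfl
@[simp] theorem val_add : (e + f).val σ = e.val σ + f.val σ := rfl
@[simp] theorem val_sub : (e - f).val σ = e.val σ - f.val σ := rfl
@[simp] theorem val_mul : (e * f).val σ = e.val σ * f.val σ := rfl
@[simp] theorem val_div : (e / f).val σ = e.val σ / f.val σ := rfl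

@[simp] theorem within_const : (Expr.const z).Within σ M ↔ |z| ≤ (M : ℤ) := Iff.rfl
@[simp] theorem within_rd : (rd a).Within σ M ↔ |σ a 0| ≤ (M : ℤ) := by
  simp [rd, Expr.Within, Expr.val]
@[simp] theorem within_read : (Expr.read a e).Within σ M ↔
    e.Within σ M ∧ |σ a (e.val σ).toNat| ≤ (M : ℤ) := Iff.rfl
@[simp] theorem within_add : (e + f).Within σ M ↔
    e.Within σ M ∧ f.Within σ M ∧ |e.val σ + f.val σ| ≤ (M : ℤ) := Iff.rfl
@[simp] theorem within_sub : (e - f).Within σ M ↔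
    e.Within σ M ∧ f.Within σ M ∧ |e.val σ - f.val σ| ≤ (M : ℤ) := Iff.rfl
@[simp] theorem within_mul : (e * f).Within σ M ↔
    e.Within σ M ∧ f.Within σ M ∧ |e.val σ * f.val σ| ≤ (M : ℤ) := Iff.rfl
@[simp] theorem within_div : (e / f).Within σ M ↔
    e.Within σ M ∧ f.Within σ M ∧ |e.val σ / f.val σ| ≤ (M : ℤ) := Iff.rfl

@[simp] theorem weight_const : (Expr.const z).weight = 1 := rfl
@[simp] theorem weight_rd : (rd a).weight = 3 := rfl
@[simp] theorem weight_read : (Expr.read a e).weight = e.weight + 2 := rfl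
@[simp] theorem weight_add : (e + f).weight = e.weight + f.weight + 2 := rfl
@[simp] theorem weight_sub : (e - f).weight = e.weight + f.weight + 2 := rfl
@[simp] theorem weight_mul : (e * f).weight = e.weight + f.weight + 2 := rfl
@[simp] theorem weight_div : (e / f).weight = e.weight + f.weight + 2 := rfl

@[simp] theorem set_apply (b i j : ℕ) :
    (σ.set a i z) b j = if b = a ∧ j = i then z else σ b j := rfl

end simps

theorem Run.skip {M : ℕ} {σ : Memory} {Q : Memory → Prop} (hQ : Q σ) : Run M .skip σ 1 Q :=
  ⟨σ, 1, Exec.skip σ, by have := size_le_unitCost M; omega, hQ⟩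

theorem Run.nil {M : ℕ} {σ : Memory} {Q : Memory → Prop} (hQ : Q σ) : Run M (block []) σ 1 Q :=
  Run.skip hQ

theorem Run.cons {M : ℕ} {σ : Memory} {Q : Memory → Prop} {p : Prog} {l : List Prog} {n m : ℕ}
    (h : Run M p σ n fun τ => Run M (block l) τ m Q) : Run M (block (p :: l)) σ (n + m) Q :=
  Run.seq h

theorem Run.assign {M : ℕ} {σ : Memory} {Q : Memory → Prop} {a : ℕ} {e : Expr}
    (he : e.Within σ M) (hQ : Q (σ.set a 0 (e.val σ))) :
    Run M (st a e) σ (e.weight + 3) Q := by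
  refine Run.mono (Run.store ?_ he hQ) (by simp only [weight_const]; omega)
  simp [within_const]

theorem Run.cons_assign {M : ℕ} {σ : Memory} {Q : Memory → Prop} {a m : ℕ} {e : Expr}
    {l : List Prog} (he : e.Within σ M) (hw : e.weight ≤ 97)
    (h : Run M (block l) (σ.set a 0 (e.val σ)) m Q) :
    Run M (block (st a e :: l)) σ (100 + m) Q :=
  Run.cons (Run.mono (Run.assign he h) (by omega))

theorem Run.cons_store {M : ℕ} {σ : Memory} {Q : Memory → Prop} {a m : ℕ} {i e : Expr}
    {l : List Prog} (hi : i.Within σ M) (he : e.Within σ M) (hw : i.weight + e.weight ≤ 98)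
    (h : Run M (block l) (σ.set a (i.val σ).toNat (e.val σ)) m Q) :
    Run M (block (.store a i e :: l)) σ (100 + m) Q :=
  Run.cons (Run.mono (Run.store hi he h) (by omega))

theorem Run.cons_seq {M : ℕ} {σ : Memory} {Q R : Memory → Prop} {n m : ℕ} {p : Prog}
    {l : List Prog} (hp : Run M p σ n R) (hl : ∀ τ, R τ → Run M (block l) τ m Q) :
    Run M (block (p :: l)) σ (n + m) Q :=
  Run.cons (hp.post hl)

/-! ## The nodes of the cyclic polytopes -/

/-- The strictly increasing function through the points `(2^(e-1) + 1, 2^(e³) + (2^e - 1)^e)` that has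
slope one between them. -/
def nodeValue (n : ℕ) : ℕ :=
  if n < 2 then n
  else 2 ^ ((Nat.log 2 (n - 1) + 1) ^ 3) + (2 ^ (Nat.log 2 (n - 1) + 1) - 1) ^ (Nat.log 2 (n - 1) + 1)
    + (n - 1 - 2 ^ Nat.log 2 (n - 1))

theorem nodeValue_of_two_le {n : ℕ} (h : 2 ≤ n) :
    nodeValue n = 2 ^ ((Nat.log 2 (n - 1) + 1) ^ 3) +
      (2 ^ (Nat.log 2 (n - 1) + 1) - 1) ^ (Nat.log 2 (n - 1) + 1)
      + (n - 1 - 2 ^ Nat.log 2 (n - 1)) := by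
  rw [nodeValue, if_neg (by omega)]

theorem nodeValue_two_pow_add_one (e : ℕ) :
    nodeValue (2 ^ e + 1) = 2 ^ ((e + 1) ^ 3) + (2 ^ (e + 1) - 1) ^ (e + 1) := by
  have : 1 ≤ 2 ^ e := Nat.one_le_two_pow
  rw [nodeValue_of_two_le (by omega)]
  simp [Nat.log_pow]

theorem pow_sub_one_pow_lt (e : ℕ) : (2 ^ (e + 1) - 1) ^ (e + 1) ≤ 2 ^ ((e + 1) ^ 3) := by
  calc (2 ^ (e + 1) - 1) ^ (e + 1) ≤ (2 ^ (e + 1)) ^ (e + 1) := Nat.pow_le_pow_left (Nat.sub_le _ _) _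
    _ = 2 ^ ((e + 1) ^ 2) := by rw [← pow_mul, pow_two]
    _ ≤ _ := Nat.pow_le_pow_right (by norm_num) (Nat.pow_le_pow_right (by omega) (by norm_num))

theorem le_cube_self (e : ℕ) : e + 1 ≤ (e + 1) ^ 3 := Nat.le_self_pow (by norm_num) _

/-- Inside a block `2^e ≤ n - 1 < 2^(e+1)` the slope is one. The values of the block stay below `3 *
2^((e+1)^3)`, while the next block starts above `2^((e+2)^3) ≥ 4 * 2^((e+1)^3)`. -/
theorem strictMono_nodeValue : StrictMono nodeValue := by
  refine strictMono_nat_of_lt_succ fun n => ?_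
  rcases lt_or_ge n 2 with h | h
  · interval_cases n
    · simp [nodeValue]
    · simp [nodeValue]
  obtain ⟨m, rfl⟩ : ∃ m, n = m + 1 := ⟨n - 1, by omega⟩
  rw [nodeValue_of_two_le h, nodeValue_of_two_le (by omega)]
  simp only [Nat.add_sub_cancel]
  have hm : m ≠ 0 := by omega
  have h1 : 2 ^ Nat.log 2 m ≤ m := Nat.pow_log_le_self 2 hm
  have h2 : m < 2 ^ (Nat.log 2 m + 1) := Nat.lt_pow_succ_log_self (by norm_num) m
  rcases Nat.lt_or_ge (m + 1) (2 ^ (Nat.log 2 m + 1)) with h3 | h3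
  · have : Nat.log 2 (m + 1) = Nat.log 2 m := by
      apply (Nat.log_eq_iff (Or.inr ⟨by norm_num, by omega⟩)).2
      exact ⟨by omega, h3⟩
    rw [this]
    omega
  · have : Nat.log 2 (m + 1) = Nat.log 2 m + 1 := by
      apply (Nat.log_eq_iff (Or.inr ⟨by norm_num, by omega⟩)).2
      refine ⟨by omega, ?_⟩
      rw [pow_succ]; omega
    rw [this]
    set e := Nat.log 2 m
    have h4 := pow_sub_one_pow_lt e
    have h5 : 2 ^ (e + 1) ≤ 2 ^ ((e + 1) ^ 3) := Nat.pow_le_pow_right (by norm_num) (le_cube_self e)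
    have h6 : 4 * 2 ^ ((e + 1) ^ 3) ≤ 2 ^ ((e + 1 + 1) ^ 3) := by
      rw [show 4 = 2 ^ 2 by norm_num, ← pow_add]
      exact Nat.pow_le_pow_right (by norm_num) (by ring_nf; omega)
    have h7 : 0 < 2 ^ ((e + 1) ^ 3) := by positivity
    rw [pow_succ 2 e] at *
    omega

/-! ### A program for the nodes -/

/-- Writes the node with the number in cell `20` to cell `27`. -/
def nodeProg : Prog :=
  block [
    st 21 (rd 20 - .const 1),
    st 22 (.const 1),
    st 23 (.const 1),
    .loop (rd 21 - .const 2 * rd 22 + .const 1)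
      (block [st 22 (.const 2 * rd 22), st 23 (rd 23 + .const 1)]),
    st 24 (.const 1),
    st 26 (rd 23 * (rd 23 * rd 23)),
    .loop (rd 26) (block [st 24 (.const 2 * rd 24), st 26 (rd 26 - .const 1)]),
    st 25 (.const 1),
    st 26 (rd 23),
    .loop (rd 26) (block [st 25 (rd 25 * (.const 2 * rd 22 - .const 1)), st 26 (rd 26 - .const 1)]),
    .ite (rd 21) (st 27 (rd 24 + rd 25 + (rd 21 - rd 22))) (st 27 (rd 20))]

theorem abs_le_of_bounds {z : ℤ} {M : ℕ} (h0 : 0 ≤ z) (h : z ≤ M) : |z| ≤ (M : ℤ) := by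
  rwa [abs_of_nonneg h0]

/-- Exponentiation with basis in `b` by a countdown in cell `c`, result in `a`. -/
theorem Run.power {M : ℕ} {σ : Memory} {a c : ℕ} (hac : a ≠ c) {e : Expr} {x k : ℕ}
    (ha : σ a 0 = 1) (hc : σ c 0 = k)
    (he : ∀ τ : Memory, (∀ b, b ≠ a → b ≠ c → τ b = σ b) →
      e.val τ = x * τ a 0 ∧ (|e.val τ| ≤ (M : ℤ) → |τ a 0| ≤ (M : ℤ) → e.Within τ M))
    (hx : 1 ≤ x) (hM : x ^ k ≤ M) (hk : k + 1 ≤ M) :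
    Run M (.loop (rd c) (block [st a e, st c (rd c - .const 1)])) σ (k * (e.weight + 20) + 4)
      fun τ => τ a 0 = (x : ℤ) ^ k ∧ ∀ b, b ≠ a → b ≠ c → τ b = σ b := by
  refine Run.mono (n := k * ((rd c).weight + 1 + (e.weight + 3 + (6 + 3 + 1))) + ((rd c).weight + 1))
    (Run.loop (fun l τ => ∃ j : ℕ, l + j = k ∧ τ a 0 = (x : ℤ) ^ j ∧ τ c 0 = l ∧
      ∀ b, b ≠ a → b ≠ c → τ b = σ b) k ⟨0, by omega, by simp [ha], hc, fun _ _ _ => rfl⟩ ?_) ?_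
  · rintro l τ ⟨j, hj, h1, h2, h3⟩
    have hx' : (1 : ℤ) ≤ x := by exact_mod_cast hx
    refine ⟨by rw [within_rd, h2]; exact abs_le_of_bounds (by positivity) (by exact_mod_cast (by omega)), ?_, ?_⟩
    · intro h4
      rw [val_rd, h2] at h4
      obtain ⟨l, rfl⟩ : ∃ i, l = i + 1 := ⟨l - 1, by omega⟩
      refine ⟨l, rfl, Run.cons (Run.assign ?_ (Run.cons (Run.assign ?_ (Run.nil ?_))))⟩
      · obtain ⟨h5, h6⟩ := he τ h3
        apply h6
        · rw [h5, h1]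
          refine abs_le_of_bounds (by positivity) ?_
          calc (x : ℤ) * x ^ j = x ^ (j + 1) := by ring
            _ ≤ x ^ k := pow_le_pow_right₀ hx' (by omega)
            _ ≤ M := by exact_mod_cast hM
        · rw [h1]
          refine abs_le_of_bounds (by positivity) ?_
          calc (x : ℤ) ^ j ≤ x ^ k := pow_le_pow_right₀ hx' (by omega)
            _ ≤ M := by exact_mod_cast hM
      · simp only [within_sub, within_rd, set_apply, within_const, val_rd, val_const, hac.symm, h2,
          false_and, if_false]
        refine ⟨?_, ?_, ?_⟩ <;> rw [abs_le] <;> push_cast <;> constructor <;> omega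
      · obtain ⟨h5, h6⟩ := he τ h3
        refine ⟨j + 1, by omega, ?_, ?_, ?_⟩
        · simp [set_apply, hac, h5, h1]; ring
        · simp [set_apply, hac.symm, h2]
        · intro b hb hb'
          funext i
          simp [set_apply, hb, hb', h3 b hb hb']
    · intro h4
      rw [val_rd, h2] at h4
      obtain rfl : l = 0 := by omega
      obtain rfl : j = k := by omega
      exact ⟨h1, h3⟩
  · simp only [weight_rd]
    ring_nf; omega

/-- Doubling as long as the result is at most `n - 1` leaves `2^e` in cell `22` and `e + 1` in cell
`23`, where `e = log₂ (n - 1)`. Both powers are then built by countdowns, of which the longer has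
`(e+1)^3` rounds; this gives the cubic time bound. No intermediate value exceeds a small multiple of
`n + nodeValue n + 2`. -/
theorem nodeProg_run {M n L : ℕ} {σ : Memory} (hn : σ 20 0 = n) (hL : Nat.log 2 (n - 1) + 1 ≤ L)
    (hM : 8 * (n + nodeValue n + 2) ≤ M) :
    Run M nodeProg σ (1000 * (L + 1) ^ 3)
      fun τ => τ 27 0 = nodeValue n ∧ ∀ a < 20, τ a = σ a := by
  set e := Nat.log 2 (n - 1) with he
  have hpos : 0 < 2 ^ e := by positivity
  have he3 : (e + 1) ^ 3 < 2 ^ ((e + 1) ^ 3) := Nat.lt_two_pow_self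
  have hb : 2 ^ ((e + 1) ^ 3) ≤ n + nodeValue n + 2 ∧
      (2 ^ (e + 1) - 1) ^ (e + 1) ≤ n + nodeValue n + 2 ∧ 2 ^ e ≤ n + nodeValue n + 2 := by
    rcases lt_or_ge n 2 with h | h
    · have : e = 0 := by rw [he, show n - 1 = 0 by omega]; simp
      rw [this]; simp
    · have := Nat.pow_log_le_self 2 (show n - 1 ≠ 0 by omega)
      rw [nodeValue_of_two_le h, ← he]
      rw [← he] at this
      refine ⟨by omega, by omega, by omega⟩
  obtain ⟨hb1, hb2, hb3⟩ := hb
  have he1 := le_cube_self e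
  have he2 : (e + 1) * (e + 1) ≤ (e + 1) ^ 3 := by
    rw [← pow_two]; exact Nat.pow_le_pow_right (by omega) (by norm_num)
  rw [nodeProg]
  set B := n + nodeValue n + 2 with hB
  refine Run.mono (n := 100 + (100 + (100 + ((e * (15 + 30) + 15) + (100 + (100 +
    (((e + 1) ^ 3 * 26 + 4) + (100 + (100 + (((e + 1) * 34 + 4) + (33 + 1))))))))))) ?_ ?_
  swap
  · have h1 : (e + 1) ^ 3 ≤ L ^ 3 := Nat.pow_le_pow_left hL 3
    have h2 : (L + 1) ^ 3 = L ^ 3 + 3 * L ^ 2 + 3 * L + 1 := by ring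
    have h3 : L ≤ L ^ 3 := Nat.le_self_pow (by norm_num) _
    omega
  refine Run.cons_assign ?_ (by simp) ?_
  · simp [hn, abs_le]; omega
  refine Run.cons_assign ?_ (by simp) ?_
  · simp; omega
  refine Run.cons_assign ?_ (by simp) ?_
  · simp; omega
  obtain ⟨E, hE⟩ : ∃ E, E = 2 ^ e := ⟨_, rfl⟩
  rw [← hE] at hb3 hpos
  refine Run.cons_seq (R := fun τ => τ 20 0 = n ∧ τ 21 0 = (n : ℤ) - 1 ∧
      τ 22 0 = (E : ℕ) ∧ τ 23 0 = (e + 1 : ℕ) ∧ ∀ a < 20, τ a = σ a)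
      (Run.mono (Run.loop (n := 30) (fun k τ => ∃ p P : ℕ, P = 2 ^ p ∧ p + k = e ∧ τ 20 0 = n ∧ τ 21 0 = (n : ℤ) - 1 ∧
      τ 22 0 = (P : ℕ) ∧ τ 23 0 = (p + 1 : ℕ) ∧ ∀ a < 20, τ a = σ a) e ?_ ?_) (by simp)) ?_
  · refine ⟨0, 1, by simp, by omega, by simp [hn], by simp [hn], by simp, by simp, ?_⟩
    intro a ha; funext i; simp; split_ifs <;> omega
  · rintro k τ ⟨p, P, hP, hp, h0, h1, h2, h3, h4⟩
    have hpe : P ≤ E := by rw [hP, hE]; exact Nat.pow_le_pow_right (by norm_num) (by omega)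
    have hp2 : p < P := by rw [hP]; exact Nat.lt_two_pow_self
    refine ⟨?_, ?_, ?_⟩
    · simp [h1, h2, abs_le, -Nat.cast_pow]; omega
    · intro h5
      simp [h1, h2, -Nat.cast_pow] at h5
      have h6 : 2 ^ (p + 1) ≤ n - 1 := by rw [pow_succ, ← hP]; omega
      have h7 : p + 1 ≤ e := (Nat.le_log_iff_pow_le (by norm_num) (by omega)).2 h6
      refine ⟨k - 1, by omega, Run.mono (Run.cons (Run.assign ?_ (Run.cons (Run.assign ?_ (Run.nil ?_))))) ?_⟩
      · simp [h2, -Nat.cast_pow]; omega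
      · simp [h3, abs_le, -Nat.cast_pow]; omega
      · refine ⟨p + 1, 2 * P, by rw [hP, pow_succ, mul_comm], by omega, by simp [h0], by simp [h1], by simp [h2], by simp [h3], ?_⟩
        intro a ha; funext i; simp; split_ifs <;> first | omega | rw [h4 a ha]
      · simp
    · intro h5
      simp [h1, h2, -Nat.cast_pow] at h5
      have : p = e := by
        rcases Nat.eq_zero_or_pos k with h | h
        · omega
        · exfalso
          have h6 : 2 ^ (p + 1) ≤ n - 1 := (Nat.le_log_iff_pow_le (by norm_num) (by
            intro h7; rw [h7] at he; simp at he; omega)).1 (by omega)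
          rw [pow_succ, ← hP] at h6; omega
      subst this
      subst hP
      subst hE
      exact ⟨h0, h1, h2, h3, h4⟩
  rintro τ ⟨h0, h1, h2, h3, h4⟩
  obtain ⟨ε, hε⟩ : ∃ ε, ε = e + 1 := ⟨_, rfl⟩
  rw [← hε] at he3 hb1 hb2 he1 he2 hL h3 ⊢
  obtain ⟨C, hC⟩ : ∃ C, C = ε ^ 3 := ⟨_, rfl⟩
  obtain ⟨Y, hY⟩ : ∃ Y, Y = 2 ^ C := ⟨_, rfl⟩
  obtain ⟨Z, hZ⟩ : ∃ Z, Z = (2 ^ ε - 1) ^ ε := ⟨_, rfl⟩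
  rw [← hC] at he3 hb1 he1 he2 ⊢
  rw [← hY] at he3 hb1
  rw [← hZ] at hb2
  refine Run.cons_assign ?_ (by simp) ?_
  · simp; omega
  refine Run.cons_assign ?_ (by simp) ?_
  · simp [h3]
    have h5 : (ε : ℤ) * ε ≤ C := by exact_mod_cast he2
    have h6 : (ε : ℤ) * (ε * ε) = C := by rw [hC]; push_cast; ring
    have h7 : (0 : ℤ) ≤ ε * ε := by positivity
    omega
  refine Run.cons_seq (Run.mono
      (Run.power (x := 2) (k := C) (by norm_num) ?_ ?_ ?_ (by norm_num) (by rw [← hY]; omega) (by omega)) (by simp)) ?_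
  · simp
  · simp [h3, hC]; ring
  · intro υ hυ
    refine ⟨by simp, fun h5 h6 => ?_⟩
    rw [within_mul, within_rd, within_const]
    exact ⟨by simp; omega, h6, h5⟩
  rintro υ ⟨g1, g2⟩
  have g3 (a : ℕ) (ha : a < 24) : υ a = τ a := by
    rw [g2 a (by omega) (by omega)]; funext i; simp; split_ifs <;> omega
  refine Run.cons_assign ?_ (by simp) ?_
  · simp; omega
  refine Run.cons_assign ?_ (by simp) ?_
  · simp [g3, h3, -Nat.cast_pow]; omega
  refine Run.cons_seq (Run.mono
      (Run.power (x := 2 ^ ε - 1) (k := ε) (by norm_num) ?_ ?_ ?_ ?_ (by rw [← hZ]; omega) (by omega)) (by simp)) ?_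
  · simp
  · simp [g3, h3]
  · intro ρ hρ
    have : ρ 22 0 = (E : ℕ) := by rw [hρ 22 (by norm_num) (by norm_num)]; simp [g3, h2]
    refine ⟨?_, fun h5 h6 => ?_⟩
    · simp [this, hE, hε, pow_succ]; ring
    rw [within_mul, within_rd]
    refine ⟨h6, ?_, h5⟩
    simp [this, abs_le]; omega
  · have : 2 ^ 1 ≤ 2 ^ ε := Nat.pow_le_pow_right (by norm_num) (by omega)
    omega
  rintro ρ ⟨f1, f2⟩
  have f3 (a : ℕ) (ha : a < 24) : ρ a = τ a := by
    rw [f2 a (by omega) (by omega), ← g3 a ha]; funext i; simp; split_ifs <;> omega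
  have f4 : ρ 24 0 = (Y : ℕ) := by
    rw [f2 24 (by omega) (by omega)]; simp [g1, hY]
  have f5 : ρ 25 0 = (Z : ℕ) := by
    rw [f1, hZ]; push_cast; rfl
  refine Run.cons_seq (R := fun τ => τ 27 0 = nodeValue n ∧ ∀ a < 20, τ a = σ a)
    (Run.mono (Run.ite (n := 25) ?_ ?_ ?_) (by simp)) fun τ hτ => Run.nil hτ
  · simp [f3, h1, abs_le]; omega
  · intro h5
    simp [f3, h1] at h5
    have := Nat.pow_log_le_self 2 (show n - 1 ≠ 0 by omega)
    rw [← he, ← hE] at this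
    have h6 : nodeValue n = Y + Z + (n - 1 - E) := by
      rw [nodeValue_of_two_le (by omega), ← he, ← hε, ← hC, ← hY, ← hZ, ← hE]
    refine Run.mono (Run.assign ?_ ⟨?_, ?_⟩) (by simp)
    · simp [f3, h1, h2, f4, f5, abs_le, -Nat.cast_pow]; omega
    · simp [f3, h1, h2, f4, f5]; omega
    · intro a ha; rw [← h4 a ha, ← f3 a (by omega)]; funext i; simp; omega
  · intro h5
    simp [f3, h1] at h5
    refine Run.mono (Run.assign ?_ ⟨?_, ?_⟩) (by simp)
    · simp [f3, h0]; omega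
    · rw [nodeValue, if_pos (by omega)]; simp [f3, h0]
    · intro a ha; rw [← h4 a ha, ← f3 a (by omega)]; funext i; simp; omega

/-! ## Divided differences -/

section DividedDifferences

open Polynomial

variable {R : Type*} [CommRing R]

theorem divByMonic_X_sub_C_eq [Nontrivial R] {p q : R[X]} {a r : R}
    (h : p = (X - C a) * q + C r) : p /ₘ (X - C a) = q := by
  refine (div_modByMonic_unique q (C r) (monic_X_sub_C a) ⟨by rw [h, add_comm], ?_⟩).1
  rw [degree_X_sub_C]
  exact degree_C_lt

theorem divByMonic_X_sub_C_spec (p : R[X]) (a : R) :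
    p = (X - C a) * (p /ₘ (X - C a)) + C (p.eval a) := by
  conv_lhs => rw [← modByMonic_add_div p (X - C a), modByMonic_X_sub_C_eq_C_eval, add_comm]

/-- Expanding `p = (X - a) ((X - b) B + A(b)) + p(a)` and regrouping around `X - b` exhibits the
quotient by `X - b` as `(X - a) B` plus a constant; uniqueness of division does the rest. -/
theorem divByMonic_X_sub_C_comm [Nontrivial R] (p : R[X]) (a b : R) :
    p /ₘ (X - C a) /ₘ (X - C b) = p /ₘ (X - C b) /ₘ (X - C a) := by
  set A := p /ₘ (X - C a) with hA
  set B := A /ₘ (X - C b) with hB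
  have h1 := divByMonic_X_sub_C_spec p a
  have h2 := divByMonic_X_sub_C_spec A b
  rw [← hA] at h1
  rw [← hB] at h2
  have h3 : p /ₘ (X - C b) = (X - C a) * B + C (A.eval b) := by
    apply divByMonic_X_sub_C_eq (r := A.eval b * (b - a) + p.eval a)
    conv_lhs => rw [h1, h2]
    simp only [C_add, C_mul, C_sub]
    ring
  exact (divByMonic_X_sub_C_eq h3).symm

/-- For `a ≠ b` both sides are the difference quotient of `p` at `a` and `b`. -/
theorem eval_divByMonic_X_sub_C_comm [IsDomain R] (p : R[X]) (a b : R) :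
    (p /ₘ (X - C a)).eval b = (p /ₘ (X - C b)).eval a := by
  by_cases h : a = b
  · rw [h]
  have h1 := congrArg (Polynomial.eval b) (divByMonic_X_sub_C_spec p a)
  have h2 := congrArg (Polynomial.eval a) (divByMonic_X_sub_C_spec p b)
  simp only [eval_add, eval_mul, eval_sub, eval_X, eval_C] at h1 h2
  refine mul_left_cancel₀ (sub_ne_zero.2 h) ?_
  linear_combination h1 + h2

/-- The iterated quotient of `p` by `X - t i, …, X - t (i + k - 1)`. -/
noncomputable def nodeQuotient (p : R[X]) (t : ℕ → R) (i : ℕ) : ℕ → R[X]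
  | 0 => p
  | k + 1 => nodeQuotient p t i k /ₘ (X - C (t (i + k)))

/-- The divided difference of `p` at the nodes `t i, …, t (i + j)`. -/
noncomputable def dividedDiff (p : R[X]) (t : ℕ → R) (j i : ℕ) : R :=
  (nodeQuotient p t i j).eval (t (i + j))

theorem nodeQuotient_succ [Nontrivial R] (p : R[X]) (t : ℕ → R) (i k : ℕ) :
    nodeQuotient p t i (k + 1) = nodeQuotient p t (i + 1) k /ₘ (X - C (t i)) := by
  induction k with
  | zero => simp [nodeQuotient]
  | succ k ih =>
    rw [nodeQuotient, ih, nodeQuotient, divByMonic_X_sub_C_comm, add_right_comm i 1 k, add_assoc i k 1]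

/-- Let `Q` be the quotient of `p` by the shared nodes `t (i+1), …, t (i+j)`. By symmetry the two
divided differences on the left are `Q(t (i+j+1))` and `Q(t i)`, and dividing `Q` by `X - t i` gives
the claim. Working with polynomial quotients avoids fractions, so integer nodes yield integer
divided differences. -/
theorem dividedDiff_succ_sub [IsDomain R] (p : R[X]) (t : ℕ → R) (j i : ℕ) :
    dividedDiff p t j (i + 1) - dividedDiff p t j i =
      (t (i + j + 1) - t i) * dividedDiff p t (j + 1) i := by
  have h1 : dividedDiff p t j i = (nodeQuotient p t (i + 1) j).eval (t i) := by
    cases j with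
    | zero => rfl
    | succ j =>
      rw [dividedDiff, nodeQuotient_succ, nodeQuotient, eval_divByMonic_X_sub_C_comm,
        add_right_comm i 1 j, add_assoc]
  have h2 := congrArg (Polynomial.eval (t (i + j + 1)))
    (divByMonic_X_sub_C_spec (nodeQuotient p t (i + 1) j) (t i))
  simp only [eval_add, eval_mul, eval_sub, eval_X, eval_C] at h2
  rw [h1, dividedDiff, dividedDiff, nodeQuotient_succ, add_right_comm i 1 j, ← add_assoc i j 1, h2]
  ring

theorem natDegree_nodeQuotient_le [Nontrivial R] (p : R[X]) (t : ℕ → R) (i k : ℕ) :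
    (nodeQuotient p t i k).natDegree ≤ p.natDegree - k := by
  induction k with
  | zero => simp [nodeQuotient]
  | succ k ih =>
    rw [nodeQuotient, natDegree_divByMonic _ (monic_X_sub_C _), natDegree_X_sub_C]
    omega

theorem dividedDiff_eq_zero [Nontrivial R] (p : R[X]) (t : ℕ → R) {j : ℕ} (h : p.natDegree < j) (i : ℕ) :
    dividedDiff p t j i = 0 := by
  obtain ⟨k, rfl⟩ : ∃ k, j = k + 1 := ⟨j - 1, by omega⟩
  have h1 := natDegree_nodeQuotient_le p t i k
  rw [dividedDiff, nodeQuotient, (divByMonic_eq_zero_iff (monic_X_sub_C _)).2, eval_zero]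
  rw [degree_X_sub_C, eq_C_of_natDegree_eq_zero (by omega : (nodeQuotient p t i k).natDegree = 0)]
  exact degree_C_lt

/-- The values in Horner's scheme: `p(a)` and the coefficients of the quotient by `X - a`. -/
noncomputable def hornerValue (p : R[X]) (a : R) : ℕ → R
  | 0 => p.eval a
  | m + 1 => (p /ₘ (X - C a)).coeff m

/-- Comparison of the coefficients of `X^m` in `p = (X - a) q + p(a)`. -/
theorem hornerValue_rec (p : R[X]) (a : R) (m : ℕ) :
    hornerValue p a m = hornerValue p a (m + 1) * a + p.coeff m := by
  have h := congrArg (fun q : R[X] => q.coeff m) (divByMonic_X_sub_C_spec p a)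
  cases m with
  | zero =>
    simp only [coeff_add, sub_mul, coeff_sub, coeff_C_mul, coeff_C_zero, coeff_X_mul_zero] at h
    simp only [hornerValue]
    rw [h]; ring
  | succ m =>
    simp only [coeff_add, sub_mul, coeff_sub, coeff_C_mul, coeff_C_succ, coeff_X_mul] at h
    simp only [hornerValue]
    rw [h]; ring

theorem hornerValue_eq_zero [Nontrivial R] (p : R[X]) (a : R) {D : ℕ} (h : p.natDegree ≤ D) :
    hornerValue p a (D + 1) = 0 := by
  rw [hornerValue]
  by_cases h0 : D = 0
  · subst h0
    rw [(divByMonic_eq_zero_iff (monic_X_sub_C _)).2, coeff_zero]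
    rw [degree_X_sub_C, eq_C_of_natDegree_eq_zero (by omega : p.natDegree = 0)]
    exact degree_C_lt
  · apply coeff_eq_zero_of_natDegree_lt
    rw [natDegree_divByMonic _ (monic_X_sub_C _), natDegree_X_sub_C]
    omega

/-- The recursion runs downwards from the value `0` at index `D + 1`. A step multiplies by at most
`T` and adds at most `A`, which is itself below the current bound, so it costs a factor `1 + T`. -/
theorem abs_hornerValue_le (p : ℤ[X]) (a : ℤ) {D A T : ℕ} (h : p.natDegree ≤ D)
    (hA : ∀ m, |p.coeff m| ≤ A) (ha : |a| ≤ T) {k m : ℕ} (hm : m + k = D + 1) :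
    |hornerValue p a m| ≤ (A * (1 + T) ^ k : ℕ) := by
  induction k generalizing m with
  | zero =>
    obtain rfl : m = D + 1 := by omega
    rw [hornerValue_eq_zero p a h]
    simp
  | succ k ih =>
    have h1 := ih (m := m + 1) (by omega)
    rw [hornerValue_rec]
    have h2 : (A : ℤ) ≤ (A * (1 + T) ^ k : ℕ) := by
      exact_mod_cast Nat.le_mul_of_pos_right _ (by positivity)
    calc |hornerValue p a (m + 1) * a + p.coeff m|
        ≤ |hornerValue p a (m + 1)| * |a| + |p.coeff m| := by
          rw [← abs_mul]; exact abs_add_le _ _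
      _ ≤ (A * (1 + T) ^ k : ℕ) * T + (A * (1 + T) ^ k : ℕ) := by
          gcongr
          exact (hA m).trans h2
      _ = _ := by push_cast; ring

theorem abs_coeff_divByMonic_le (p : ℤ[X]) (a : ℤ) {D A T : ℕ} (h : p.natDegree ≤ D)
    (hA : ∀ m, |p.coeff m| ≤ A) (ha : |a| ≤ T) (m : ℕ) :
    |(p /ₘ (X - C a)).coeff m| ≤ (A * (1 + T) ^ (D + 1) : ℕ) := by
  by_cases hm : m ≤ D
  · refine (abs_hornerValue_le p a h hA ha (m := m + 1) (k := D - m) (by omega)).trans ?_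
    exact_mod_cast Nat.mul_le_mul_left _ (Nat.pow_le_pow_right (by omega) (by omega))
  · rw [coeff_eq_zero_of_natDegree_lt, abs_zero]
    · positivity
    rw [natDegree_divByMonic _ (monic_X_sub_C _), natDegree_X_sub_C]
    omega

/-- Each of the `k` divisions multiplies the coefficient bound by `(1 + T)^(D+1)`. -/
theorem abs_coeff_nodeQuotient_le (p : ℤ[X]) (t : ℕ → ℤ) (i : ℕ) {D A T k : ℕ} (h : p.natDegree ≤ D)
    (hA : ∀ m, |p.coeff m| ≤ A) (ht : ∀ l < k, |t (i + l)| ≤ T) (m : ℕ) :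
    |(nodeQuotient p t i k).coeff m| ≤ (A * (1 + T) ^ ((D + 1) * k) : ℕ) := by
  induction k generalizing m with
  | zero => simpa [nodeQuotient] using hA m
  | succ k ih =>
    have := abs_coeff_divByMonic_le (D := D) (nodeQuotient p t i k) (t (i + k))
      ((natDegree_nodeQuotient_le p t i k).trans (by omega))
      (fun m => ih (fun l hl => ht l (by omega)) m) (ht k (by omega)) m
    rw [nodeQuotient]
    refine this.trans (le_of_eq ?_)
    push_cast; ring

end DividedDifferences

/-! ### A program for divided differences -/

section

open Polynomial

/-- Replaces the polynomial with coefficients in array `12` (of degree at most the content of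
cell `2`) by its quotient by `X - t`, where `t` is the content of cell `27`, and writes its value
at `t` to cell `15`. -/
def synthDivProg : Prog :=
  block [
    st 15 (.const 0),
    st 14 (rd 2 + .const 1),
    .loop (rd 14)
      (block [
        st 16 (rd 15 * rd 27 + .read 12 (rd 14 - .const 1)),
        .store 12 (rd 14 - .const 1) (rd 15),
        st 15 (rd 16),
        st 14 (rd 14 - .const 1)])]

/-- Horner's scheme in place: when cell `14` holds `k`, cell `15` holds the Horner value with index
`k`, array `12` still has the coefficients of `p` below `k`, and from `k` on it has those of the
quotient. A coefficient is read just before its cell is overwritten. -/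
theorem synthDivProg_run {M D A T : ℕ} {σ : Memory} {p : ℤ[X]} {t : ℤ} (hD : σ 2 0 = D)
    (ht : σ 27 0 = t) (hp : p.natDegree ≤ D) (hw : ∀ m ≤ D, σ 12 m = p.coeff m)
    (hA : ∀ m, |p.coeff m| ≤ A) (hT : |t| ≤ T) (hM : A * (1 + T) ^ (D + 1) ≤ M)
    (hTM : T ≤ M) (hDM : D + 1 ≤ M) :
    Run M synthDivProg σ (500 * (D + 2))
      fun τ => τ 15 0 = p.eval t ∧ (∀ m ≤ D, τ 12 m = (p /ₘ (X - C t)).coeff m) ∧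
        ∀ a, a ≠ 12 → a ≠ 14 → a ≠ 15 → a ≠ 16 → τ a = σ a := by
  have hAM : A ≤ M := le_trans (Nat.le_mul_of_pos_right _ (by positivity)) hM
  have hmon : ∀ k ≤ D + 1, A * (1 + T) ^ k ≤ M := fun k hk =>
    (Nat.mul_le_mul_left _ (Nat.pow_le_pow_right (by omega) hk)).trans hM
  rw [synthDivProg]
  refine Run.mono (n := 100 + (100 + (((D + 1) * 405 + 4) + 1))) ?_ (by omega)
  refine Run.cons_assign (by simp) (by simp) ?_
  refine Run.cons_assign ?_ (by simp) ?_
  · simp [hD, abs_le]; omega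
  refine Run.cons_seq (R := fun τ => τ 15 0 = p.eval t ∧
      (∀ m ≤ D, τ 12 m = (p /ₘ (X - C t)).coeff m) ∧
        ∀ a, a ≠ 12 → a ≠ 14 → a ≠ 15 → a ≠ 16 → τ a = σ a)
    (Run.mono (Run.loop (n := 401) (fun k τ => k ≤ D + 1 ∧ τ 14 0 = k ∧ τ 15 0 = hornerValue p t k ∧
      (∀ m < k, τ 12 m = p.coeff m) ∧ (∀ m, k ≤ m → m ≤ D → τ 12 m = hornerValue p t (m + 1)) ∧
        ∀ a, a ≠ 12 → a ≠ 14 → a ≠ 15 → a ≠ 16 → τ a = σ a) (D + 1) ?_ ?_) (by simp))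
    fun τ h => Run.nil h
  · refine ⟨le_rfl, by simp [hD], by simp [hornerValue_eq_zero p t hp], ?_, ?_, ?_⟩
    · intro m hm
      rw [← hw m (by omega)]; simp
    · intro m h1 h2; omega
    · intro a h1 h2 h3 h4; funext i; simp [h2, h3]
  · rintro k τ ⟨hk, h1, h2, h3, h4, h5⟩
    have h27 : τ 27 0 = t := by rw [h5 27 (by norm_num) (by norm_num) (by norm_num) (by norm_num), ht]
    refine ⟨?_, ?_, ?_⟩
    · simp [h1]; omega
    · intro hk0
      simp [h1] at hk0
      obtain ⟨l, rfl⟩ : ∃ l, k = l + 1 := ⟨k - 1, by omega⟩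
      have hl : τ 14 0 - 1 = l := by rw [h1]; push_cast; ring
      have b1 := (abs_hornerValue_le p t hp hA hT (m := l + 1) (k := D - l) (by omega)).trans
        (Int.ofNat_le.2 (hmon _ (by omega)))
      have b2 := (abs_hornerValue_le p t hp hA hT (m := l) (k := D + 1 - l) (by omega)).trans
        (Int.ofNat_le.2 (hmon _ (by omega)))
      have b3 : |hornerValue p t (l + 1)| * |t| ≤ (M : ℤ) := by
        have b4 := abs_hornerValue_le p t hp hA hT (m := l + 1) (k := D - l) (by omega)
        calc |hornerValue p t (l + 1)| * |t| ≤ (A * (1 + T) ^ (D - l) : ℕ) * T := by gcongr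
          _ ≤ (A * (1 + T) ^ (D - l) : ℕ) * (1 + T) := by gcongr; omega
          _ = (A * (1 + T) ^ (D - l + 1) : ℕ) := by push_cast; ring
          _ ≤ M := Int.ofNat_le.2 (hmon _ (by omega))
      refine ⟨l, rfl, ?_⟩
      refine Run.mono (n := 100 + (100 + (100 + (100 + 1)))) ?_ (by omega)
      have b0 : |(l : ℤ)| ≤ M := abs_le_of_bounds (by positivity) (by omega)
      have b00 : |(l : ℤ) + 1| ≤ M := abs_le_of_bounds (by positivity) (by omega)
      have bt : |t| ≤ M := hT.trans (by exact_mod_cast hTM)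
      have ba : |p.coeff l| ≤ M := (hA l).trans (by exact_mod_cast hAM)
      have bone : (1 : ℤ) ≤ M := by omega
      have hrec := hornerValue_rec p t l
      refine Run.cons_assign ?_ (by simp) ?_
      · simp [h1, h2, h27, h3 l (by omega), b00, bt, ba, b1, b3, ← hrec, b2]
        omega
      refine Run.cons_store ?_ ?_ (by simp) ?_
      · simp [h1, b00]; omega
      · simp [h2, b1]
      refine Run.cons_assign ?_ (by simp) ?_
      · simp [h1, h2, h27, h3 l (by omega), ← hrec, b2]
      refine Run.cons_assign ?_ (by simp) ?_
      · simp [h1, b00]; omega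
      refine Run.nil ⟨by omega, ?_, ?_, ?_, ?_, ?_⟩
      · simp [h1]
      · simp [h1, h2, h27, h3 l (by omega), ← hrec]
      · intro m hm
        simp [h1]
        rw [if_neg (by omega), h3 m (by omega)]
      · intro m hm hm'
        simp [h1]
        by_cases hml : m = l
        · rw [if_pos hml, hml, h2]
        · rw [if_neg hml, h4 m (by omega) hm']
      · intro a ha1 ha2 ha3 ha4
        funext i
        simp [ha1, ha2, ha3, ha4]
        rw [h5 a ha1 ha2 ha3 ha4]
    · intro hk0
      simp [h1] at hk0
      subst hk0
      exact ⟨h2, fun m hm => h4 m (by omega) hm, h5⟩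

/-- The polynomial `c 0 X + c 1 X² + … + c (D - 1) X^D`. -/
noncomputable def objectivePoly (D : ℕ) (c : ℕ → ℤ) : ℤ[X] :=
  ∑ m ∈ Finset.range D, C (c m) * X ^ (m + 1)

theorem coeff_objectivePoly_zero (D : ℕ) (c : ℕ → ℤ) : (objectivePoly D c).coeff 0 = 0 := by
  simp [objectivePoly]

theorem coeff_objectivePoly_succ (D : ℕ) (c : ℕ → ℤ) (m : ℕ) :
    (objectivePoly D c).coeff (m + 1) = if m < D then c m else 0 := by
  simp [objectivePoly, coeff_X_pow]

theorem natDegree_objectivePoly_le (D : ℕ) (c : ℕ → ℤ) : (objectivePoly D c).natDegree ≤ D := by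
  rw [natDegree_le_iff_coeff_eq_zero]
  intro m hm
  obtain ⟨k, rfl⟩ : ∃ k, m = k + 1 := ⟨m - 1, by omega⟩
  rw [coeff_objectivePoly_succ, if_neg (by omega)]

theorem abs_coeff_objectivePoly_le {D A : ℕ} {c : ℕ → ℤ} (hA : ∀ m < D, |c m| ≤ A) (m : ℕ) :
    |(objectivePoly D c).coeff m| ≤ A := by
  cases m with
  | zero => simp [coeff_objectivePoly_zero]
  | succ m =>
    rw [coeff_objectivePoly_succ]
    split_ifs with h
    · exact hA m h
    · simp

/-- Writes the divided difference of the objective polynomial at the nodes with the numbers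
`i, …, i + j` to cell `15`, where `i` and `j` are the contents of cells `11` and `5`. -/
def dividedDiffProg : Prog :=
  block [
    .store 12 (.const 0) (.const 0),
    st 14 (rd 2),
    .loop (rd 14) (block [.store 12 (rd 14) (.read 1 (rd 14 - .const 1)), st 14 (rd 14 - .const 1)]),
    st 13 (.const 0),
    .loop (rd 5 + .const 1 - rd 13)
      (block [st 20 (rd 11 + rd 13), nodeProg, synthDivProg, st 13 (rd 13 + .const 1)])]

/-- A time bound for `dividedDiffProg`. -/
def dividedDiffTime (D L : ℕ) : ℕ := 1000 * (D + 2) * (D + 2 + (L + 1) ^ 3)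

/-- The first loop shifts the input by one place because `c m` belongs to `X^(m+1)`. Then `j + 1`
synthetic divisions follow; the last one yields the divided difference as its remainder. They cost
at most `D + 1` factors `(1 + T)^(D+1)`, whence the exponent in `hM`. -/
theorem dividedDiffProg_run {M D A T L i j I : ℕ} {σ : Memory} (hD : σ 2 0 = D)
    (hj : σ 5 0 = j) (hjD : j ≤ D) (hi : σ 11 0 = i) (hA : ∀ m < D, |σ 1 m| ≤ A)
    (hI : i + j ≤ I) (hL : Nat.log 2 I + 1 ≤ L) (hT : nodeValue I ≤ T) (hDM : D + 2 ≤ M)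
    (hTM : 8 * (I + T + 2) ≤ M) (hM : A * (1 + T) ^ ((D + 1) * (D + 1)) ≤ M) :
    Run M dividedDiffProg σ (dividedDiffTime D L)
      fun τ => τ 15 0 = dividedDiff (objectivePoly D (σ 1)) (fun l => (nodeValue l : ℤ)) j i ∧
        ∀ a < 12, τ a = σ a := by
  set p := objectivePoly D (σ 1) with hp
  have hAM : A ≤ M := le_trans (Nat.le_mul_of_pos_right _ (by positivity)) hM
  have hnode : ∀ l ≤ j, nodeValue (i + l) ≤ T := fun l hl =>
    (strictMono_nodeValue.monotone (by omega)).trans hT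
  rw [dividedDiffProg]
  refine Run.mono (n := 100 + (100 + ((D * 205 + 4) + (100 + (((D + 1) * (12 +
    (100 + (1000 * (L + 1) ^ 3 + (500 * (D + 2) + (100 + 1))))) + 12) + 1))))) ?_ ?_
  swap
  · rw [dividedDiffTime]
    generalize (L + 1) ^ 3 = Z
    nlinarith [sq_nonneg D, Nat.zero_le Z]
  refine Run.cons_store (by simp [Expr.Within]) (by simp [Expr.Within]) (by simp) ?_
  refine Run.cons_assign ?_ (by simp) ?_
  · simp [hD]; omega
  refine Run.cons_seq (R := fun τ => (∀ m ≤ D, τ 12 m = p.coeff m) ∧ ∀ a < 12, τ a = σ a)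
    (Run.mono (Run.loop (n := 201) (fun k τ => k ≤ D ∧ τ 14 0 = k ∧ τ 12 0 = 0 ∧
      (∀ m, k < m → m ≤ D → τ 12 m = p.coeff m) ∧ ∀ a < 12, τ a = σ a) D ?_ ?_) (by simp)) ?_
  · refine ⟨le_rfl, by simp [hD], by simp, fun m h1 h2 => by omega, ?_⟩
    intro a ha; funext i; simp; split_ifs <;> omega
  · rintro k τ ⟨hk, h1, h2, h3, h4⟩
    refine ⟨by simp [h1]; exact_mod_cast (by omega : k ≤ M), ?_, ?_⟩
    · intro hk0
      simp [h1] at hk0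
      obtain ⟨l, rfl⟩ : ∃ l, k = l + 1 := ⟨k - 1, by omega⟩
      have b0 : |(l : ℤ)| ≤ M := abs_le_of_bounds (by positivity) (by omega)
      have b00 : |(l : ℤ) + 1| ≤ M := abs_le_of_bounds (by positivity) (by omega)
      have bone : (1 : ℤ) ≤ M := by omega
      refine ⟨l, rfl, Run.cons_store ?_ ?_ (by simp) (Run.cons_assign ?_ (by simp)
        (Run.nil ⟨by omega, ?_, ?_, ?_, ?_⟩))⟩
      · simp [h1, b00]
      · simp [h1, b00, h4]
        exact ⟨by omega, (hA l (by omega)).trans (by exact_mod_cast hAM)⟩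
      · simp [h1, b00]; omega
      · simp [h1]
      · simp [h1, h2]
      · intro m hm hm'
        simp [h1]
        split_ifs with h5
        · have h6 : m = l + 1 := by omega
          rw [h4 1 (by norm_num), h6, hp, coeff_objectivePoly_succ, if_pos (by omega)]
        · exact h3 m (by omega) hm'
      · intro a ha; rw [← h4 a ha]; funext i; simp; split_ifs <;> omega
    · intro hk0
      simp [h1] at hk0
      subst hk0
      refine ⟨fun m hm => ?_, h4⟩
      cases m with
      | zero => rw [h2, hp, coeff_objectivePoly_zero]
      | succ m => exact h3 _ (by omega) hm
  rintro τ ⟨h1, h2⟩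
  refine Run.cons_assign (by simp) (by simp) ?_
  refine Run.cons_seq (R := fun τ => τ 15 0 = dividedDiff p (fun l => (nodeValue l : ℤ)) j i ∧
        ∀ a < 12, τ a = σ a)
    (Run.mono (Run.loop (n := 100 + (1000 * (L + 1) ^ 3 + (500 * (D + 2) + (100 + 1))))
      (fun r τ => ∃ k, r + k = j + 1 ∧ τ 13 0 = k ∧
      (∀ m ≤ D, τ 12 m = (nodeQuotient p (fun l => (nodeValue l : ℤ)) i k).coeff m) ∧
      (k = j + 1 → τ 15 0 = dividedDiff p (fun l => (nodeValue l : ℤ)) j i) ∧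
      ∀ a < 12, τ a = σ a) (j + 1) ?_ ?_) ?_) fun τ h => Run.nil h
  · refine ⟨0, rfl, by simp, fun m hm => ?_, fun h => by omega, ?_⟩
    · simp [nodeQuotient, h1 m hm]
    · intro a ha; rw [← h2 a ha]; funext i; simp; omega
  · rintro r υ ⟨k, hk, g1, g2, g3, g4⟩
    have b1 : |(j : ℤ) + 1| ≤ M := abs_le_of_bounds (by positivity) (by omega)
    have b2 : |(j : ℤ) + 1 - k| ≤ M := abs_le_of_bounds (by omega) (by omega)
    refine ⟨?_, ?_, ?_⟩
    · simp [g4, hj, g1, b1, b2]; omega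
    · intro hk0
      simp [g1, g4, hj] at hk0
      refine ⟨r - 1, by omega, ?_⟩
      refine Run.cons_assign ?_ (by simp) ?_
      · simp [g4, hi, g1, abs_le]; omega
      have hk' := hnode k (by omega)
      refine Run.cons_seq (nodeProg_run (n := i + k) (by simp [g4, hi, g1])
        ((Nat.add_le_add_right (Nat.log_mono_right (by omega)) 1).trans hL) (by omega)) ?_
      rintro ρ ⟨f1, f2⟩
      have f3 (a : ℕ) (ha : a < 20) : ρ a = υ a := by
        rw [f2 a ha]; funext i; simp; omega
      refine Run.cons_seq (synthDivProg_run (p := nodeQuotient p (fun l => (nodeValue l : ℤ)) i k)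
        (A := A * (1 + T) ^ ((D + 1) * k)) (T := T) (by rw [f3 2 (by norm_num), g4 2 (by norm_num), hD])
        f1 ?_ ?_ ?_ ?_ ?_ (by omega) (by omega)) ?_
      · exact (natDegree_nodeQuotient_le _ _ _ _).trans
          ((Nat.sub_le _ _).trans (natDegree_objectivePoly_le _ _))
      · intro m hm; rw [f3 12 (by norm_num), g2 m hm]
      · refine abs_coeff_nodeQuotient_le p _ i (natDegree_objectivePoly_le _ _)
          (abs_coeff_objectivePoly_le hA) ?_
        intro l hl
        rw [Nat.abs_cast]
        exact_mod_cast hnode l (by omega)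
      · rw [Nat.abs_cast]
        exact_mod_cast hk'
      · rw [mul_assoc, ← pow_add]
        refine le_trans (Nat.mul_le_mul_left _ (Nat.pow_le_pow_right (by omega) ?_)) hM
        calc (D + 1) * k + (D + 1) = (D + 1) * (k + 1) := by ring
          _ ≤ _ := Nat.mul_le_mul_left _ (by omega)
      rintro χ ⟨e1, e2, e3⟩
      have e4 (a : ℕ) (ha : a < 12) : χ a = σ a := by
        rw [e3 a (by omega) (by omega) (by omega) (by omega), f3 a (by omega), g4 a ha]
      have e5 : χ 13 0 = k := by
        rw [e3 13 (by omega) (by omega) (by omega) (by omega), f3 13 (by omega), g1]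
      refine Run.cons_assign ?_ (by simp) (Run.nil ⟨k + 1, by omega, by simp [e5], ?_, ?_, ?_⟩)
      · simp [e5, abs_le]; omega
      · intro m hm; simp [e2 m hm, nodeQuotient]
      · intro hkj
        obtain rfl : k = j := by omega
        simp [e1, dividedDiff]
      · intro a ha; rw [← e4 a ha]; funext i; simp; omega
    · intro hk0
      simp [g1, g4, hj] at hk0
      exact ⟨g3 (by omega), g4⟩
  · refine Nat.add_le_add (Nat.mul_le_mul (by omega) ?_) ?_ <;> simp

end

/-! ## Breakpoints of piecewise monotone sequences -/

/-- The sign of an integer, where `0` counts as positive. -/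
def sgn (x : ℤ) : ℤ := if 0 ≤ x then 1 else -1

theorem sgn_eq_sgn_iff {x y : ℤ} : sgn x = sgn y ↔ (0 ≤ x ↔ 0 ≤ y) := by
  unfold sgn
  split_ifs <;> simp [*]

theorem sgn_mul_sgn_pos_iff {x y : ℤ} : 0 < sgn x * sgn y ↔ sgn x = sgn y := by
  unfold sgn
  split_ifs <;> norm_num

theorem abs_sgn (x : ℤ) : |sgn x| = 1 := by
  unfold sgn
  split_ifs <;> norm_num

/-- Monotone or antitone between `a` and `b`. -/
def MonoBetween (f : ℕ → ℤ) (a b : ℕ) : Prop :=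
  MonotoneOn f (Set.Icc a b) ∨ AntitoneOn f (Set.Icc a b)

theorem MonoBetween.sgn_eq {f : ℕ → ℤ} {a b i j k : ℕ} (h : MonoBetween f a b) (hi : a ≤ i)
    (hij : i ≤ j) (hjk : j ≤ k) (hk : k ≤ b) (hs : sgn (f i) = sgn (f k)) :
    sgn (f j) = sgn (f i) := by
  rw [sgn_eq_sgn_iff] at hs ⊢
  rcases h with h | h
  · have h1 := h (show i ∈ Set.Icc a b by constructor <;> omega)
      (show j ∈ Set.Icc a b by constructor <;> omega) hij
    have h2 := h (show j ∈ Set.Icc a b by constructor <;> omega)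
      (show k ∈ Set.Icc a b by constructor <;> omega) hjk
    omega
  · have h1 := h (show i ∈ Set.Icc a b by constructor <;> omega)
      (show j ∈ Set.Icc a b by constructor <;> omega) hij
    have h2 := h (show j ∈ Set.Icc a b by constructor <;> omega)
      (show k ∈ Set.Icc a b by constructor <;> omega) hjk
    omega

/-- A monotone sequence that has left its initial sign cannot return to it. -/
theorem MonoBetween.sgn_eq_of_ne {f : ℕ → ℤ} {a b i j : ℕ} (h : MonoBetween f a b) (hi : a ≤ i)
    (hij : i ≤ j) (hj : j ≤ b) (hs : sgn (f i) ≠ sgn (f a)) : sgn (f j) = sgn (f i) := by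
  rw [ne_eq, sgn_eq_sgn_iff] at hs
  rw [sgn_eq_sgn_iff]
  rcases h with h | h
  · have h1 := h (show a ∈ Set.Icc a b by constructor <;> omega)
      (show i ∈ Set.Icc a b by constructor <;> omega) hi
    have h2 := h (show i ∈ Set.Icc a b by constructor <;> omega)
      (show j ∈ Set.Icc a b by constructor <;> omega) hij
    omega
  · have h1 := h (show a ∈ Set.Icc a b by constructor <;> omega)
      (show i ∈ Set.Icc a b by constructor <;> omega) hi
    have h2 := h (show i ∈ Set.Icc a b by constructor <;> omega)
      (show j ∈ Set.Icc a b by constructor <;> omega) hij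
    omega

/-- All sign changes of `f` between `a` and `b` happen at `s`. -/
structure IsSwitch (f : ℕ → ℤ) (a b s : ℕ) : Prop where
  ge : a ≤ s
  le : s ≤ b
  before : ∀ i, a ≤ i → i < s → sgn (f i) = sgn (f a)
  after : ∀ i, s ≤ i → i ≤ b → sgn (f i) = sgn (f s)

theorem monoBetween_of_sgn {f h w : ℕ → ℤ} (hw : ∀ i, 0 ≤ w i)
    (hfh : ∀ i, f (i + 1) - f i = w i * h i) {a b : ℕ}
    (hs : ∀ i, a ≤ i → i < b → sgn (h i) = sgn (h a)) : MonoBetween f a b := by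
  by_cases h0 : 0 ≤ h a
  · left
    have hstep : ∀ i, a ≤ i → i < b → f i ≤ f (i + 1) := by
      intro i hi hi'
      have h1 : 0 ≤ h i := (sgn_eq_sgn_iff.1 (hs i hi hi')).2 h0
      have h2 := hfh i
      have h3 := mul_nonneg (hw i) h1
      omega
    rintro i ⟨hi1, hi2⟩ j ⟨hj1, hj2⟩ hij
    induction j, hij using Nat.le_induction with
    | base => exact le_rfl
    | succ j hij ih => exact (ih (by omega) (by omega)).trans (hstep j (by omega) (by omega))
  · right
    have hstep : ∀ i, a ≤ i → i < b → f (i + 1) ≤ f i := by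
      intro i hi hi'
      have h1 : ¬ 0 ≤ h i := fun h1 => h0 ((sgn_eq_sgn_iff.1 (hs i hi hi')).1 h1)
      have h2 := hfh i
      have h3 := mul_nonneg (hw i) (show 0 ≤ -h i by omega)
      have h4 : w i * -h i = - (w i * h i) := by ring
      omega
    rintro i ⟨hi1, hi2⟩ j ⟨hj1, hj2⟩ hij
    induction j, hij using Nat.le_induction with
    | base => exact le_rfl
    | succ j hij ih => exact (hstep j (by omega) (by omega)).trans (ih (by omega) (by omega))

/-- If `h` is piecewise monotone with breakpoints `r` and has its sign changes at the points `s`,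
then a sequence whose differences have the signs of `h` is piecewise monotone with breakpoints `s`. -/
theorem monoBetween_switches {f h w : ℕ → ℤ} (hw : ∀ i, 0 ≤ w i)
    (hfh : ∀ i, f (i + 1) - f i = w i * h i) {r s : ℕ → ℕ} {D : ℕ} (h0 : s 0 = r 0)
    (hs : ∀ k ≤ D, IsSwitch h (r k) (r (k + 1)) (s (k + 1))) (k : ℕ) (hk : k ≤ D) :
    MonoBetween f (s k) (s (k + 1)) := by
  apply monoBetween_of_sgn hw hfh
  intro i hi hi'
  cases k with
  | zero => rw [h0] at hi ⊢; exact (hs 0 hk).before i hi hi'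
  | succ k =>
    have h1 := hs k (by omega)
    have h2 := hs (k + 1) hk
    -- The interval between two switches contains the old breakpoint `r (k + 1)`. To its left the
    -- sign is the one after the first switch, to its right the one before the second, and both are
    -- the sign at `r (k + 1)`.
    by_cases h3 : i ≤ r (k + 1)
    · exact h1.after i hi h3
    · rw [h2.before i (by omega) hi', h1.after _ h1.le le_rfl]

theorem le_of_monoBetween {f : ℕ → ℤ} {r : ℕ → ℕ} {D : ℕ} {v : ℤ}
    (hf : ∀ k ≤ D, MonoBetween f (r k) (r (k + 1))) (hv : ∀ k ≤ D + 1, f (r k) ≤ v) {i : ℕ}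
    (h0 : r 0 ≤ i) (h1 : i ≤ r (D + 1)) : f i ≤ v := by
  obtain ⟨k, hk, h2, h3⟩ : ∃ k ≤ D, r k ≤ i ∧ i ≤ r (k + 1) := by
    clear hf hv
    induction D with
    | zero => exact ⟨0, le_rfl, h0, h1⟩
    | succ D ih =>
      by_cases h : i ≤ r (D + 1)
      · obtain ⟨k, hk, h2⟩ := ih h
        exact ⟨k, by omega, h2⟩
      · exact ⟨D + 1, le_rfl, by omega, h1⟩
  rcases hf k hk with h | h
  · exact (h ⟨h2, h3⟩ ⟨by omega, le_rfl⟩ h3).trans (hv _ (by omega))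
  · exact (h ⟨le_rfl, by omega⟩ ⟨h2, h3⟩ h2).trans (hv _ (by omega))

/-! ### Bisection -/

/-- The divided differences of the objective function at the nodes. -/
noncomputable def objectiveDiff (D : ℕ) (c : ℕ → ℤ) (j i : ℕ) : ℤ :=
  dividedDiff (objectivePoly D c) (fun l => (nodeValue l : ℤ)) j i

/-- Bounds for the objective function `c` with `D` coefficients and for the nodes up to number `I`,
which ensure that the solver below works with numbers of absolute value at most `M`. -/
structure SolverBounds (M D I L : ℕ) (c : ℕ → ℤ) : Prop where
  log_le : Nat.log 2 I + 1 ≤ L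
  size_le : D + 2 ≤ M
  exists_bound : ∃ A T : ℕ, (∀ m < D, |c m| ≤ A) ∧ nodeValue I ≤ T ∧ 8 * (I + T + 2) ≤ M ∧
    2 * (A * (1 + T) ^ ((D + 1) * (D + 1))) + 2 ≤ M

/-- A divided difference is the Horner value with index `0` of the last quotient. The factor `2`
leaves room for the difference of two objective values in `bestProg`, the summand `2` for the sign
test. -/
theorem SolverBounds.diff_le {M D I L : ℕ} {c : ℕ → ℤ} (hB : SolverBounds M D I L c) {i j : ℕ}
    (hj : j ≤ D) (hI : i + j ≤ I) : 2 * |objectiveDiff D c j i| + 2 ≤ (M : ℤ) := by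
  obtain ⟨A, T, hA, hT, -, hM⟩ := hB.exists_bound
  have ht : ∀ l ≤ j, |((nodeValue (i + l) : ℕ) : ℤ)| ≤ (T : ℤ) := by
    intro l hl
    rw [Nat.abs_cast]
    exact_mod_cast (strictMono_nodeValue.monotone (by omega)).trans hT
  have h1 := abs_hornerValue_le (nodeQuotient (objectivePoly D c) (fun l => (nodeValue l : ℤ)) i j)
    (nodeValue (i + j) : ℤ) (D := D) (A := A * (1 + T) ^ ((D + 1) * j)) (T := T) (m := 0) (k := D + 1)
    ((natDegree_nodeQuotient_le _ _ _ _).trans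
          ((Nat.sub_le _ _).trans (natDegree_objectivePoly_le _ _)))
    (abs_coeff_nodeQuotient_le _ _ i (natDegree_objectivePoly_le _ _)
          (abs_coeff_objectivePoly_le hA) (fun l hl => ht l (by omega))) (ht j le_rfl) (by omega)
  change |objectiveDiff D c j i| ≤ _ at h1
  have h2 : A * (1 + T) ^ ((D + 1) * j) * (1 + T) ^ (D + 1) ≤ A * (1 + T) ^ ((D + 1) * (D + 1)) := by
    rw [mul_assoc, ← pow_add]
    refine Nat.mul_le_mul_left _ (Nat.pow_le_pow_right (by omega) ?_)
    calc (D + 1) * j + (D + 1) = (D + 1) * (j + 1) := by ring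
      _ ≤ _ := Nat.mul_le_mul_left _ (by omega)
  have h3 : |objectiveDiff D c j i| ≤ ((A * (1 + T) ^ ((D + 1) * (D + 1)) : ℕ) : ℤ) :=
    h1.trans (by exact_mod_cast h2)
  generalize A * (1 + T) ^ ((D + 1) * (D + 1)) = V at *
  omega

theorem SolverBounds.index_le {M D I L : ℕ} {c : ℕ → ℤ} (hB : SolverBounds M D I L c) :
    8 * (I + 2) ≤ M := by
  obtain ⟨A, T, -, -, h, -⟩ := hB.exists_bound
  omega

theorem SolverBounds.dividedDiffProg_run {M D I L i j : ℕ} {c : ℕ → ℤ} (hB : SolverBounds M D I L c)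
    {σ : Memory} (hc : σ 1 = c) (hD : σ 2 0 = D) (hj : σ 5 0 = j) (hjD : j ≤ D) (hi : σ 11 0 = i)
    (hI : i + j ≤ I) :
    Run M dividedDiffProg σ (dividedDiffTime D L)
      fun τ => τ 15 0 = objectiveDiff D c j i ∧ ∀ a < 12, τ a = σ a := by
  obtain ⟨A, T, hA, hT, h1, h2⟩ := hB.exists_bound
  subst hc
  exact PolyOpt.dividedDiffProg_run hD hj hjD hi hA hI hB.log_le hT hB.size_le h1 (by omega)

/-- Moves the content of cell `8` to the point between the contents of cells `7` and `8` where the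
divided difference of order given by cell `5` changes its sign. -/
def bisectProg : Prog :=
  block [
    st 11 (rd 7),
    dividedDiffProg,
    .ite (rd 15 + .const 1) (st 9 (.const 1)) (st 9 (.const (-1))),
    .loop (rd 8 - rd 7 - .const 1)
      (block [
        st 11 ((rd 7 + rd 8) / .const 2),
        dividedDiffProg,
        .ite (rd 15 + .const 1) (st 10 (.const 1)) (st 10 (.const (-1))),
        .ite (rd 9 * rd 10) (st 7 (rd 11)) (st 8 (rd 11))])]

/-- Conditions have the form `e > 0`; for integers `x + 1 > 0` is `0 ≤ x`, in accordance with the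
convention for `sgn 0`. -/
theorem sgnProg_run {M a n : ℕ} {l : List Prog} {σ : Memory} {Q : Memory → Prop}
    (hM : |σ 15 0| + 1 ≤ (M : ℤ))
    (h : Run M (block l) (σ.set a 0 (sgn (σ 15 0))) n Q) :
    Run M (block (.ite (rd 15 + .const 1) (st a (.const 1)) (st a (.const (-1))) :: l)) σ
      (100 + n) Q := by
  have h0 := abs_nonneg (σ 15 0)
  refine Run.cons_seq (R := fun τ => τ = σ.set a 0 (sgn (σ 15 0)))
    (Run.mono (Run.ite (n := 50) ?_ ?_ ?_) (by simp)) fun τ hτ => hτ ▸ h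
  · have h1 := abs_add_le (σ 15 0) 1
    simp at h1 ⊢
    omega
  · intro h1
    simp at h1
    refine Run.mono (Run.assign (by simp; omega) ?_) (by simp)
    rw [sgn, if_pos (by omega)]; rfl
  · intro h1
    simp at h1
    refine Run.mono (Run.assign (by simp; omega) ?_) (by simp)
    rw [sgn, if_neg (by omega)]; rfl

/-- Invariant: the left end `l` has the sign of `lo`, and the right end `h` has the other sign or is
still `hi`. The width is at most `2^k` with `k` rounds left. Once `h - l ≤ 1`, monotonicity makes
`h` a switch; without a sign change the result is `hi`, which is also a valid switch. -/
theorem bisectProg_run {M D I L j lo hi K : ℕ} {c : ℕ → ℤ} (hB : SolverBounds M D I L c)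
    {σ : Memory} (hc : σ 1 = c) (hD : σ 2 0 = D) (hj : σ 5 0 = j) (hjD : j ≤ D)
    (hlo : σ 7 0 = lo) (hhi : σ 8 0 = hi) (hle : lo ≤ hi) (hI : hi + j ≤ I) (hK : hi ≤ 2 ^ K)
    (hmono : MonoBetween (objectiveDiff D c j) lo hi) :
    Run M bisectProg σ ((K + 2) * (dividedDiffTime D L + 500))
      fun τ => (∃ s : ℕ, τ 8 0 = s ∧ IsSwitch (objectiveDiff D c j) lo hi s) ∧
        ∀ a < 7, τ a = σ a := by
  set f := objectiveDiff D c j with hf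
  have hIM := hB.index_le
  have hfM : ∀ i ≤ hi, |f i| + 1 ≤ (M : ℤ) := fun i hi' => by
    have := hB.diff_le hjD (i := i) (by omega)
    have := abs_nonneg (f i)
    rw [← hf] at *
    omega
  rw [bisectProg]
  refine Run.mono (n := 100 + (dividedDiffTime D L + (100 + ((K *
    (12 + (100 + (dividedDiffTime D L + (100 + (50 + 1))))) + 12) + 1)))) ?_ ?_
  swap
  · generalize dividedDiffTime D L = V
    nlinarith [Nat.zero_le K, Nat.zero_le V]
  refine Run.cons_assign ?_ (by simp) ?_
  · simp [hlo]; omega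
  refine Run.cons_seq (hB.dividedDiffProg_run (j := j) (i := lo) ?_ ?_ ?_ hjD ?_ (by omega)) ?_
  · funext i; simp [← hc]
  · simp [hD]
  · simp [hj]
  · simp [hlo]
  rintro τ ⟨h1, h2⟩
  rw [← hf] at h1
  refine sgnProg_run (by rw [h1]; exact hfM lo hle) ?_
  rw [h1]
  refine Run.cons_seq (Run.mono (Run.loop (n := 100 + (dividedDiffTime D L + (100 + (50 + 1))))
    (fun k τ => ∃ l h : ℕ, lo ≤ l ∧ l ≤ h ∧ h ≤ hi ∧ h - l ≤ 2 ^ k ∧ τ 7 0 = l ∧ τ 8 0 = h ∧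
      τ 9 0 = sgn (f lo) ∧ sgn (f l) = sgn (f lo) ∧ (h = hi ∨ sgn (f h) ≠ sgn (f lo)) ∧
      (l = h → h = hi) ∧ ∀ a < 7, τ a = σ a) K ?_ ?_) (by simp)) fun τ h => Run.nil h
  · refine ⟨lo, hi, le_rfl, hle, le_rfl, by omega, ?_, ?_, by simp, rfl, Or.inl rfl, fun _ => rfl, ?_⟩
    · simp [h2, hlo]
    · simp [h2, hhi]
    · intro a ha
      rw [← show (σ.set 11 0 ((rd 7).val σ)) a = σ a by funext i; simp; omega, ← h2 a (by omega)]
      funext i; simp; omega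
  · rintro k υ ⟨l, h, g1, g2, g3, g4, g5, g6, g7, g8, g9, g10, g11⟩
    refine ⟨?_, ?_, ?_⟩
    · simp [g5, g6, abs_le]; omega
    · intro hk0
      -- The loop condition says `h - l ≥ 2`, so the width bound `2^k` excludes `k = 0`.
      simp [g5, g6] at hk0
      have hk : k ≠ 0 := by
        rintro rfl
        simp at g4; omega
      obtain ⟨k, rfl⟩ := Nat.exists_eq_succ_of_ne_zero hk
      rw [Nat.succ_eq_add_one, pow_succ] at g4
      refine ⟨k, rfl, ?_⟩
      obtain ⟨m, hm⟩ : ∃ m, m = (l + h) / 2 := ⟨_, rfl⟩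
      have hm' : ((l : ℤ) + h) / 2 = m := by omega
      refine Run.cons_assign ?_ (by simp) ?_
      · simp [g5, g6, abs_le]; omega
      refine Run.cons_seq (hB.dividedDiffProg_run (j := j) (i := m) ?_ ?_ ?_ hjD ?_ (by omega)) ?_
      · funext i; simp [← hc, g11]
      · simp [hD, g11]
      · simp [hj, g11]
      · simp [g5, g6, hm']
      rintro ρ ⟨f1, f2⟩
      rw [← hf] at f1
      refine sgnProg_run (by rw [f1]; exact hfM m (by omega)) ?_
      rw [f1]
      have f3 (a : ℕ) (ha : a < 10) : ρ a = υ a := by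
        rw [f2 a (by omega)]; funext i; simp; omega
      have f4 : ρ 11 0 = m := by rw [f2 11 (by omega)]; simp [g5, g6, hm']
      refine Run.cons_seq (Run.mono (Run.ite (n := 30) ?_ ?_ ?_) (by simp)) fun τ h => Run.nil h
      · simp [f3, g7, abs_sgn]; omega
      · intro hs
        simp [f3, g7, sgn_mul_sgn_pos_iff] at hs
        refine Run.mono (Run.assign ?_ ⟨m, h, by omega, by omega, by omega, by omega, ?_, ?_, ?_, hs.symm, g9, ?_, ?_⟩) (by simp)
        · simp [f4]; omega
        · simp [f4]
        · simp [f3, g6]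
        · simp [f3, g7]
        · omega
        · intro a ha; rw [← g11 a ha, ← f3 a (by omega)]; funext i; simp; omega
      · intro hs
        simp only [val_mul, val_rd, set_apply] at hs
        simp [f3, g7, sgn_mul_sgn_pos_iff] at hs
        refine Run.mono (Run.assign ?_ ⟨l, m, by omega, by omega, by omega, by omega, ?_, ?_, ?_, g8, Or.inr fun h => hs h.symm, ?_, ?_⟩) (by simp)
        · simp [f4]; omega
        · simp [f3, g5]
        · simp [f4]
        · simp [f3, g7]
        · omega
        · intro a ha; rw [← g11 a ha, ← f3 a (by omega)]; funext i; simp; omega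
    · intro hk0
      simp [g5, g6] at hk0
      refine ⟨⟨h, g6, by omega, by omega, ?_, ?_⟩, g11⟩
      · intro i hi1 hi2
        exact hmono.sgn_eq le_rfl hi1 (show i ≤ l by omega) (by omega) g8.symm
      · intro i hi1 hi2
        rcases g9 with g9 | g9
        · rw [show i = h by omega]
        · exact hmono.sgn_eq_of_ne (by omega) hi1 hi2 g9

/-! ### The solver -/

/-- Replaces the breakpoints in array `4` by the sign changes between them of the divided difference
of order given by cell `5`. -/
def passProg : Prog :=
  block [
    st 6 (rd 2 + .const 1),
    .loop (rd 6)
      (block [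
        st 7 (.read 4 (rd 6 - .const 1)),
        st 8 (.read 4 (rd 6)),
        bisectProg,
        .store 4 (rd 6) (rd 8),
        st 6 (rd 6 - .const 1)])]

theorem le_of_chain {r : ℕ → ℕ} {n : ℕ} (h : ∀ k < n, r k ≤ r (k + 1)) {k : ℕ} (hk : k ≤ n) :
    r k ≤ r n := by
  induction n, hk using Nat.le_induction with
  | base => exact le_rfl
  | succ n hn ih => exact (ih fun k hk => h k (by omega)).trans (h n (by omega))

/-- The breakpoints are replaced from the last one downwards: the switch stored at index `k` is
computed from the old entries `k - 1` and `k`, and only entries above `k` have been overwritten by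
then. Entry `0` stays. -/
theorem passProg_run {M D I L j N K : ℕ} {c : ℕ → ℤ} (hB : SolverBounds M D I L c)
    {σ : Memory} (hc : σ 1 = c) (hD : σ 2 0 = D) (hj : σ 5 0 = j) (hjD : j ≤ D)
    {r : ℕ → ℕ} (hr : ∀ k ≤ D + 1, σ 4 k = r k) (hchain : ∀ k ≤ D, r k ≤ r (k + 1))
    (hrN : r (D + 1) = N) (hI : N + D ≤ I) (hK : N ≤ 2 ^ K)
    (hmono : ∀ k ≤ D, MonoBetween (objectiveDiff D c j) (r k) (r (k + 1))) :
    Run M passProg σ ((D + 2) * ((K + 2) * (dividedDiffTime D L + 500) + 500))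
      fun τ => (∃ s : ℕ → ℕ, s 0 = r 0 ∧ (∀ k ≤ D + 1, τ 4 k = s k) ∧
        ∀ k ≤ D, IsSwitch (objectiveDiff D c j) (r k) (r (k + 1)) (s (k + 1))) ∧
        τ 0 = σ 0 ∧ τ 1 = σ 1 ∧ τ 2 = σ 2 ∧ τ 5 = σ 5 := by
  have hIM := hB.index_le
  have hrle : ∀ k ≤ D + 1, r k ≤ N := fun k hk => by
    rw [← hrN]; exact le_of_chain (fun k hk => hchain k (by omega)) hk
  rw [passProg]
  set V := (K + 2) * (dividedDiffTime D L + 500) with hV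
  refine Run.mono (n := 100 + (((D + 1) * (4 + (100 + (100 + (V + (100 + (100 + 1)))))) + 4) + 1)) ?_ ?_
  swap
  · nlinarith [Nat.zero_le D, Nat.zero_le V]
  refine Run.cons_assign ?_ (by simp) ?_
  · simp [hD, abs_le]; omega
  refine Run.cons_seq (Run.mono (Run.loop (n := 100 + (100 + (V + (100 + (100 + 1)))))
    (fun k τ => k ≤ D + 1 ∧ τ 6 0 = k ∧ (∀ l ≤ k, τ 4 l = r l) ∧
      (∃ s : ℕ → ℕ, ∀ l, k ≤ l → l ≤ D → τ 4 (l + 1) = s (l + 1) ∧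
        IsSwitch (objectiveDiff D c j) (r l) (r (l + 1)) (s (l + 1))) ∧
      τ 0 = σ 0 ∧ τ 1 = σ 1 ∧ τ 2 = σ 2 ∧ τ 5 = σ 5) (D + 1) ?_ ?_) (by simp)) fun τ h => Run.nil h
  · refine ⟨le_rfl, by simp [hD], ?_, ⟨r, fun l h1 h2 => by omega⟩, ?_, ?_, ?_, ?_⟩
    · intro l hl; simp [hr l hl]
    all_goals funext i; simp
  · rintro k τ ⟨h1, h2, h3, ⟨s, h4⟩, g0, g1, g2, g5⟩
    refine ⟨by simp [h2]; omega, ?_, ?_⟩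
    · intro hk0
      simp [h2] at hk0
      obtain ⟨l, rfl⟩ : ∃ l, k = l + 1 := ⟨k - 1, by omega⟩
      have b0 : |(l : ℤ)| ≤ M := abs_le_of_bounds (by positivity) (by omega)
      have b00 : |(l : ℤ) + 1| ≤ M := abs_le_of_bounds (by positivity) (by omega)
      have b1 := hrle l (by omega)
      have b2 := hrle (l + 1) (by omega)
      have b3 : |(r l : ℤ)| ≤ M := abs_le_of_bounds (by positivity) (by omega)
      have b4 : |(r (l + 1) : ℤ)| ≤ M := abs_le_of_bounds (by positivity) (by omega)
      have e1 := h3 l (by omega)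
      have e2 := h3 (l + 1) (by omega)
      have toNat_succ : ((l : ℤ) + 1).toNat = l + 1 := by omega
      refine ⟨l, rfl, ?_⟩
      refine Run.cons_assign ?_ (by simp) ?_
      · simp [h2, e1, b00]; omega
      refine Run.cons_assign ?_ (by simp) ?_
      · simp [h2, b00, toNat_succ, e2]; omega
      refine Run.cons_seq (bisectProg_run hB (j := j) (lo := r l) (hi := r (l + 1)) (K := K) ?_ ?_ ?_
        hjD ?_ ?_ (hchain l (by omega)) (by omega) (by omega) (hmono l (by omega))) ?_
      · funext i; simp [← hc, g1]
      · simp [hD, g2]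
      · simp [hj, g5]
      · simp [h2, e1]
      · simp [h2, toNat_succ, e2]
      rintro υ ⟨⟨u, f1, f2⟩, f3⟩
      have f4 (a : ℕ) (ha : a < 7) : υ a = τ a := by
        rw [f3 a ha]; funext i; simp; omega
      have b6 := f2.le
      refine Run.cons_store ?_ ?_ (by simp) ?_
      · simp [f4, h2, b00]
      · simp [f1]; omega
      refine Run.cons_assign ?_ (by simp) (Run.nil ⟨by omega, ?_, ?_, ⟨fun m => if m = l + 1 then u else s m, ?_⟩, ?_, ?_, ?_, ?_⟩)
      · simp [f4, h2, b00]; omega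
      · simp [f4, h2]
      · intro m hm
        simp [f4, h2, toNat_succ]
        rw [if_neg (by omega), h3 m (by omega)]
      · intro m hm hm'
        simp [f4, h2, toNat_succ]
        by_cases hml : m = l
        · subst hml; simp [f1, f2]
        · simp only [if_neg hml]
          exact h4 m (by omega) hm'
      · funext i; simp [f4, ← g0]
      · funext i; simp [f4, ← g1]
      · funext i; simp [f4, ← g2]
      · funext i; simp [f4, ← g5]
    · intro hk0
      simp [h2] at hk0
      subst hk0
      refine ⟨⟨fun m => if m = 0 then r 0 else s m, by simp, ?_, ?_⟩, g0, g1, g2, g5⟩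
      · intro m hm
        cases m with
        | zero => simp [h3]
        | succ m => simpa using (h4 m (by omega) (by omega)).1
      · intro m hm
        simpa using (h4 m (by omega) hm).2

/-- Computes the breakpoints of the objective function. -/
def levelsProg : Prog :=
  block [
    st 5 (rd 2),
    .loop (rd 5) (block [passProg, st 5 (rd 5 - .const 1)])]

/-- A pass at order `j` turns breakpoints for `f_j` into breakpoints for `f_(j-1)`. It always works
with `D + 1` intervals, most of which are degenerate at the start: the breakpoints with index above
`D - j` equal `N`, because a switch in `[N, N]` is `N`. Each pass uses up one degenerate interval,
so the last breakpoint is still `N` at order `0`. -/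
theorem levelsProg_run {M D I L N K : ℕ} {c : ℕ → ℤ} (hB : SolverBounds M D I L c)
    {σ : Memory} (hc : σ 1 = c) (hD : σ 2 0 = D) (h0 : σ 4 0 = 1)
    (hr : ∀ k, 1 ≤ k → k ≤ D + 1 → σ 4 k = N) (hN : 1 ≤ N) (hI : N + D ≤ I) (hK : N ≤ 2 ^ K) :
    Run M levelsProg σ ((D + 1) * ((D + 2) * ((K + 2) * (dividedDiffTime D L + 500) + 500) + 500))
      fun τ => (∃ r : ℕ → ℕ, r 0 = 1 ∧ r (D + 1) = N ∧ (∀ k ≤ D + 1, τ 4 k = r k) ∧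
        (∀ k ≤ D, r k ≤ r (k + 1)) ∧
        ∀ k ≤ D, MonoBetween (objectiveDiff D c 0) (r k) (r (k + 1))) ∧
        τ 1 = c ∧ τ 2 0 = D ∧ τ 5 0 = 0 := by
  have hDM := hB.size_le
  rw [levelsProg]
  set V := (D + 2) * ((K + 2) * (dividedDiffTime D L + 500) + 500) with hV
  refine Run.mono (n := 100 + ((D * (4 + (V + (100 + 1))) + 4) + 1)) ?_ ?_
  swap
  · nlinarith [Nat.zero_le D, Nat.zero_le V]
  refine Run.cons_assign ?_ (by simp) ?_
  · simp [hD]; omega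
  refine Run.cons_seq (Run.mono (Run.loop (n := V + (100 + 1))
    (fun j τ => j ≤ D ∧ τ 5 0 = j ∧ (∃ r : ℕ → ℕ, r 0 = 1 ∧ (∀ k, D - j < k → k ≤ D + 1 → r k = N) ∧
      (∀ k ≤ D + 1, τ 4 k = r k) ∧ (∀ k ≤ D, r k ≤ r (k + 1)) ∧
      ∀ k ≤ D, MonoBetween (objectiveDiff D c j) (r k) (r (k + 1))) ∧
      τ 1 = c ∧ τ 2 0 = D) D ?_ ?_) (by simp)) fun τ h => Run.nil h
  · refine ⟨le_rfl, by simp [hD], ⟨fun k => if k = 0 then 1 else N, by simp, ?_, ?_, ?_, ?_⟩, ?_, ?_⟩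
    · intro k hk hk'
      simp; omega
    · intro k hk
      by_cases h : k = 0
      · simp [h, h0]
      · simp [h, hr k (by omega) hk]
    · intro k hk
      simp; split_ifs <;> omega
    · intro k hk
      -- The differences of the order `D` divided differences vanish, since those of order `D + 1`
      -- do for a polynomial of degree at most `D`. So any breakpoints are admissible at the start.
      apply monoBetween_of_sgn (w := fun _ => 0) (h := fun _ => 0) (fun _ => le_rfl)
      · intro i
        rw [objectiveDiff, objectiveDiff, dividedDiff_succ_sub,
          dividedDiff_eq_zero _ _ (Nat.lt_succ_of_le (natDegree_objectivePoly_le D c))]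
        simp
      · intros; rfl
    · funext i; simp [← hc]
    · simp [hD]
  · rintro j τ ⟨h1, h2, ⟨r, r0, r1, r2, r3, r4⟩, g1, g2⟩
    refine ⟨by simp [h2]; omega, ?_, ?_⟩
    · intro hj0
      simp [h2] at hj0
      obtain ⟨j, rfl⟩ : ∃ l, j = l + 1 := ⟨j - 1, by omega⟩
      refine ⟨j, rfl, ?_⟩
      refine Run.cons_seq (passProg_run hB (j := j + 1) (r := r) (N := N) (K := K) g1 g2 h2 h1 r2 r3
        (r1 _ (by omega) le_rfl) hI hK r4) ?_
      rintro υ ⟨⟨s, s0, s1, s2⟩, f0, f1, f2, f5⟩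
      refine Run.cons_assign ?_ (by simp) (Run.nil ⟨by omega, ?_, ⟨s, by rw [s0, r0], ?_, ?_, ?_, ?_⟩, ?_, ?_⟩)
      · simp [f5, h2, abs_le]; omega
      · simp [f5, h2]
      · intro k hk hk'
        obtain ⟨k, rfl⟩ : ∃ l, k = l + 1 := ⟨k - 1, by omega⟩
        have h3 := (s2 k (by omega)).ge
        have h4 := (s2 k (by omega)).le
        rw [r1 (k + 1) (by omega) hk'] at h4
        rw [r1 k (by omega) (by omega)] at h3
        omega
      · intro k hk; simp [s1 k hk]
      · intro k hk
        have h3 := (s2 k hk).ge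
        cases k with
        | zero => rw [s0]; exact h3
        | succ k => exact (s2 k (by omega)).le.trans h3
      · apply monoBetween_switches (h := objectiveDiff D c (j + 1))
          (w := fun i => (nodeValue (i + j + 1) : ℤ) - nodeValue i)
        · intro i
          rw [sub_nonneg]
          exact_mod_cast strictMono_nodeValue.monotone (by omega)
        · intro i
          exact dividedDiff_succ_sub _ _ _ _
        · exact s0
        · exact s2
      · funext i; simp [f1, ← g1]
      · simp [f2, g2]
    · intro hj0
      simp [h2] at hj0
      subst hj0
      exact ⟨⟨r, r0, r1 _ (by omega) le_rfl, r2, r3, r4⟩, g1, g2, by simpa using h2⟩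

/-- Writes the maximal value of the objective function at the breakpoints to cell `0` of
array `0`. -/
def bestProg : Prog :=
  block [
    st 11 (.read 4 (.const 0)),
    dividedDiffProg,
    st 9 (rd 15),
    st 6 (rd 2 + .const 1),
    .loop (rd 6)
      (block [
        st 11 (.read 4 (rd 6)),
        dividedDiffProg,
        .ite (rd 15 - rd 9) (st 9 (rd 15)) .skip,
        st 6 (rd 6 - .const 1)]),
    st 0 (rd 9)]

/-- The divided difference of order `0` is the objective value itself, so `dividedDiffProg` with `0`
in cell `5` evaluates the objective at a node. -/
theorem bestProg_run {M D I L N : ℕ} {c : ℕ → ℤ} (hB : SolverBounds M D I L c)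
    {σ : Memory} (hc : σ 1 = c) (hD : σ 2 0 = D) (h5 : σ 5 0 = 0) {r : ℕ → ℕ}
    (hr : ∀ k ≤ D + 1, σ 4 k = r k) (hrN : ∀ k ≤ D + 1, r k ≤ N) (hI : N + D ≤ I) :
    Run M bestProg σ ((D + 3) * (dividedDiffTime D L + 500))
      fun τ => (∃ k ≤ D + 1, τ 0 0 = objectiveDiff D c 0 (r k)) ∧
        ∀ k ≤ D + 1, objectiveDiff D c 0 (r k) ≤ τ 0 0 := by
  have hIM := hB.index_le
  set f := objectiveDiff D c 0 with hf
  have hfM : ∀ k ≤ D + 1, 2 * |f (r k)| + 2 ≤ (M : ℤ) := fun k hk =>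
    hB.diff_le (Nat.zero_le D) (i := r k) (by have := hrN k hk; omega)
  rw [bestProg]
  refine Run.mono (n := 100 + (dividedDiffTime D L + (100 + (100 + (((D + 1) *
    (4 + (100 + (dividedDiffTime D L + (50 + (100 + 1))))) + 4) + (100 + 1)))))) ?_ ?_
  swap
  · generalize dividedDiffTime D L = V
    nlinarith [Nat.zero_le D, Nat.zero_le V]
  have h0 := hr 0 (by omega)
  have h0N := hrN 0 (by omega)
  have h0M := hfM 0 (by omega)
  refine Run.cons_assign ?_ (by simp) ?_
  · simp [h0]; omega
  refine Run.cons_seq (hB.dividedDiffProg_run (j := 0) (i := r 0) ?_ ?_ ?_ (Nat.zero_le D) ?_ (by omega)) ?_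
  · funext i; simp [← hc]
  · simp [hD]
  · simp [h5]
  · simp [h0]
  rintro τ ⟨g1, g2⟩
  rw [← hf] at g1
  have g3 (a : ℕ) (ha : a < 11) : τ a = σ a := by
    rw [g2 a (by omega)]; funext i; simp; omega
  refine Run.cons_assign ?_ (by simp) ?_
  · simp [g1]; have := abs_nonneg (f (r 0)); omega
  refine Run.cons_assign ?_ (by simp) ?_
  · simp [g3, hD, abs_le]; omega
  refine Run.cons_seq (Run.mono (Run.loop (n := 100 + (dividedDiffTime D L + (50 + (100 + 1))))
    (Q := fun τ => (∃ k ≤ D + 1, τ 9 0 = f (r k)) ∧ ∀ k ≤ D + 1, f (r k) ≤ τ 9 0)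
    (fun l τ => l ≤ D + 1 ∧ τ 6 0 = l ∧ (∃ k ≤ D + 1, τ 9 0 = f (r k)) ∧ f (r 0) ≤ τ 9 0 ∧
      (∀ k, l < k → k ≤ D + 1 → f (r k) ≤ τ 9 0) ∧ τ 1 = c ∧ τ 2 = σ 2 ∧ τ 4 = σ 4 ∧ τ 5 = σ 5)
    (D + 1) ?_ ?_) (by simp)) ?_
  · refine ⟨le_rfl, by simp [g3, hD], ⟨0, by omega, by simp [g1]⟩, by simp [g1],
      fun k h1 h2 => by omega, ?_, ?_, ?_, ?_⟩
    · funext i; simp [g3, ← hc]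
    all_goals funext i; simp [g3]
  · rintro l υ ⟨h1, h2, ⟨k₀, h3, h4⟩, h6, h7, e1, e2, e4, e5⟩
    refine ⟨by simp [h2]; omega, ?_, ?_⟩
    · intro hl0
      simp [h2] at hl0
      obtain ⟨l, rfl⟩ : ∃ m, l = m + 1 := ⟨l - 1, by omega⟩
      have b00 : |(l : ℤ) + 1| ≤ M := abs_le_of_bounds (by positivity) (by omega)
      have toNat_succ : ((l : ℤ) + 1).toNat = l + 1 := by omega
      have hl := hr (l + 1) (by omega)
      have hlN := hrN (l + 1) (by omega)
      have hlM := hfM (l + 1) (by omega)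
      have hkM := hfM k₀ (by omega)
      refine ⟨l, rfl, ?_⟩
      refine Run.cons_assign ?_ (by simp) ?_
      · simp [h2, b00, e4, toNat_succ, hl]; omega
      refine Run.cons_seq (hB.dividedDiffProg_run (j := 0) (i := r (l + 1)) ?_ ?_ ?_ (Nat.zero_le D) ?_ (by omega)) ?_
      · funext i; simp [← e1]
      · simp [e2, hD]
      · simp [e5, h5]
      · simp [h2, e4, toNat_succ, hl]
      rintro ρ ⟨f1, f2⟩
      rw [← hf] at f1
      have f3 (a : ℕ) (ha : a < 11) : ρ a = υ a := by
        rw [f2 a (by omega)]; funext i; simp; omega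
      refine Run.cons_seq (R := fun τ => (∃ k ≤ D + 1, τ 9 0 = f (r k)) ∧ υ 9 0 ≤ τ 9 0 ∧
        f (r (l + 1)) ≤ τ 9 0 ∧ ∀ a < 9, τ a = υ a) (Run.mono (Run.ite (n := 10) ?_ ?_ ?_) (by simp)) ?_
      · have := abs_sub (f (r (l + 1))) (f (r k₀))
        have := abs_nonneg (f (r (l + 1)))
        have := abs_nonneg (f (r k₀))
        simp [f1, f3, h4]
        omega
      · intro hs
        simp [f1, f3] at hs
        refine Run.mono (Run.assign ?_ ⟨⟨l + 1, by omega, ?_⟩, ?_, ?_, ?_⟩) (by simp)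
        · have := abs_nonneg (f (r (l + 1)))
          simp [f1]; omega
        · simp [f1]
        · simp [f1]; omega
        · simp [f1]
        · intro a ha; rw [← f3 a (by omega)]; funext i; simp; omega
      · intro hs
        simp [f1, f3] at hs
        refine Run.mono (Run.skip ⟨⟨k₀, h3, by rw [f3 9 (by omega), h4]⟩, ?_, ?_, ?_⟩) (by simp)
        · rw [f3 9 (by omega)]
        · rw [f3 9 (by omega)]; omega
        · intro a ha; exact f3 a (by omega)
      rintro χ ⟨d1, d2, d3, d4⟩
      refine Run.cons_assign ?_ (by simp) (Run.nil ⟨by omega, ?_, ?_, ?_, ?_, ?_, ?_, ?_, ?_⟩)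
      · simp [d4, h2, abs_le]; omega
      · simp [d4, h2]
      · simpa using d1
      · simpa using h6.trans d2
      · intro k hk hk'
        simp only [set_apply, show ¬ (9 = 6) by norm_num, false_and, if_false]
        by_cases hkl : k = l + 1
        · rw [hkl]; exact d3
        · exact (h7 k (by omega) hk').trans d2
      · funext i; simp [d4, ← e1]
      · funext i; simp [d4, ← e2]
      · funext i; simp [d4, ← e4]
      · funext i; simp [d4, ← e5]
    · intro hl0
      simp [h2] at hl0
      subst hl0
      refine ⟨⟨k₀, h3, h4⟩, fun k hk => ?_⟩
      rcases Nat.eq_zero_or_pos k with rfl | h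
      · exact h6
      · exact h7 k h hk
  · rintro υ ⟨⟨k₀, h3, h4⟩, h6⟩
    have := hfM k₀ h3
    have := abs_nonneg (f (r k₀))
    refine Run.cons_assign ?_ (by simp) (Run.nil ⟨⟨k₀, h3, by simp [h4]⟩, fun k hk => ?_⟩)
    · simp [h4]; omega
    · simpa using h6 k hk

/-- The solver for the cyclic problems with `2^(d-1) + 1` points in dimension `2 d`. -/
def solverProg : Prog :=
  block [
    st 2 (.const 2 * rd 0),
    st 3 (.const 1),
    st 6 (rd 0 - .const 1),
    .loop (rd 6) (block [st 3 (.const 2 * rd 3), st 6 (rd 6 - .const 1)]),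
    st 3 (rd 3 + .const 1),
    .store 4 (.const 0) (.const 1),
    st 6 (rd 2 + .const 1),
    .loop (rd 6) (block [.store 4 (rd 6) (rd 3), st 6 (rd 6 - .const 1)]),
    levelsProg,
    bestProg]

/-- The divided differences at indices up to `2^(d-1) + 1` involve up to `2d` nodes beyond the
points of the problem. These are available because `nodeValue` is defined and increasing everywhere;
hence the size of `I`. -/
theorem solverProg_run {M d I L : ℕ} {c : ℕ → ℤ} (hd : 1 ≤ d) (hB : SolverBounds M (2 * d) I L c)
    {σ : Memory} (h0 : σ 0 0 = d) (hc : σ 1 = c) (hI : 2 ^ (d - 1) + 1 + 2 * d ≤ I) :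
    Run M solverProg σ ((2 * d + 5) * ((2 * d + 2) * ((d + 2) * (dividedDiffTime (2 * d) L + 500) + 500) + 500))
      fun τ => (∃ i, 1 ≤ i ∧ i ≤ 2 ^ (d - 1) + 1 ∧ τ 0 0 = objectiveDiff (2 * d) c 0 i) ∧
        ∀ i, 1 ≤ i → i ≤ 2 ^ (d - 1) + 1 → objectiveDiff (2 * d) c 0 i ≤ τ 0 0 := by
  have hIM := hB.index_le
  have hpos : 1 ≤ 2 ^ (d - 1) := Nat.one_le_two_pow
  have hd2 : d - 1 < 2 ^ (d - 1) := Nat.lt_two_pow_self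
  have hK : 2 ^ (d - 1) + 1 ≤ 2 ^ d := by
    conv_rhs => rw [show d = d - 1 + 1 by omega, pow_succ]
    omega
  obtain ⟨N, hN⟩ : ∃ N, N = 2 ^ (d - 1) + 1 := ⟨_, rfl⟩
  rw [← hN] at hI hK ⊢
  obtain ⟨D, hDd⟩ : ∃ D, D = 2 * d := ⟨_, rfl⟩
  rw [← hDd] at hI hB ⊢
  rw [solverProg]
  refine Run.mono (n := 100 + (100 + (100 + (((d - 1) * 26 + 4) + (100 + (100 + (100 + (((D + 1) *
    (4 + 201) + 4) + (((D + 1) * ((D + 2) * ((d + 2) * (dividedDiffTime D L + 500) + 500) + 500)) +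
    (((D + 3) * (dividedDiffTime D L + 500)) + 1)))))))))) ?_ ?_
  swap
  · have h1 : D ≤ dividedDiffTime D L := by
      rw [dividedDiffTime]
      exact (show D ≤ 1000 * (D + 2) by omega).trans (Nat.le_mul_of_pos_right _ (by positivity))
    generalize dividedDiffTime D L = V at *
    have h2 : (d - 1) * 26 ≤ 26 * D := by omega
    have h3 : (D + 3) * (V + 500) ≤ (D + 2) * ((d + 2) * (V + 500)) := by
      rw [← mul_assoc]
      refine Nat.mul_le_mul_right _ ?_
      nlinarith
    set U := (D + 2) * ((d + 2) * (V + 500) + 500) with hU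
    have h4 : (D + 2) * ((d + 2) * (V + 500)) ≤ U := Nat.mul_le_mul_left _ (Nat.le_add_right _ _)
    have h5 : 500 * D ≤ U := by rw [hU]; nlinarith [Nat.zero_le ((d + 2) * (V + 500))]
    nlinarith
  refine Run.cons_assign ?_ (by simp) ?_
  · simp [h0]; omega
  refine Run.cons_assign ?_ (by simp) ?_
  · simp; omega
  refine Run.cons_assign ?_ (by simp) ?_
  · simp [h0, abs_le]; omega
  refine Run.cons_seq (Run.mono
      (Run.power (x := 2) (k := d - 1) (by norm_num) ?_ ?_ ?_ (by norm_num) (by omega) (by omega)) (by simp)) ?_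
  · simp
  · simp [h0]; omega
  · intro υ hυ
    refine ⟨by simp, fun h5 h6 => ?_⟩
    rw [within_mul, within_rd, within_const]
    exact ⟨by simp; omega, h6, h5⟩
  rintro τ ⟨h3, h4⟩
  have h3' : τ 3 0 + 1 = N := by rw [h3, hN]; push_cast; rfl
  have g2 : τ 2 0 = D := by rw [h4 2 (by omega) (by omega)]; simp [h0, hDd]
  have g1 : τ 1 = c := by rw [h4 1 (by omega) (by omega)]; funext i; simp [← hc]
  refine Run.cons_assign ?_ (by simp) ?_
  · have : τ 3 0 = N - 1 := by omega
    simp [this, abs_le]; omega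
  refine Run.cons_store (by simp [Expr.Within]) (by simp; omega) (by simp) ?_
  refine Run.cons_assign ?_ (by simp) ?_
  · simp [g2, abs_le]; omega
  refine Run.cons_seq (R := fun τ => τ 1 = c ∧ τ 2 0 = D ∧ τ 4 0 = 1 ∧
      ∀ k, 1 ≤ k → k ≤ D + 1 → τ 4 k = N)
    (Run.mono (Run.loop (n := 201) (fun l τ => l ≤ D + 1 ∧ τ 6 0 = l ∧ τ 1 = c ∧ τ 2 0 = D ∧ τ 3 0 = N ∧ τ 4 0 = 1 ∧
      ∀ k, l < k → k ≤ D + 1 → τ 4 k = N) (D + 1) ?_ ?_) (by simp)) ?_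
  · refine ⟨le_rfl, by simp [g2], ?_, by simp [g2], by simp [h3'], by simp, fun k h1 h2 => by omega⟩
    funext i; simp [g1]
  · rintro l υ ⟨f1, f2, f3, f4, f5, f6, f7⟩
    refine ⟨by simp [f2]; omega, ?_, ?_⟩
    · intro hl0
      simp [f2] at hl0
      obtain ⟨l, rfl⟩ : ∃ m, l = m + 1 := ⟨l - 1, by omega⟩
      have toNat_succ : ((l : ℤ) + 1).toNat = l + 1 := by omega
      refine ⟨l, rfl, Run.cons_store ?_ ?_ (by simp) (Run.cons_assign ?_ (by simp) (Run.nil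
        ⟨by omega, ?_, ?_, ?_, ?_, ?_, ?_⟩))⟩
      · simp [f2, abs_le]; omega
      · simp [f5]; omega
      · simp [f2, abs_le]; omega
      · simp [f2]
      · funext i; simp [← f3]
      · simp [f4]
      · simp [f5]
      · simp [f2, toNat_succ, f6]
      · intro k hk hk'
        simp only [val_rd, f2, f5, set_apply]
        push_cast
        rw [toNat_succ]
        by_cases hkl : k = l + 1
        · simp [hkl]
        · simp [hkl, f7 k (by omega) hk']
    · intro hl0
      simp [f2] at hl0
      subst hl0
      exact ⟨f3, f4, f6, fun k hk hk' => f7 k (by omega) hk'⟩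
  rintro υ ⟨f1, f2, f3, f4⟩
  refine Run.cons_seq (levelsProg_run hB (N := N) (K := d) f1 f2 f3 f4 (by omega) (by omega) hK) ?_
  rintro ρ ⟨⟨r, r0, r1, r2, r3, r4⟩, e1, e2, e5⟩
  have hr1 : ∀ k ≤ D + 1, 1 ≤ r k := fun k hk => by
    rw [← r0]; exact le_of_chain (fun l hl => r3 l (by omega)) (Nat.zero_le k)
  have hrN : ∀ k ≤ D + 1, r k ≤ N := fun k hk => by
    rw [← r1]; exact le_of_chain (fun k hk => r3 k (by omega)) hk
  refine Run.cons_seq (bestProg_run hB (N := N) e1 e2 e5 r2 hrN (by omega)) ?_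
  rintro χ ⟨⟨k, hk, d1⟩, d2⟩
  refine Run.nil ⟨⟨r k, hr1 k hk, hrN k hk, d1⟩, fun i hi hi' => ?_⟩
  exact le_of_monoBetween r4 d2 (by omega) (by omega)

/-! ### Polynomial time bounds -/

theorem log_pred_add_one_le {n s : ℕ} (h : n < 2 ^ s) : Nat.log 2 (n - 1) + 1 ≤ s + 1 :=
  Nat.succ_le_succ (Nat.le_of_lt_succ (Nat.log_lt_of_lt_pow' (by omega)
    (by rw [pow_succ]; omega)))

/-- The two powers are at most `2^(s^3)` each, and the linear part is below `2^s`. -/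
theorem nodeValue_le {n s : ℕ} (h : n < 2 ^ s) : nodeValue n ≤ 2 ^ (s ^ 3 + 2) := by
  have hs : s < 2 ^ s := Nat.lt_two_pow_self
  rw [pow_add]
  have h1 : 2 ^ s ≤ 2 ^ (s ^ 3) := Nat.pow_le_pow_right (by norm_num) (Nat.le_self_pow (by norm_num) _)
  rcases lt_or_ge n 2 with h2 | h2
  · rw [nodeValue, if_pos h2]; omega
  have h3 : Nat.log 2 (n - 1) < s := Nat.log_lt_of_lt_pow (by omega) (by omega)
  have h4 : 2 ^ ((Nat.log 2 (n - 1) + 1) ^ 3) ≤ 2 ^ (s ^ 3) :=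
    Nat.pow_le_pow_right (by norm_num) (Nat.pow_le_pow_left h3 3)
  have h5 := pow_sub_one_pow_lt (Nat.log 2 (n - 1))
  have h6 : 0 < 2 ^ Nat.log 2 (n - 1) := by positivity
  rw [nodeValue_of_two_le h2]
  omega

theorem unitCost_two_pow (B : ℕ) : unitCost (2 ^ B) = (B + 2) ^ 2 := by
  rw [unitCost, Nat.size_pow]

theorem polyTimeComputable_nodeValue : PolyTimeComputable nodeValue := by
  refine ⟨block [st 20 (rd 0), nodeProg, st 0 (rd 27)],
    (201 + 1000 * (Polynomial.X + 2) ^ 3) * (Polynomial.X ^ 3 + Polynomial.X + 12) ^ 2, fun n => ?_⟩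
  set s := n.size with hs
  have hn : n < 2 ^ s := Nat.lt_size_self n
  have hg := nodeValue_le hn
  have h1 : 2 ^ s ≤ 2 ^ (s ^ 3 + s + 4) := Nat.pow_le_pow_right (by norm_num) (by omega)
  have h2 : 2 ^ (s ^ 3 + 2) ≤ 2 ^ (s ^ 3 + s + 4) := Nat.pow_le_pow_right (by norm_num) (by omega)
  have h3 : 2 ^ 1 ≤ 2 ^ (s ^ 3 + s + 4) := Nat.pow_le_pow_right (by norm_num) (by omega)
  have h4 : 2 ^ (s ^ 3 + s + 10) = 2 ^ (s ^ 3 + s + 4) * 64 := by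
    rw [← show 2 ^ 6 = 64 by norm_num, ← pow_add]
  have hM : 8 * (n + nodeValue n + 2) ≤ 2 ^ (s ^ 3 + s + 10) := by omega
  have hrun : Run (2 ^ (s ^ 3 + s + 10)) (block [st 20 (rd 0), nodeProg, st 0 (rd 27)])
      (inputMemory n (Fin.elim0 : Fin 0 → ℤ)) (100 + (1000 * (s + 2) ^ 3 + (100 + 1)))
      fun τ => τ 0 0 = nodeValue n := by
    generalize 2 ^ (s ^ 3 + s + 10) = M at *
    refine Run.cons_assign ?_ (by simp) ?_
    · simp [inputMemory]; omega
    refine Run.cons_seq (nodeProg_run (n := n) (by simp [inputMemory]) (log_pred_add_one_le hn) hM) ?_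
    rintro τ ⟨f1, -⟩
    refine Run.cons_assign ?_ (by simp) (Run.nil ?_)
    · simp [f1]; omega
    · simp [f1]
  obtain ⟨τ, t, e1, e2, e3⟩ := hrun
  refine ⟨τ, t, e1, e3, e2.trans (le_of_eq ?_)⟩
  rw [unitCost_two_pow]
  simp
  ring

theorem objectiveDiff_zero (D : ℕ) (c : ℕ → ℤ) (i : ℕ) :
    objectiveDiff D c 0 i = ∑ m ∈ Finset.range D, c m * (nodeValue i : ℤ) ^ (m + 1) := by
  simp [objectiveDiff, dividedDiff, nodeQuotient, objectivePoly, Polynomial.eval_finsetSum]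

theorem lt_two_pow_bitLen (z : ℤ) : |z| < 2 ^ bitLen z := by
  rw [Int.abs_eq_natAbs, bitLen]
  exact_mod_cast (Nat.lt_size_self z.natAbs).trans_le (Nat.pow_le_pow_right (by norm_num) (by omega))

/-- With `s = 2d + 2` all node numbers have at most `s` bits and the nodes are at most `T =
2^(s^3+2)`. Then `1 + T ≤ 2^(s^3+3)`, whose power with exponent `(2d+1)^2` gives the main term; the
other summands of the exponent are slack. -/
theorem solverBounds_two_pow {d n : ℕ} (hd : 1 ≤ d) {c : ℕ → ℤ} (hc : ∀ m < 2 * d, |c m| ≤ 2 ^ n) :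
    SolverBounds (2 ^ (n + ((2 * d + 2) ^ 3 + 3) * ((2 * d + 1) * (2 * d + 1)) + (2 * d + 2) ^ 3 + 20))
      (2 * d) (2 ^ (d - 1) + 1 + 2 * d) (2 * d + 3) c := by
  have hI : 2 ^ (d - 1) + 1 + 2 * d < 2 ^ (2 * d + 2) := by
    have h1 : 2 * d < 2 ^ (2 * d) := Nat.lt_two_pow_self
    have h2 : 2 ^ (d - 1) ≤ 2 ^ (2 * d) := Nat.pow_le_pow_right (by norm_num) (by omega)
    rw [pow_add]; omega
  set s := 2 * d + 2 with hs
  have hs3 : s ≤ s ^ 3 := Nat.le_self_pow (by norm_num) _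
  set E := (s ^ 3 + 3) * ((2 * d + 1) * (2 * d + 1)) with hE
  have h5 : 2 ^ (s ^ 3 + 4) ≤ 2 ^ (n + E + s ^ 3 + 4) := Nat.pow_le_pow_right (by norm_num) (by omega)
  have h6 : 2 ^ s ≤ 2 ^ (s ^ 3 + 2) := Nat.pow_le_pow_right (by norm_num) (by omega)
  have h7 : 2 ^ (n + E + s ^ 3 + 20) = 2 ^ (n + E + s ^ 3 + 4) * 65536 := by
    rw [← show 2 ^ 16 = 65536 by norm_num, ← pow_add]
  have h8 : 2 ^ (s ^ 3 + 4) = 2 ^ (s ^ 3 + 2) * 4 := by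
    rw [show s ^ 3 + 4 = s ^ 3 + 2 + 2 from rfl, pow_add 2 (s ^ 3 + 2) 2]; norm_num
  have hs2 : s < 2 ^ s := Nat.lt_two_pow_self
  refine ⟨?_, ?_, 2 ^ n, 2 ^ (s ^ 3 + 2), fun m hm => by exact_mod_cast hc m hm, nodeValue_le hI, ?_, ?_⟩
  · have := Nat.log_lt_of_lt_pow (b := 2) (by positivity) hI
    omega
  · omega
  · omega
  · have h1 : 1 + 2 ^ (s ^ 3 + 2) ≤ 2 ^ (s ^ 3 + 3) := by
      have : 1 ≤ 2 ^ (s ^ 3 + 2) := Nat.one_le_two_pow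
      rw [pow_succ 2 (s ^ 3 + 2)]
      omega
    have h2 : 2 ^ n * (1 + 2 ^ (s ^ 3 + 2)) ^ ((2 * d + 1) * (2 * d + 1)) ≤ 2 ^ (n + E) := by
      rw [pow_add 2 n E, hE, pow_mul 2 (s ^ 3 + 3)]
      exact Nat.mul_le_mul_left _ (Nat.pow_le_pow_left h1 _)
    have h3 : 2 ^ (n + E) ≤ 2 ^ (n + E + s ^ 3 + 4) := Nat.pow_le_pow_right (by norm_num) (by omega)
    have h4 : 1 ≤ 2 ^ (n + E) := Nat.one_le_two_pow
    omega

/-- Only the cardinality of the hard set enters `Y d`, and this is a fixed function of `d`; so one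
program serves all `d`. The time polynomial is the step count of `solverProg_run` times the unit
cost for numbers below the power of two in `solverBounds_two_pow`. -/
theorem polySolvable_cyclicSet (Y : ∀ d : ℕ, Finset (Fin (2 * d) → ℤ))
    (hY : ∀ d, 1 ≤ d → Y d = cyclicSet (2 * d) (2 ^ (d - 1) + 1) nodeValue) :
    PolySolvable (fun d => 2 * d) Y := by
  refine ⟨solverProg, ((2 * .X + 5) * ((2 * .X + 2) * ((.X + 2) *
    (1000 * (2 * .X + 2) * (2 * .X + 2 + (2 * .X + 3 + 1) ^ 3) + 500) + 500) + 500)) *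
    ((.X + ((2 * .X + 2) ^ 3 + 3) * ((2 * .X + 1) * (2 * .X + 1)) + (2 * .X + 2) ^ 3 + 20) + 2) ^ 2,
    fun d hd c => ?_⟩
  set n := d + ∑ i, bitLen (c i) with hn
  set c' : ℕ → ℤ := inputMemory d c 1 with hc'
  have hc'' : ∀ (m : ℕ) (hm : m < 2 * d), c' m = c ⟨m, hm⟩ := by
    intro m hm
    simp [hc', inputMemory, hm]
  have hbound : ∀ m < 2 * d, |c' m| ≤ 2 ^ n := by
    intro m hm
    rw [hc'' m hm]
    refine (lt_two_pow_bitLen _).le.trans (pow_le_pow_right₀ (by norm_num) ?_)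
    have := Finset.single_le_sum (f := fun i => bitLen (c i)) (fun i _ => Nat.zero_le _)
      (Finset.mem_univ (⟨m, hm⟩ : Fin (2 * d)))
    exact this.trans (by rw [hn]; exact Nat.le_add_left _ _)
  obtain ⟨τ, t, h1, h2, ⟨i₀, h3, h4, h5⟩, h6⟩ := solverProg_run hd (solverBounds_two_pow hd hbound)
    (σ := inputMemory d c) (by simp [inputMemory]) rfl le_rfl
  have hobj : ∀ i : ℕ, ∑ j : Fin (2 * d), c j * (nodeValue i : ℤ) ^ ((j : ℕ) + 1) =
      objectiveDiff (2 * d) c' 0 i := by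
    intro i
    rw [objectiveDiff_zero, Finset.sum_range]
    exact Finset.sum_congr rfl fun j _ => by rw [hc'' j j.2]
  refine ⟨τ, t, h1, ?_, ?_⟩
  · rw [hY d hd]
    refine ⟨⟨fun j => (nodeValue i₀ : ℤ) ^ ((j : ℕ) + 1), ?_, ?_⟩, ?_⟩
    · simp only [cyclicSet, Finset.coe_image]
      exact ⟨i₀, by simp; omega, rfl⟩
    · rw [h5]; exact hobj i₀
    · rintro _ ⟨y, hy, rfl⟩
      simp only [cyclicSet, Finset.coe_image] at hy
      obtain ⟨i, hi, rfl⟩ := hy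
      simp at hi
      change ∑ j : Fin (2 * d), c j * (nodeValue i : ℤ) ^ ((j : ℕ) + 1) ≤ _
      rw [hobj]
      exact h6 i hi.1 hi.2
  · refine h2.trans ?_
    have hdn : d ≤ n := Nat.le_add_right _ _
    rw [unitCost_two_pow, dividedDiffTime]
    simp only [Polynomial.eval_mul, Polynomial.eval_add, Polynomial.eval_pow, Polynomial.eval_X,
      Polynomial.eval_ofNat, Polynomial.eval_one]
    gcongr

/-! ## Faces of convex hulls -/

section Faces

variable {d e : ℕ}

/-- The points with `l x ≤ m` which, in case of equality, lie in the hull of the maximizers form a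
convex set: a proper convex combination attains `m` only if both ends do. This set contains `S`. -/
theorem convexHull_inter_hyperplane {S : Set (Fin d → ℝ)} {l : StrongDual ℝ (Fin d → ℝ)} {m : ℝ}
    (h : ∀ x ∈ S, l x ≤ m) :
    {x ∈ convexHull ℝ S | l x = m} = convexHull ℝ {x ∈ S | l x = m} := by
  apply Set.Subset.antisymm
  · rintro x ⟨hx, hxm⟩
    have hconv : Convex ℝ {x : Fin d → ℝ | l x ≤ m ∧ (l x = m → x ∈ convexHull ℝ {x ∈ S | l x = m})} := by
      rw [convex_iff_forall_pos]
      rintro x ⟨hx1, hx2⟩ y ⟨hy1, hy2⟩ a b ha hb hab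
      have h1 : l (a • x + b • y) = a * l x + b * l y := by simp
      have h2 : m = a * m + b * m := by rw [← add_mul, hab, one_mul]
      refine ⟨by rw [h1, h2]; gcongr, fun h3 => ?_⟩
      have h4 : a * (m - l x) + b * (m - l y) = 0 := by linarith
      have h5 : 0 ≤ a * (m - l x) := mul_nonneg ha.le (by linarith)
      have h6 : 0 ≤ b * (m - l y) := mul_nonneg hb.le (by linarith)
      have h7 : m - l x = 0 := by
        rcases mul_eq_zero.1 (show a * (m - l x) = 0 by linarith) with h | h
        · linarith
        · exact h
      have h8 : m - l y = 0 := by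
        rcases mul_eq_zero.1 (show b * (m - l y) = 0 by linarith) with h | h
        · linarith
        · exact h
      exact (convex_convexHull ℝ _) (hx2 (by linarith)) (hy2 (by linarith)) ha.le hb.le hab
    have hsub : S ⊆ {x : Fin d → ℝ | l x ≤ m ∧ (l x = m → x ∈ convexHull ℝ {x ∈ S | l x = m})} :=
      fun y hy => ⟨h y hy, fun hym => subset_convexHull ℝ _ ⟨hy, hym⟩⟩
    exact (convexHull_min hsub hconv hx).2 hxm
  · refine convexHull_min (fun x hx => ⟨subset_convexHull ℝ _ hx.1, hx.2⟩) ?_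
    exact (convex_convexHull ℝ S).inter (convex_hyperplane l.toLinearMap.isLinear m)

theorem isExposed_hyperplane {S : Set (Fin d → ℝ)} {l : StrongDual ℝ (Fin d → ℝ)} {m : ℝ}
    (h : ∀ x ∈ S, l x ≤ m) : IsExposed ℝ (convexHull ℝ S) {x ∈ convexHull ℝ S | l x = m} := by
  rintro ⟨x₀, hx₀, hm⟩
  have h1 : ∀ x ∈ convexHull ℝ S, l x ≤ m := fun x hx =>
    convexHull_min h (convex_halfSpace_le l.toLinearMap.isLinear m) hx
  refine ⟨l, ?_⟩
  ext x
  constructor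
  · rintro ⟨hx, hxm⟩
    exact ⟨hx, fun y hy => (h1 y hy).trans hxm.ge⟩
  · rintro ⟨hx, hxm⟩
    exact ⟨hx, le_antisymm (h1 x hx) (hm ▸ hxm x₀ hx₀)⟩

theorem exists_eq_hyperplane {S F : Set (Fin d → ℝ)} (hF : IsExposed ℝ (convexHull ℝ S) F)
    (hne : F.Nonempty) : ∃ (l : StrongDual ℝ (Fin d → ℝ)) (m : ℝ), (∀ x ∈ S, l x ≤ m) ∧
      F = {x ∈ convexHull ℝ S | l x = m} := by
  obtain ⟨l, rfl⟩ := hF hne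
  obtain ⟨x₀, hx₀, h0⟩ := hne
  refine ⟨l, l x₀, fun x hx => h0 x (subset_convexHull ℝ _ hx), ?_⟩
  ext x
  constructor
  · rintro ⟨hx, hxm⟩
    exact ⟨hx, le_antisymm (h0 x hx) (hxm x₀ hx₀)⟩
  · rintro ⟨hx, hxm⟩
    exact ⟨hx, fun y hy => by rw [hxm]; exact h0 y hy⟩

theorem eq_convexHull_inter {S F : Set (Fin d → ℝ)} (hF : IsExposed ℝ (convexHull ℝ S) F)
    (hne : F.Nonempty) : F = convexHull ℝ (S ∩ F) := by
  obtain ⟨l, m, h, hFe⟩ := exists_eq_hyperplane hF hne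
  have h1 : S ∩ F = {x ∈ S | l x = m} := by
    rw [hFe]
    ext x
    constructor
    · rintro ⟨hx, -, hxm⟩; exact ⟨hx, hxm⟩
    · rintro ⟨hx, hxm⟩; exact ⟨hx, subset_convexHull ℝ _ hx, hxm⟩
  rw [h1, hFe, convexHull_inter_hyperplane h]

/-- If the proper faces of `conv p` have at most `k` vertices and all sets of at most `k` points `q`
are cut out by a supporting hyperplane of `conv q`, then the face lattice of `conv p` embeds into
that of `conv q`. -/
theorem nonempty_faceLattice_embedding {ι : Type*} (p : ι → Fin d → ℝ) (q : ι → Fin e → ℝ) (k : ℕ)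
    (hp : ∀ F : FaceLattice (convexHull ℝ (Set.range p)), {i | p i ∈ F.1}.ncard ≤ k)
    (hq : ∀ V : Set ι, V.ncard ≤ k → ∃ (l : StrongDual ℝ (Fin e → ℝ)) (m : ℝ),
      ∀ i, l (q i) ≤ m ∧ (l (q i) = m ↔ i ∈ V)) :
    Nonempty (FaceLattice (convexHull ℝ (Set.range p)) ↪o
      FaceLattice (convexHull ℝ (Set.range q))) := by
  choose! l m hlm using hq
  set V : FaceLattice (convexHull ℝ (Set.range p)) → Set ι := fun F => {i | p i ∈ F.1} with hV
  -- `G F` is the face of `conv q` whose points `q i` are exactly those with `p i ∈ F`. A face and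
  -- its image are both the hulls of the points with the same index set `V F`, so inclusions
  -- transfer in both directions.
  set G : FaceLattice (convexHull ℝ (Set.range p)) → Set (Fin e → ℝ) := fun F =>
    {x ∈ convexHull ℝ (Set.range q) | l (V F) x = m (V F)} with hG
  have hle : ∀ F, ∀ x ∈ Set.range q, l (V F) x ≤ m (V F) := by
    rintro F _ ⟨i, rfl⟩
    exact (hlm _ (hp F) i).1
  have hGV : ∀ F, G F = convexHull ℝ (q '' V F) := by
    intro F
    change {x ∈ convexHull ℝ (Set.range q) | l (V F) x = m (V F)} = _
    rw [convexHull_inter_hyperplane (hle F)]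
    congr 1
    ext x
    constructor
    · rintro ⟨⟨i, rfl⟩, hx⟩
      exact ⟨i, ((hlm _ (hp F) i).2).1 hx, rfl⟩
    · rintro ⟨i, hi, rfl⟩
      exact ⟨⟨i, rfl⟩, ((hlm _ (hp F) i).2).2 hi⟩
  have hFV : ∀ F : FaceLattice (convexHull ℝ (Set.range p)), F.1 = convexHull ℝ (p '' V F) := by
    intro F
    conv_lhs => rw [eq_convexHull_inter F.2.1 F.2.2.1]
    congr 1
    ext x
    constructor
    · rintro ⟨⟨i, rfl⟩, hx⟩; exact ⟨i, hx, rfl⟩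
    · rintro ⟨i, hi, rfl⟩; exact ⟨⟨i, rfl⟩, hi⟩
  have hqG : ∀ F i, q i ∈ G F ↔ i ∈ V F := fun F i =>
    ⟨fun h => ((hlm _ (hp F) i).2).1 h.2,
      fun h => ⟨subset_convexHull ℝ _ ⟨i, rfl⟩, ((hlm _ (hp F) i).2).2 h⟩⟩
  refine ⟨OrderEmbedding.ofMapLEIff (fun F => ⟨G F, isExposed_hyperplane (hle F), ?_, ?_⟩) ?_⟩
  · rw [hGV]
    have h := F.2.2.1
    rw [hFV F] at h
    exact ((convexHull_nonempty_iff.1 h).of_image.image q).convexHull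
  · intro h
    apply F.2.2.2
    have : V F = Set.univ := by
      rw [Set.eq_univ_iff_forall]
      intro i
      rw [← hqG, h]
      exact subset_convexHull ℝ _ ⟨i, rfl⟩
    rw [hFV F, this, Set.image_univ]
  · intro F₁ F₂
    constructor
    · intro h
      have h1 : V F₁ ⊆ V F₂ := fun i hi => (hqG F₂ i).1 (h ((hqG F₁ i).2 hi))
      change F₁.1 ⊆ F₂.1
      rw [hFV F₁, hFV F₂]
      exact convexHull_mono (Set.image_mono h1)
    · intro h
      change G F₁ ⊆ G F₂
      rw [hGV, hGV]
      exact convexHull_mono (Set.image_mono fun i hi => h hi)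

end Faces

/-! ## Neighborliness of cyclic polytopes -/

/-- The point `(t, t², …, t^e)`. -/
noncomputable def momentPoint (e : ℕ) (t : ℝ) : Fin e → ℝ := fun j => t ^ ((j : ℕ) + 1)

/-- Gale's argument: `∏ (T - t v)^2` over `v ∈ V` has degree at most `2d`, is nonnegative, and
vanishes at `t i` only for `i ∈ V`. -/
theorem exists_supporting_hyperplane_momentPoint {ι : Type*} {t : ι → ℝ} (ht : Function.Injective t)
    {d : ℕ} (V : Finset ι) (hV : V.card ≤ d) : ∃ (l : StrongDual ℝ (Fin (2 * d) → ℝ)) (m : ℝ),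
      ∀ i, l (momentPoint (2 * d) (t i)) ≤ m ∧ (l (momentPoint (2 * d) (t i)) = m ↔ i ∈ V) := by
  set P : Polynomial ℝ := ∏ v ∈ V, (Polynomial.X - Polynomial.C (t v)) ^ 2 with hP
  have hdeg : P.natDegree < 2 * d + 1 := by
    have h1 : P.natDegree ≤ ∑ v ∈ V, 2 := by
      refine (Polynomial.natDegree_prod_le _ _).trans (Finset.sum_le_sum fun v _ => ?_)
      exact Polynomial.natDegree_pow_le.trans (by rw [Polynomial.natDegree_X_sub_C])
    simp at h1
    omega
  -- The signs are chosen such that `m - l` takes the value `P(t)` at the moment point of `t`.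
  refine ⟨-∑ j : Fin (2 * d), P.coeff ((j : ℕ) + 1) • ContinuousLinearMap.proj (R := ℝ) j,
    P.coeff 0, fun i => ?_⟩
  have h1 : (-∑ j : Fin (2 * d), P.coeff ((j : ℕ) + 1) • ContinuousLinearMap.proj (R := ℝ) j :
      StrongDual ℝ (Fin (2 * d) → ℝ)) (momentPoint (2 * d) (t i)) = P.coeff 0 - P.eval (t i) := by
    rw [Polynomial.eval_eq_sum_range' hdeg, Finset.sum_range_succ', Finset.sum_range]
    simp [momentPoint]
  have h2 : P.eval (t i) = ∏ v ∈ V, (t i - t v) ^ 2 := by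
    simp [hP, Polynomial.eval_prod]
  rw [h1, h2]
  constructor
  · have : 0 ≤ ∏ v ∈ V, (t i - t v) ^ 2 := Finset.prod_nonneg fun v _ => sq_nonneg _
    linarith
  · rw [sub_eq_self, Finset.prod_eq_zero_iff]
    constructor
    · rintro ⟨v, hv, h⟩
      rwa [ht (sub_eq_zero.1 (pow_eq_zero_iff (two_ne_zero) |>.1 h))]
    · intro hi
      exact ⟨i, hi, by simp⟩

/-! ## Cyclic perturbations -/

theorem binNumber_succ {d : ℕ} (x : Fin (d + 1) → Bool) :
    binNumber x = (x 0).toNat + 2 * binNumber fun i => x i.succ := by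
  simp only [binNumber, Fin.sum_univ_succ, Finset.mul_sum]
  simp [pow_succ, mul_comm, mul_left_comm]

theorem binNumber_injective {d : ℕ} : Function.Injective (binNumber (d := d)) := by
  induction d with
  | zero => exact fun x y _ => Subsingleton.elim _ _
  | succ d ih =>
    intro x y h
    rw [binNumber_succ, binNumber_succ] at h
    have h1 := Bool.toNat_le (x 0)
    have h2 := Bool.toNat_le (y 0)
    have h3 : (x 0).toNat = (y 0).toNat := by omega
    have h4 := ih (a₁ := fun i => x i.succ) (a₂ := fun i => y i.succ) (by omega)
    funext i
    refine Fin.cases ?_ (fun i => congrFun h4 i) i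
    cases hx : x 0 <;> cases hy : y 0 <;> simp [hx, hy] at h3 ⊢

theorem binNumber_lt {d : ℕ} (x : Fin d → Bool) : binNumber x < 2 ^ d := by
  induction d with
  | zero => simp [binNumber]
  | succ d ih =>
    rw [binNumber_succ, pow_succ]
    have h1 := Bool.toNat_le (x 0)
    have h2 := ih fun i => x i.succ
    omega

theorem binNumber_true (d : ℕ) : binNumber (fun _ : Fin d => true) + 1 = 2 ^ d := by
  induction d with
  | zero => simp [binNumber]
  | succ d ih =>
    rw [binNumber_succ, pow_succ, ← ih]
    simp; ring

/-- The point of the cyclic perturbation that belongs to the vertex `x` of the cube. -/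
def perturbedPoint {d : ℕ} (x : Fin d → Bool) : Fin d → ℤ := fun j =>
  2 ^ (d ^ 3) * ((x j).toNat : ℤ) + (binNumber x : ℤ) ^ ((j : ℕ) + 1)

theorem cyclicPerturbation_eq {d : ℕ} (Z : Finset (Fin d → Bool)) :
    cyclicPerturbation Z = Z.image perturbedPoint := rfl

theorem sum_pow_succ_lt (a d : ℕ) : ∑ j : Fin d, a ^ ((j : ℕ) + 1) < (a + 1) ^ d := by
  induction d with
  | zero => simp
  | succ d ih =>
    rw [Fin.sum_univ_succ]
    simp only [Fin.val_zero, Fin.val_succ, zero_add, pow_one]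
    have h1 : ∑ j : Fin d, a ^ ((j : ℕ) + 1 + 1) = a * ∑ j : Fin d, a ^ ((j : ℕ) + 1) := by
      rw [Finset.mul_sum]
      exact Finset.sum_congr rfl fun j _ => by ring
    have h2 : 0 < (a + 1) ^ d := by positivity
    rw [h1, pow_succ]
    nlinarith

theorem sum_binNumber_pow_lt {d : ℕ} (x : Fin d → Bool) :
    ∑ j : Fin d, (binNumber x : ℤ) ^ ((j : ℕ) + 1) < 2 ^ (d ^ 2) := by
  have h1 := sum_pow_succ_lt (binNumber x) d
  have h2 : (binNumber x + 1) ^ d ≤ (2 ^ d) ^ d := Nat.pow_le_pow_left (binNumber_lt x) d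
  rw [← pow_mul, ← pow_two] at h2
  have h3 := Int.ofNat_lt.2 (h1.trans_le h2)
  push_cast at h3
  exact h3

/-- Each point of the cyclic perturbation is the unique maximizer of its sign vector. -/
theorem signVector_lt {d : ℕ} {x z : Fin d → Bool} (h : z ≠ x) :
    ∑ i, signVector x i * perturbedPoint z i < ∑ i, signVector x i * perturbedPoint x i := by
  obtain ⟨i₀, hi₀⟩ := Function.ne_iff.1 h
  have hd : 1 ≤ d := Nat.one_le_iff_ne_zero.2 fun h0 => by subst h0; exact i₀.elim0
  set K : ℤ := 2 ^ (d ^ 3) with hK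
  have h1 : ∀ i, (0 : ℤ) ≤ signVector x i * (((x i).toNat : ℤ) - (z i).toNat) := by
    intro i
    cases hx : x i <;> cases hz : z i <;> simp [signVector, hx]
  have h2 : (1 : ℤ) ≤ signVector x i₀ * (((x i₀).toNat : ℤ) - (z i₀).toNat) := by
    cases hx : x i₀ <;> cases hz : z i₀ <;> simp [signVector, hx, hz] at hi₀ ⊢
  have h3 : (1 : ℤ) ≤ ∑ i, signVector x i * (((x i).toNat : ℤ) - (z i).toNat) :=
    h2.trans (Finset.single_le_sum (fun i _ => h1 i) (Finset.mem_univ i₀))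
  set a := (binNumber x : ℤ) with ha
  set b := (binNumber z : ℤ) with hb
  have ha0 : 0 ≤ a := by positivity
  have hb0 : 0 ≤ b := by positivity
  -- Both powers are nonnegative, so a coordinate loses at most the larger one. The maximum of `a`
  -- and `b` is one of them for all coordinates at once, so the total loss is below `2^(d^2) ≤ K`,
  -- while the cube part gains at least `K`.
  have h4 : ∀ i : Fin d, -(max a b ^ ((i : ℕ) + 1)) ≤ signVector x i * (a ^ ((i : ℕ) + 1) - b ^ ((i : ℕ) + 1)) := by
    intro i
    have h5 : a ^ ((i : ℕ) + 1) ≤ max a b ^ ((i : ℕ) + 1) := pow_le_pow_left₀ ha0 (le_max_left _ _) _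
    have h6 : b ^ ((i : ℕ) + 1) ≤ max a b ^ ((i : ℕ) + 1) := pow_le_pow_left₀ hb0 (le_max_right _ _) _
    have h7 : 0 ≤ a ^ ((i : ℕ) + 1) := by positivity
    have h8 : 0 ≤ b ^ ((i : ℕ) + 1) := by positivity
    cases hx : x i <;> simp [signVector, hx] <;> linarith
  have h5 : -(2 ^ (d ^ 2) : ℤ) < ∑ i : Fin d, signVector x i * (a ^ ((i : ℕ) + 1) - b ^ ((i : ℕ) + 1)) := by
    refine lt_of_lt_of_le (neg_lt_neg ?_) ((Finset.sum_neg_distrib _).symm.le.trans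
      (Finset.sum_le_sum fun i _ => h4 i))
    rcases max_choice a b with h | h <;> rw [h]
    · exact sum_binNumber_pow_lt x
    · exact sum_binNumber_pow_lt z
  have h6 : (2 : ℤ) ^ (d ^ 2) ≤ K := pow_le_pow_right₀ (by norm_num)
    (Nat.pow_le_pow_right hd (by norm_num))
  have h7 : ∑ i, signVector x i * perturbedPoint x i - ∑ i, signVector x i * perturbedPoint z i =
      K * ∑ i, signVector x i * (((x i).toNat : ℤ) - (z i).toNat) +
      ∑ i : Fin d, signVector x i * (a ^ ((i : ℕ) + 1) - b ^ ((i : ℕ) + 1)) := by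
    rw [← Finset.sum_sub_distrib, Finset.mul_sum, ← Finset.sum_add_distrib]
    refine Finset.sum_congr rfl fun i _ => ?_
    simp only [perturbedPoint, ← hK, ← ha, ← hb]
    ring
  have h8 : 0 < K := by positivity
  nlinarith

theorem perturbedPoint_injective {d : ℕ} : Function.Injective (perturbedPoint (d := d)) := by
  intro x z h
  by_contra hne
  have := signVector_lt (x := x) (z := z) (Ne.symm hne)
  rw [h] at this
  exact lt_irrefl _ this

theorem card_cyclicPerturbation {d : ℕ} (Z : Finset (Fin d → Bool)) :
    (cyclicPerturbation Z).card = Z.card :=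
  Finset.card_image_of_injective _ perturbedPoint_injective

/-- The optimal values for sign vectors determine the problem. -/
theorem eq_of_isOptValue {d : ℕ} {Z Z' : Finset (Fin d → Bool)} {v : (Fin d → Bool) → ℤ}
    (h : ∀ x, IsOptValue (cyclicPerturbation Z) (signVector x) (v x))
    (h' : ∀ x, IsOptValue (cyclicPerturbation Z') (signVector x) (v x)) : Z = Z' := by
  have key : ∀ {Z Z' : Finset (Fin d → Bool)},
      (∀ x, IsOptValue (cyclicPerturbation Z) (signVector x) (v x)) →
      (∀ x, IsOptValue (cyclicPerturbation Z') (signVector x) (v x)) → ∀ x ∈ Z, x ∈ Z' := by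
    intro Z Z' h h' x hx
    -- The value at the point of `x` is a lower bound for `v x`. If `x ∉ Z'`, then every point of
    -- the second problem has a strictly smaller value, so `v x` is not attained there.
    have h1 := (h x).2 ⟨perturbedPoint x, by simpa [cyclicPerturbation_eq] using ⟨x, hx, rfl⟩, rfl⟩
    obtain ⟨y, hy, h2⟩ := (h' x).1
    simp only [cyclicPerturbation_eq, Finset.coe_image] at hy
    obtain ⟨z, hz, rfl⟩ := hy
    by_contra hxZ
    have hzx : z ≠ x := fun h => hxZ (h ▸ hz)
    have h3 := signVector_lt hzx
    simp only at h1 h2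
    omega
  ext x
  exact ⟨key h h' x, key h' h x⟩

/-- The real version of `perturbedPoint`. -/
def realPoint {d : ℕ} (x : Fin d → Bool) : Fin d → ℝ := fun i => perturbedPoint x i

theorem realPoints_cyclicPerturbation {d : ℕ} (Z : Finset (Fin d → Bool)) :
    realPoints (cyclicPerturbation Z) = realPoint '' (Z : Set (Fin d → Bool)) := by
  rw [realPoints, cyclicPerturbation_eq, Finset.coe_image, Set.image_image]
  rfl

theorem realPoint_injective {d : ℕ} : Function.Injective (realPoint (d := d)) := by
  intro x y h
  apply perturbedPoint_injective
  funext i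
  have h1 : (perturbedPoint x i : ℝ) = perturbedPoint y i := congrFun h i
  exact_mod_cast h1

/-! ### General position -/

/-- There are at most `d * d` nontrivial factors `|n j - n i|`, each at most `2^d - 1`. This is
where the exponent `d^3` of the perturbation is needed. -/
theorem abs_det_vandermonde_lt {d : ℕ} (hd : 1 ≤ d) (n : Fin (d + 1) → ℤ) (h0 : ∀ i, 0 ≤ n i)
    (h : ∀ i, n i < 2 ^ d) : |(Matrix.vandermonde n).det| < 2 ^ (d ^ 3) := by
  rw [Matrix.det_vandermonde, Finset.abs_prod, Fin.prod_univ_castSucc]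
  simp only [Finset.abs_prod]
  have h1 : ∏ j ∈ Finset.Ioi (Fin.last d), |n j - n (Fin.last d)| = 1 := by
    rw [← Fin.top_eq_last, Finset.Ioi_top]; rfl
  have hpow : (2 : ℤ) ≤ 2 ^ d := by
    calc (2 : ℤ) = 2 ^ 1 := by norm_num
      _ ≤ _ := pow_le_pow_right₀ (by norm_num) hd
  set a : ℤ := 2 ^ d - 1 with ha
  have h2 : ∀ i : Fin d, ∏ j ∈ Finset.Ioi i.castSucc, |n j - n i.castSucc| ≤ a ^ d := by
    intro i
    calc ∏ j ∈ Finset.Ioi i.castSucc, |n j - n i.castSucc| ≤ ∏ j ∈ Finset.Ioi i.castSucc, a := by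
          refine Finset.prod_le_prod (fun _ _ => abs_nonneg _) fun j _ => ?_
          have h1 := h j
          have h2 := h i.castSucc
          have h3 := h0 j
          have h4 := h0 i.castSucc
          rw [abs_le]; constructor <;> omega
      _ = a ^ (Finset.Ioi i.castSucc).card := by rw [Finset.prod_const]
      _ ≤ a ^ d := pow_le_pow_right₀ (by omega) (by rw [Fin.card_Ioi]; simp)
  rw [h1, mul_one]
  calc ∏ i : Fin d, ∏ j ∈ Finset.Ioi i.castSucc, |n j - n i.castSucc| ≤ ∏ i : Fin d, a ^ d :=
        Finset.prod_le_prod (fun _ _ => Finset.prod_nonneg fun _ _ => abs_nonneg _) fun i _ => h2 i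
    _ = a ^ (d * d) := by simp [← pow_mul]
    _ < (2 ^ d) ^ (d * d) := pow_lt_pow_left₀ (by omega) (by omega) (by positivity)
    _ = 2 ^ (d ^ 3) := by rw [← pow_mul]; congr 1; ring

/-- Modulo `2^(d^3)` the cube part disappears and the Vandermonde matrix of the numbers `binNumber
(x i)` remains. If the determinant were zero, the modulus would divide the Vandermonde determinant,
which is smaller in absolute value and nonzero because the numbers are distinct. -/
theorem det_ne_zero_of_injective {d : ℕ} (hd : 1 ≤ d) {x : Fin (d + 1) → Fin d → Bool}
    (hx : Function.Injective x) :
    (Matrix.of fun i : Fin (d + 1) => (Fin.cons 1 (perturbedPoint (x i)) : Fin (d + 1) → ℤ)).det ≠ 0 := by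
  set A : Matrix (Fin (d + 1)) (Fin (d + 1)) ℤ :=
    Matrix.of fun i : Fin (d + 1) => (Fin.cons 1 (perturbedPoint (x i)) : Fin (d + 1) → ℤ) with hA
  set n : Fin (d + 1) → ℤ := fun i => binNumber (x i) with hn
  intro h0
  have hmap : (Int.castRingHom (ZMod (2 ^ (d ^ 3)))).mapMatrix A =
      (Int.castRingHom (ZMod (2 ^ (d ^ 3)))).mapMatrix (Matrix.vandermonde n) := by
    ext i j
    refine Fin.cases ?_ (fun j => ?_) j
    · simp [hA, Matrix.vandermonde_apply]
    · have h2 : ((2 : ZMod (2 ^ (d ^ 3))) ^ (d ^ 3)) = 0 := by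
        have := ZMod.natCast_self (2 ^ (d ^ 3))
        push_cast at this
        exact this
      simp [hA, Matrix.vandermonde_apply, perturbedPoint, h2, hn]
  have hdet := congrArg Matrix.det hmap
  rw [← RingHom.map_det, ← RingHom.map_det, h0, map_zero] at hdet
  have hdvd : ((2 ^ (d ^ 3) : ℕ) : ℤ) ∣ (Matrix.vandermonde n).det :=
    (ZMod.intCast_zmod_eq_zero_iff_dvd _ _).1 hdet.symm
  have hlt := abs_det_vandermonde_lt hd n (fun i => by positivity)
    (fun i => by have h1 := binNumber_lt (x i); zify at h1; exact h1)
  have h3 : (Matrix.vandermonde n).det = 0 :=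
    Int.eq_zero_of_abs_lt_dvd hdvd (by exact_mod_cast hlt)
  refine Matrix.det_vandermonde_ne_zero_iff.2 ?_ h3
  intro i j hij
  exact hx (binNumber_injective (Int.ofNat_inj.1 hij))

theorem affineIndependent_of_injective {d : ℕ} (hd : 1 ≤ d) {x : Fin (d + 1) → Fin d → Bool}
    (hx : Function.Injective x) : AffineIndependent ℝ fun i => realPoint (x i) := by
  rw [affineIndependent_iff_of_fintype]
  intro w hw h
  rw [Finset.weightedVSub_eq_linear_combination (hw := hw)] at h
  set A : Matrix (Fin (d + 1)) (Fin (d + 1)) ℤ :=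
    Matrix.of fun i : Fin (d + 1) => (Fin.cons 1 (perturbedPoint (x i)) : Fin (d + 1) → ℤ) with hA
  have hdet : (A.map (Int.castRingHom ℝ)).det ≠ 0 := by
    rw [← RingHom.mapMatrix_apply, ← RingHom.map_det]
    simpa using det_ne_zero_of_injective hd hx
  refine congrFun (Matrix.eq_zero_of_vecMul_eq_zero hdet (v := w) ?_)
  funext j
  refine Fin.cases ?_ (fun j => ?_) j
  · simpa [Matrix.vecMul, dotProduct, hA] using hw
  · simpa [Matrix.vecMul, dotProduct, hA, realPoint] using congrFun h j

theorem exists_injective_of_card {d : ℕ} {W : Finset (Fin d → Bool)} {k : ℕ} (hW : W.card = k) :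
    ∃ x : Fin k → Fin d → Bool, Function.Injective x ∧ Set.range x = W := by
  refine ⟨fun i => ((W.equivFinOfCardEq hW).symm i : Fin d → Bool),
    Subtype.val_injective.comp (Equiv.injective _), ?_⟩
  rw [← Function.comp_def, Set.range_comp, Equiv.range_eq_univ, Set.image_univ, Subtype.range_coe]

/-- The cube has `2^d ≥ d + 1` vertices, so `W` can be enlarged to exactly `d + 1` of them. -/
theorem affineIndependent_realPoint_image {d : ℕ} (hd : 1 ≤ d) {W : Finset (Fin d → Bool)}
    (hW : W.card ≤ d + 1) :
    AffineIndependent ℝ (Subtype.val : (realPoint '' (W : Set (Fin d → Bool))) → Fin d → ℝ) := by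
  have hcard : d + 1 ≤ (Finset.univ : Finset (Fin d → Bool)).card := by
    simpa using (Nat.lt_two_pow_self : d < 2 ^ d)
  obtain ⟨W', h1, -, h2⟩ := Finset.exists_subsuperset_card_eq (Finset.subset_univ W) hW hcard
  obtain ⟨x, hx, hxW⟩ := exists_injective_of_card h2
  have h3 := (affineIndependent_of_injective hd hx).range
  refine h3.mono ?_
  rw [← Function.comp_def, Set.range_comp, hxW]
  exact Set.image_mono (by exact_mod_cast h1)

theorem affineSpan_realPoint_image {d : ℕ} (hd : 1 ≤ d) {W : Finset (Fin d → Bool)}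
    (hW : d + 1 ≤ W.card) : affineSpan ℝ (realPoint '' (W : Set (Fin d → Bool))) = ⊤ := by
  obtain ⟨W', h1, h2⟩ := Finset.exists_subset_card_eq hW
  obtain ⟨x, hx, hxW⟩ := exists_injective_of_card h2
  have h3 := (affineIndependent_of_injective hd hx).affineSpan_eq_top_iff_card_eq_finrank_add_one.2
    (by simp)
  rw [← Function.comp_def, Set.range_comp, hxW] at h3
  exact top_unique (h3 ▸ affineSpan_mono ℝ (Set.image_mono (by exact_mod_cast h1)))

/-! ### The polytopes of cyclic perturbations -/

theorem conv_cyclicPerturbation {d : ℕ} (Z : Finset (Fin d → Bool)) :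
    conv (cyclicPerturbation Z) = convexHull ℝ (realPoint '' (Z : Set (Fin d → Bool))) := by
  rw [conv, realPoints_cyclicPerturbation]

/-- The sign vector of `x` exposes the point of `x`. -/
theorem extremePoints_conv_cyclicPerturbation {d : ℕ} (Z : Finset (Fin d → Bool)) :
    (conv (cyclicPerturbation Z)).extremePoints ℝ = realPoints (cyclicPerturbation Z) := by
  refine Set.Subset.antisymm extremePoints_convexHull_subset ?_
  rw [conv_cyclicPerturbation, realPoints_cyclicPerturbation]
  rintro _ ⟨x, hx, rfl⟩
  set l : StrongDual ℝ (Fin d → ℝ) :=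
    ∑ i, (signVector x i : ℝ) • ContinuousLinearMap.proj (R := ℝ) i with hl
  have hlv : ∀ z, l (realPoint z) = ((∑ i, signVector x i * perturbedPoint z i : ℤ) : ℝ) := by
    intro z; simp [hl, realPoint]
  have hle : ∀ y ∈ realPoint '' (Z : Set (Fin d → Bool)), l y ≤ l (realPoint x) := by
    rintro _ ⟨z, -, rfl⟩
    by_cases hzx : z = x
    · rw [hzx]
    · rw [hlv, hlv]; exact_mod_cast (signVector_lt hzx).le
  have hexp := isExposed_hyperplane hle
  have hsing : {y ∈ realPoint '' (Z : Set (Fin d → Bool)) | l y = l (realPoint x)} = {realPoint x} := by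
    ext y
    constructor
    · rintro ⟨⟨z, -, rfl⟩, hz⟩
      by_cases hzx : z = x
      · rw [hzx]; rfl
      · rw [hlv, hlv] at hz
        exact absurd (by exact_mod_cast hz) (signVector_lt hzx).ne
    · rintro rfl
      exact ⟨⟨x, hx, rfl⟩, rfl⟩
  rw [convexHull_inter_hyperplane hle, hsing, convexHull_singleton] at hexp
  exact hexp.isExtreme.mem_extremePoints

/-- Any `d + 1` of the points span the whole space, so a functional constant on them is constant
everywhere and does not cut out a proper face. -/
theorem card_face_le {d : ℕ} (hd : 1 ≤ d) {S : Set (Fin d → ℝ)} (F : FaceLattice (convexHull ℝ S))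
    {W : Finset (Fin d → Bool)} (hW : ∀ x ∈ W, realPoint x ∈ F.1) : W.card ≤ d := by
  by_contra hcard
  obtain ⟨l, m, h1, h2⟩ := exists_eq_hyperplane F.2.1 F.2.2.1
  have hspan := affineSpan_realPoint_image hd (W := W) (by omega)
  have hconst : ∀ y, l y = m := by
    intro y
    have hy : l.toLinearMap.toAffineMap y ∈
        (affineSpan ℝ (realPoint '' (W : Set (Fin d → Bool)))).map l.toLinearMap.toAffineMap :=
      AffineSubspace.mem_map_of_mem _ (by rw [hspan]; exact AffineSubspace.mem_top _ _ _)
    rw [AffineSubspace.map_span] at hy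
    have hsub : l.toLinearMap.toAffineMap '' (realPoint '' (W : Set (Fin d → Bool))) ⊆ {m} := by
      rintro _ ⟨_, ⟨x, hx, rfl⟩, rfl⟩
      have h3 := hW x hx
      rw [h2] at h3
      exact h3.2
    exact (AffineSubspace.mem_affineSpan_singleton ℝ _).1 (affineSpan_mono ℝ hsub hy)
  apply F.2.2.2
  rw [h2]
  ext y
  simp [hconst]

theorem isSimplicialPolytope_cyclicPerturbation {d : ℕ} (hd : 1 ≤ d) {Z : Finset (Fin d → Bool)}
    (hZ : d + 1 ≤ Z.card) : IsSimplicialPolytope (conv (cyclicPerturbation Z)) where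
  finite := by
    rw [extremePoints_conv_cyclicPerturbation, realPoints]
    exact (Finset.finite_toSet _).image _
  hull := by rw [extremePoints_conv_cyclicPerturbation]; rfl
  full := by
    rw [conv_cyclicPerturbation, affineSpan_convexHull, affineSpan_realPoint_image hd hZ]
  simplex := by
    classical
    rw [conv_cyclicPerturbation]
    intro F
    set W := Z.filter fun x => realPoint x ∈ F.1 with hW
    have hcard : W.card ≤ d := card_face_le hd F fun x hx => (Finset.mem_filter.1 hx).2
    refine (affineIndependent_realPoint_image hd (W := W) (by omega)).mono ?_
    intro y hy
    have hyF := hy.1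
    have hyP := F.2.1.isExtreme.extremePoints_subset_extremePoints hy
    obtain ⟨x, hx, rfl⟩ := extremePoints_convexHull_subset hyP
    exact ⟨x, by simp [hW, hyF]; exact_mod_cast hx, rfl⟩

/-- The bijection `φ` of the vertices is arbitrary: proper faces on the left have at most `d`
vertices, and on the right every set of at most `d` vertices is a face. -/
theorem nonempty_faceLattice_embedding_cyclicSet {d : ℕ} (hd : 1 ≤ d) {Z : Finset (Fin d → Bool)}
    {g : ℕ → ℕ} (hg : StrictMono g) :
    Nonempty (FaceLattice (conv (cyclicPerturbation Z)) ↪o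
      FaceLattice (conv (cyclicSet (2 * d) Z.card g))) := by
  classical
  have hcard : Z.card = (Finset.Icc 1 Z.card).card := by simp
  set φ := Finset.equivOfCardEq hcard with hφ
  set t : Z → ℝ := fun x => (g (φ x) : ℝ) with ht
  have htinj : Function.Injective t := by
    intro x y h
    apply φ.injective
    apply Subtype.ext
    apply hg.injective
    have h1 : (g (φ x) : ℝ) = g (φ y) := h
    exact_mod_cast h1
  have h1 : conv (cyclicPerturbation Z) = convexHull ℝ (Set.range fun x : Z => realPoint x.1) := by
    rw [conv_cyclicPerturbation]
    congr 1
    ext y; simp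
  have h2 : conv (cyclicSet (2 * d) Z.card g) =
      convexHull ℝ (Set.range fun x : Z => momentPoint (2 * d) (t x)) := by
    rw [conv, realPoints, cyclicSet, Finset.coe_image, Set.image_image]
    congr 1
    ext y
    constructor
    · rintro ⟨i, hi, rfl⟩
      refine ⟨φ.symm ⟨i, hi⟩, ?_⟩
      funext j
      simp [momentPoint, ht]
    · rintro ⟨x, rfl⟩
      refine ⟨φ x, (φ x).2, ?_⟩
      funext j
      simp [momentPoint, ht]
  rw [h1, h2]
  refine nonempty_faceLattice_embedding _ _ d ?_ ?_
  · intro F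
    rw [Set.ncard_eq_toFinset_card', ← Finset.card_map (Function.Embedding.subtype _)]
    apply card_face_le hd F
    intro x hx
    simp only [Finset.mem_map, Set.mem_toFinset, Set.mem_ofPred_eq] at hx
    obtain ⟨y, hy, rfl⟩ := hx
    exact hy
  · intro V hV
    rw [Set.ncard_eq_toFinset_card'] at hV
    obtain ⟨l, m, h⟩ := exists_supporting_hyperplane_momentPoint htinj V.toFinset hV
    exact ⟨l, m, fun i => by simpa using h i⟩

/-! ### Encoding sizes -/

/-- The last coordinate of the point of `(1, …, 1)` maximizes the cube part and the perturbation at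
the same time. -/
theorem maxNorm_cyclicPerturbation {d : ℕ} (hd : 1 ≤ d) {Z : Finset (Fin d → Bool)}
    (hZ : (fun _ => true) ∈ Z) :
    maxNorm (cyclicPerturbation Z) = 2 ^ (d ^ 3) + (2 ^ d - 1) ^ d := by
  have habs : ∀ (x : Fin d → Bool) (i : Fin d), (perturbedPoint x i).natAbs =
      2 ^ (d ^ 3) * (x i).toNat + binNumber x ^ ((i : ℕ) + 1) := by
    intro x i
    rw [perturbedPoint]
    exact_mod_cast Int.natAbs_natCast (2 ^ (d ^ 3) * (x i).toNat + binNumber x ^ ((i : ℕ) + 1))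
  have hnum := binNumber_true d
  apply le_antisymm
  · refine Finset.sup_le fun y hy => Finset.sup_le fun i _ => ?_
    rw [cyclicPerturbation_eq] at hy
    obtain ⟨x, -, rfl⟩ := Finset.mem_image.1 hy
    rw [habs]
    have h1 := binNumber_lt x
    have h2 : binNumber x ^ ((i : ℕ) + 1) ≤ (2 ^ d - 1) ^ d := by
      calc binNumber x ^ ((i : ℕ) + 1) ≤ (2 ^ d - 1) ^ ((i : ℕ) + 1) :=
            Nat.pow_le_pow_left (by omega) _
        _ ≤ (2 ^ d - 1) ^ d := by
            refine Nat.pow_le_pow_right ?_ i.2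
            have : 2 ^ 1 ≤ 2 ^ d := Nat.pow_le_pow_right (by norm_num) hd
            omega
    have h3 : 2 ^ (d ^ 3) * (x i).toNat ≤ 2 ^ (d ^ 3) := by
      have := Bool.toNat_le (x i)
      calc _ ≤ 2 ^ (d ^ 3) * 1 := Nat.mul_le_mul_left _ this
        _ = _ := mul_one _
    omega
  · have h1 : 2 ^ (d ^ 3) + (2 ^ d - 1) ^ d =
        (perturbedPoint (fun _ : Fin d => true) ⟨d - 1, by omega⟩).natAbs := by
      rw [habs, ← hnum]
      simp [Nat.sub_add_cancel hd]
    rw [h1]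
    refine le_trans ?_ (Finset.le_sup (f := fun x : Fin d → ℤ => Finset.univ.sup fun i => (x i).natAbs)
      (by rw [cyclicPerturbation_eq]; exact Finset.mem_image_of_mem _ hZ))
    exact Finset.le_sup (f := fun i => (perturbedPoint (fun _ : Fin d => true) i).natAbs)
      (Finset.mem_univ _)

theorem nodeValue_eq_maxNorm {d : ℕ} (hd : 1 ≤ d) {Z : Finset (Fin d → Bool)}
    (hZ : (fun _ => true) ∈ Z) :
    nodeValue (2 ^ (d - 1) + 1) = maxNorm (cyclicPerturbation Z) := by
  rw [maxNorm_cyclicPerturbation hd hZ, nodeValue_two_pow_add_one, Nat.sub_add_cancel hd]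

theorem two_rpow_encSize {d : ℕ} {X : Finset (Fin d → ℤ)} (h : 0 < maxNorm X) :
    (2 : ℝ) ^ encSize X = maxNorm X := by
  rw [encSize, Real.rpow_logb (by norm_num) (by norm_num) (by exact_mod_cast h)]

theorem encSize_cyclicPerturbation_le {d : ℕ} (hd : 1 ≤ d) {Z : Finset (Fin d → Bool)}
    (hZ : (fun _ => true) ∈ Z) : encSize (cyclicPerturbation Z) ≤ 2 * (d : ℝ) ^ 3 := by
  have h1 : maxNorm (cyclicPerturbation Z) ≤ 2 ^ (2 * d ^ 3) := by
    rw [maxNorm_cyclicPerturbation hd hZ]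
    have h2 := pow_sub_one_pow_lt (d - 1)
    rw [Nat.sub_add_cancel hd] at h2
    have h3 : 2 ^ (d ^ 3 + 1) ≤ 2 ^ (2 * d ^ 3) := by
      refine Nat.pow_le_pow_right (by norm_num) ?_
      have : 1 ≤ d ^ 3 := Nat.one_le_pow _ _ hd
      omega
    rw [pow_succ] at h3
    omega
  have h0 : 0 < maxNorm (cyclicPerturbation Z) := by
    rw [maxNorm_cyclicPerturbation hd hZ]; positivity
  rw [encSize, Real.logb_le_iff_le_rpow (by norm_num) (by exact_mod_cast h0)]
  calc (maxNorm (cyclicPerturbation Z) : ℝ) ≤ ((2 ^ (2 * d ^ 3) : ℕ) : ℝ) := by exact_mod_cast h1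
    _ = (2 : ℝ) ^ (2 * (d : ℝ) ^ 3) := by
      rw [show (2 * (d : ℝ) ^ 3) = ((2 * d ^ 3 : ℕ) : ℝ) by push_cast; ring, Real.rpow_natCast]
      push_cast; rfl

theorem le_maxNorm_cyclicSet {e N : ℕ} (he : 0 < e) (hN : 1 ≤ N) (g : ℕ → ℕ) :
    g N ≤ maxNorm (cyclicSet e N g) := by
  have hmem : (fun j : Fin e => ((g N : ℤ)) ^ ((j : ℕ) + 1)) ∈ cyclicSet e N g :=
    Finset.mem_image_of_mem _ (by simp [hN])
  refine le_trans ?_ (Finset.le_sup (f := fun x : Fin e → ℤ => Finset.univ.sup fun i => (x i).natAbs) hmem)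
  refine le_trans ?_ (Finset.le_sup (f := fun i : Fin e => (((g N : ℤ)) ^ ((i : ℕ) + 1)).natAbs)
    (Finset.mem_univ ⟨0, he⟩))
  simp

theorem encSize_le_encSize {d e : ℕ} {X : Finset (Fin d → ℤ)} {Y : Finset (Fin e → ℤ)}
    (h0 : 0 < maxNorm X) (h : maxNorm X ≤ maxNorm Y) : encSize X ≤ encSize Y :=
  Real.logb_le_logb_of_le (by norm_num) (by exact_mod_cast h0) (by exact_mod_cast h)

/-! ## Counting circuits -/

/-- A circuit with `s + 1` gates consists of a circuit with `s` gates and a gate. -/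
def circuitSuccEquiv (n s : ℕ) :
    Circuit n (s + 1) ≃ Circuit n s × (Bool → Bool → Bool) × Fin (n + s) × Fin (n + s) where
  toFun | .gate C op l r => (C, op, l, r)
  invFun q := .gate q.1 q.2.1 q.2.2.1 q.2.2.2
  left_inv | .gate _ _ _ _ => rfl
  right_inv _ := rfl

theorem unique_circuit_zero {n : ℕ} : ∀ C : Circuit n 0, C = .nil
  | .nil => rfl

instance finite_circuit (n s : ℕ) : Finite (Circuit n s) := by
  induction s with
  | zero =>
    have : Subsingleton (Circuit n 0) :=
      ⟨fun C D => (unique_circuit_zero C).trans (unique_circuit_zero D).symm⟩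
    infer_instance
  | succ s ih => exact Finite.of_equiv _ (circuitSuccEquiv n s).symm

/-- A gate is one of `16 = 2^4` operations with two of at most `2^B` wires. -/
theorem card_circuit_le {n s S B : ℕ} (hB : n + S ≤ 2 ^ B) (hs : s ≤ S) :
    Nat.card (Circuit n s) ≤ (2 ^ (2 * B + 4)) ^ s := by
  induction s with
  | zero =>
    have : Subsingleton (Circuit n 0) :=
      ⟨fun C D => (unique_circuit_zero C).trans (unique_circuit_zero D).symm⟩
    simpa using Finite.card_le_one_iff_subsingleton.2 this
  | succ s ih =>
    rw [Nat.card_congr (circuitSuccEquiv n s), Nat.card_prod, Nat.card_prod, Nat.card_prod, pow_succ]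
    refine Nat.mul_le_mul (ih (by omega)) ?_
    have h1 : Nat.card (Bool → Bool → Bool) = 16 := by
      simp [Nat.card_eq_fintype_card]
    have h2 : Nat.card (Fin (n + s)) ≤ 2 ^ B := by
      rw [Nat.card_eq_fintype_card, Fintype.card_fin]; omega
    calc _ ≤ 16 * (2 ^ B * 2 ^ B) := by
          rw [h1]
          exact Nat.mul_le_mul_left _ (Nat.mul_le_mul h2 h2)
      _ = _ := by rw [show 16 = 2 ^ 4 by norm_num, ← pow_add, ← pow_add]; congr 1; ring

/-- Circuits with `n` inputs and less than `S` gates, with `k` output wires. -/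
abbrev MultiCircuit (n S k : ℕ) : Type := Σ s : Fin S, Circuit n s × (Fin k → Fin (n + s))

theorem card_multiCircuit_le {n S k B : ℕ} (hB : n + S ≤ 2 ^ B) :
    Nat.card (MultiCircuit n S k) ≤ S * (2 ^ ((2 * B + 4) * S + B * k)) := by
  rw [Nat.card_sigma]
  calc ∑ s : Fin S, Nat.card (Circuit n s × (Fin k → Fin (n + s)))
      ≤ ∑ s : Fin S, 2 ^ ((2 * B + 4) * S + B * k) := by
        refine Finset.sum_le_sum fun s _ => ?_
        rw [Nat.card_prod, pow_add]
        refine Nat.mul_le_mul ?_ ?_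
        · refine (card_circuit_le hB s.2.le).trans ?_
          rw [← pow_mul]
          exact Nat.pow_le_pow_right (by norm_num) (Nat.mul_le_mul_left _ s.2.le)
        · rw [Nat.card_fun, Nat.card_eq_fintype_card, Nat.card_eq_fintype_card, Fintype.card_fin,
            Fintype.card_fin, pow_mul]
          have := s.2
          exact Nat.pow_le_pow_left (by omega) _
    _ = _ := by simp

/-- The counting principle behind all lower bounds here: `β` consists of circuits or program
numbers, and each of them handles at most one set. -/
theorem ncard_le_of_relation {α β : Type*} [Finite β] (S : Set α) (R : α → β → Prop)
    (hR : ∀ a ∈ S, ∃ b, R a b) (hinj : ∀ a a' b, R a b → R a' b → a = a') : S.ncard ≤ Nat.card β := by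
  rcases S.eq_empty_or_nonempty with rfl | ⟨a₀, ha₀⟩
  · simp
  have : Nonempty β := ⟨(hR a₀ ha₀).choose⟩
  choose! f hf using hR
  rw [← Set.ncard_univ]
  exact Set.ncard_le_ncard_of_injOn f (fun _ _ => Set.mem_univ _)
    (fun a ha b hb h => hinj a b (f a) (hf a ha) (h ▸ hf b hb)) Set.finite_univ

/-! ### Two's complement representations -/

/-- Sign extension: repeating the top bit does not change a two's complement value. So, for any
width `m`, the value modulo `2^L` can be read off `L` wires, and the arbitrary number of outputs in
`Intractable` becomes harmless for counting. -/
theorem exists_signedValue_eq {m : ℕ} (w : Fin (m + 1) → Bool) (L : ℕ) :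
    ∃ q : ℤ, signedValue w = ∑ k ∈ Finset.range L,
      2 ^ k * ((w ⟨min k m, by omega⟩).toNat : ℤ) + 2 ^ L * q := by
  set u : ℕ → ℤ := fun k => ((w ⟨min k m, by omega⟩).toNat : ℤ) with hu
  have hm : ∀ n, m ≤ n → u n = u m := by
    intro n hn
    simp only [hu]
    congr 3
    simp only [Fin.mk.injEq]
    omega
  have h1 : ∀ n, m ≤ n → signedValue w = ∑ k ∈ Finset.range n, 2 ^ k * u k - 2 ^ n * u m := by
    intro n hn
    induction n, hn using Nat.le_induction with
    | base =>
      rw [signedValue, Finset.sum_range]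
      congr 1
      · refine Finset.sum_congr rfl fun i _ => ?_
        simp only [hu]
        congr 4
        ext
        simp
      · simp only [hu]
        congr 4
        ext
        simp
    | succ n hn ih =>
      rw [ih, Finset.sum_range_succ, hm n hn]; ring
  have h2 : ∀ n, L ≤ n → ∃ q : ℤ, ∑ k ∈ Finset.range n, 2 ^ k * u k =
      ∑ k ∈ Finset.range L, 2 ^ k * u k + 2 ^ L * q := by
    intro n hn
    induction n, hn using Nat.le_induction with
    | base => exact ⟨0, by ring⟩
    | succ n hn ih =>
      obtain ⟨q, hq⟩ := ih
      refine ⟨q + 2 ^ (n - L) * u n, ?_⟩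
      rw [Finset.sum_range_succ, hq]
      have : (2 : ℤ) ^ n = 2 ^ L * 2 ^ (n - L) := by rw [← pow_add]; congr 1; omega
      rw [this]; ring
  obtain ⟨q, hq⟩ := h2 (max m L) (le_max_right _ _)
  refine ⟨q - 2 ^ (max m L - L) * u m, ?_⟩
  have h3 : (2 : ℤ) ^ (max m L) = 2 ^ L * 2 ^ (max m L - L) := by rw [← pow_add]; congr 1; omega
  rw [h1 _ (le_max_left _ _), hq, h3]; ring

theorem abs_isOptValue_lt {d : ℕ} {Z : Finset (Fin d → Bool)} {x : Fin d → Bool} {v : ℤ}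
    (h : IsOptValue (cyclicPerturbation Z) (signVector x) v) : |v| < 2 ^ (d ^ 3 + d + 1) := by
  obtain ⟨y, hy, rfl⟩ := h.1
  simp only [cyclicPerturbation_eq, Finset.coe_image] at hy
  obtain ⟨z, hz, rfl⟩ := hy
  have h1 : ∀ i, |signVector x i * perturbedPoint z i| ≤ 2 ^ (d ^ 3) + (binNumber z : ℤ) ^ ((i : ℕ) + 1) := by
    intro i
    have h2 : |signVector x i| = 1 := by cases hx : x i <;> simp [signVector, hx]
    rw [abs_mul, h2, one_mul, perturbedPoint, abs_of_nonneg (by positivity)]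
    cases hz : z i <;> simp
  have h3 : |∑ i, signVector x i * perturbedPoint z i| ≤ d * 2 ^ (d ^ 3) + 2 ^ (d ^ 2) := by
    refine (Finset.abs_sum_le_sum_abs _ _).trans ((Finset.sum_le_sum fun i _ => h1 i).trans ?_)
    rw [Finset.sum_add_distrib]
    have := sum_binNumber_pow_lt z
    simp only [Finset.sum_const, Finset.card_univ, Fintype.card_fin, nsmul_eq_mul]
    linarith
  refine h3.trans_lt ?_
  have h4 : (d : ℤ) < 2 ^ d := by exact_mod_cast (Nat.lt_two_pow_self : d < 2 ^ d)
  have h5 : (2 : ℤ) ^ (d ^ 2) ≤ 2 ^ (d ^ 3 + d) := by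
    refine pow_le_pow_right₀ (by norm_num) ?_
    rcases Nat.eq_zero_or_pos d with rfl | hd
    · simp
    · exact (Nat.pow_le_pow_right hd (by norm_num)).trans (Nat.le_add_right _ _)
  have h6 : (d : ℤ) * 2 ^ (d ^ 3) < 2 ^ (d ^ 3 + d) := by
    rw [pow_add, mul_comm]
    exact mul_lt_mul_of_pos_left h4 (by positivity)
  rw [pow_succ 2 (d ^ 3 + d)]
  linarith

/-- The problems whose optimal values for sign vectors are computed by circuits with less than `S`
gates. -/
def easyProblems (d S : ℕ) : Set (Finset (Fin d → Bool)) :=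
  {Z | ∃ s < S, ∃ (C : Circuit d s) (m : ℕ) (out : Fin (m + 1) → Fin (d + s)),
    ∀ x, IsOptValue (cyclicPerturbation Z) (signVector x) (signedValue fun k => C.eval x (out k))}

/-- The sets whose indicator functions are computed by circuits with less than `S` gates. -/
def easySets (d S : ℕ) : Set (Finset (Fin d → Bool)) :=
  {Z | ∃ s < S, ∃ (C : Circuit d s) (o : Fin (d + s)), ∀ x, C.eval x o = decide (x ∈ Z)}

/-- The single output is copied `k` times, so that the same count as for optimization circuits
applies. -/
theorem ncard_easySets_le (d S k : ℕ) (hk : 0 < k) :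
    (easySets d S).ncard ≤ Nat.card (MultiCircuit d S k) := by
  refine ncard_le_of_relation _
    (fun Z (q : MultiCircuit d S k) => ∀ x, q.2.1.eval x (q.2.2 ⟨0, hk⟩) = decide (x ∈ Z)) ?_ ?_
  · rintro Z ⟨s, hs, C, o, h⟩
    exact ⟨⟨⟨s, hs⟩, C, fun _ => o⟩, h⟩
  · intro Z Z' q h h'
    ext x
    have := (h x).symm.trans (h' x)
    simpa using this

/-- Optimal values are smaller than `2^(d^3+d+1)` in absolute value, hence determined by their
residues modulo `2^(d^3+d+2)`, that is, by `d^3 + d + 2` output wires. The values determine the set.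
-/
theorem ncard_easyProblems_le (d S : ℕ) :
    (easyProblems d S).ncard ≤ Nat.card (MultiCircuit d S (d ^ 3 + d + 2)) := by
  refine ncard_le_of_relation _
    (fun Z (q : MultiCircuit d S (d ^ 3 + d + 2)) => ∃ v : (Fin d → Bool) → ℤ,
      (∀ x, IsOptValue (cyclicPerturbation Z) (signVector x) (v x)) ∧ ∀ x, ∃ r : ℤ,
      v x = ∑ k : Fin (d ^ 3 + d + 2), 2 ^ (k : ℕ) * ((q.2.1.eval x (q.2.2 k)).toNat : ℤ) +
        2 ^ (d ^ 3 + d + 2) * r) ?_ ?_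
  · rintro Z ⟨s, hs, C, m, out, h⟩
    refine ⟨⟨⟨s, hs⟩, C, fun k => out ⟨min k m, by omega⟩⟩, _, h, fun x => ?_⟩
    obtain ⟨r, hr⟩ := exists_signedValue_eq (fun k => C.eval x (out k)) (d ^ 3 + d + 2)
    exact ⟨r, by rw [hr, Finset.sum_range]⟩
  · rintro Z Z' q ⟨v, hv, hr⟩ ⟨v', hv', hr'⟩
    have hvv : v = v' := by
      funext x
      obtain ⟨r, h1⟩ := hr x
      obtain ⟨r', h2⟩ := hr' x
      have h3 := abs_isOptValue_lt (hv x)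
      have h4 := abs_isOptValue_lt (hv' x)
      have h5 : (2 : ℤ) ^ (d ^ 3 + d + 2) ∣ v x - v' x := ⟨r - r', by rw [h1, h2]; ring⟩
      have h6 : |v x - v' x| < 2 ^ (d ^ 3 + d + 2) := by
        have := abs_sub (v x) (v' x)
        rw [pow_succ]
        linarith
      exact sub_eq_zero.1 (Int.eq_zero_of_abs_lt_dvd h5 h6)
    exact eq_of_isOptValue hv (hvv ▸ hv')

/-! ## Diagonalization against programs -/

/-- A numbering of the expressions. -/
def Expr.code : Expr → ℕ
  | .const z => 6 * Encodable.encode z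
  | .read a i => 6 * Nat.pair a i.code + 1
  | .add e f => 6 * Nat.pair e.code f.code + 2
  | .sub e f => 6 * Nat.pair e.code f.code + 3
  | .mul e f => 6 * Nat.pair e.code f.code + 4
  | .div e f => 6 * Nat.pair e.code f.code + 5

theorem Expr.code_injective : Function.Injective Expr.code := by
  intro e
  induction e with
  | const z =>
    intro f h
    cases f with
    | const z' =>
      simp only [Expr.code] at h
      rw [Encodable.encode_injective (show Encodable.encode z = Encodable.encode z' by omega)]
    | _ => simp only [Expr.code] at h; omega
  | read a i ih =>
    intro f h
    cases f with
    | read a' i' =>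
      simp only [Expr.code] at h
      obtain ⟨h1, h2⟩ := Nat.pair_eq_pair.1 (show Nat.pair a i.code = Nat.pair a' i'.code by omega)
      rw [h1, ih h2]
    | _ => simp only [Expr.code] at h; omega
  | add e f ihe ihf =>
    intro g h
    cases g with
    | add e' f' =>
      simp only [Expr.code] at h
      obtain ⟨h1, h2⟩ := Nat.pair_eq_pair.1
        (show Nat.pair e.code f.code = Nat.pair e'.code f'.code by omega)
      rw [ihe h1, ihf h2]
    | _ => simp only [Expr.code] at h; omega
  | sub e f ihe ihf =>
    intro g h
    cases g with
    | sub e' f' =>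
      simp only [Expr.code] at h
      obtain ⟨h1, h2⟩ := Nat.pair_eq_pair.1
        (show Nat.pair e.code f.code = Nat.pair e'.code f'.code by omega)
      rw [ihe h1, ihf h2]
    | _ => simp only [Expr.code] at h; omega
  | mul e f ihe ihf =>
    intro g h
    cases g with
    | mul e' f' =>
      simp only [Expr.code] at h
      obtain ⟨h1, h2⟩ := Nat.pair_eq_pair.1
        (show Nat.pair e.code f.code = Nat.pair e'.code f'.code by omega)
      rw [ihe h1, ihf h2]
    | _ => simp only [Expr.code] at h; omega
  | div e f ihe ihf =>
    intro g h
    cases g with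
    | div e' f' =>
      simp only [Expr.code] at h
      obtain ⟨h1, h2⟩ := Nat.pair_eq_pair.1
        (show Nat.pair e.code f.code = Nat.pair e'.code f'.code by omega)
      rw [ihe h1, ihf h2]
    | _ => simp only [Expr.code] at h; omega

/-- A numbering of the programs. -/
def Prog.code : Prog → ℕ
  | .skip => 0
  | .store a i e => 5 * Nat.pair a (Nat.pair i.code e.code) + 1
  | .seq p q => 5 * Nat.pair p.code q.code + 2
  | .ite e p q => 5 * Nat.pair e.code (Nat.pair p.code q.code) + 3
  | .loop e p => 5 * Nat.pair e.code p.code + 4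

theorem Prog.code_injective : Function.Injective Prog.code := by
  intro p
  induction p with
  | skip =>
    intro q h
    cases q with
    | skip => rfl
    | _ => simp only [Prog.code] at h; omega
  | store a i e =>
    intro q h
    cases q with
    | store a' i' e' =>
      simp only [Prog.code] at h
      obtain ⟨h1, h2⟩ := Nat.pair_eq_pair.1 (show Nat.pair a (Nat.pair i.code e.code) =
        Nat.pair a' (Nat.pair i'.code e'.code) by omega)
      obtain ⟨h3, h4⟩ := Nat.pair_eq_pair.1 h2
      rw [h1, Expr.code_injective h3, Expr.code_injective h4]
    | _ => simp only [Prog.code] at h; omega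
  | seq p q ihp ihq =>
    intro r h
    cases r with
    | seq p' q' =>
      simp only [Prog.code] at h
      obtain ⟨h1, h2⟩ := Nat.pair_eq_pair.1
        (show Nat.pair p.code q.code = Nat.pair p'.code q'.code by omega)
      rw [ihp h1, ihq h2]
    | _ => simp only [Prog.code] at h; omega
  | ite e p q ihp ihq =>
    intro r h
    cases r with
    | ite e' p' q' =>
      simp only [Prog.code] at h
      obtain ⟨h1, h2⟩ := Nat.pair_eq_pair.1 (show Nat.pair e.code (Nat.pair p.code q.code) =
        Nat.pair e'.code (Nat.pair p'.code q'.code) by omega)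
      obtain ⟨h3, h4⟩ := Nat.pair_eq_pair.1 h2
      rw [Expr.code_injective h1, ihp h3, ihq h4]
    | _ => simp only [Prog.code] at h; omega
  | loop e p ih =>
    intro r h
    cases r with
    | loop e' p' =>
      simp only [Prog.code] at h
      obtain ⟨h1, h2⟩ := Nat.pair_eq_pair.1
        (show Nat.pair e.code p.code = Nat.pair e'.code p'.code by omega)
      rw [Expr.code_injective h1, ih h2]
    | _ => simp only [Prog.code] at h; omega

/-- The final memory is determined by the program and the initial memory. -/
theorem Exec.deterministic {p : Prog} {σ τ τ' : Memory} {t t' : ℕ} (h : Exec p σ τ t)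
    (h' : Exec p σ τ' t') : τ = τ' := by
  induction h generalizing τ' t' with
  | skip σ => cases h'; rfl
  | store a i e σ => cases h'; rfl
  | seq hp hq ihp ihq =>
    cases h' with
    | seq hp' hq' =>
      obtain rfl := ihp hp'
      exact ihq hq'
  | ite_true q he hp ih =>
    cases h' with
    | ite_true _ _ hp' => exact ih hp'
    | ite_false _ he' _ => exact absurd he he'
  | ite_false p he hq ih =>
    cases h' with
    | ite_true _ he' _ => exact absurd he' he
    | ite_false _ _ hq' => exact ih hq'
  | loop_true he hp hl ihp ihl =>
    cases h' with
    | loop_true _ hp' hl' =>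
      obtain rfl := ihp hp'
      exact ihl hl'
    | loop_false _ he' => exact absurd he he'
  | loop_false p he =>
    cases h' with
    | loop_true he' _ _ => exact absurd he' he
    | loop_false _ _ => rfl

/-- The problems that are solved by a program with number at most `d`. -/
def programmedProblems (d : ℕ) : Set (Finset (Fin d → Bool)) :=
  {Z | ∃ p : Prog, p.code ≤ d ∧ ∀ c : Fin d → ℤ, ∃ (τ : Memory) (t : ℕ),
    Exec p (inputMemory d c) τ t ∧ IsOptValue (cyclicPerturbation Z) c (τ 0 0)}

/-- Determinism: a program produces one value for each input, so it solves the problem of at most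
one set. Running time plays no role. -/
theorem ncard_programmedProblems_le (d : ℕ) : (programmedProblems d).ncard ≤ d + 1 := by
  have h := ncard_le_of_relation (programmedProblems d)
    (fun Z (k : Fin (d + 1)) => ∃ p : Prog, p.code = k ∧ ∀ c : Fin d → ℤ, ∃ (τ : Memory) (t : ℕ),
      Exec p (inputMemory d c) τ t ∧ IsOptValue (cyclicPerturbation Z) c (τ 0 0)) ?_ ?_
  · simpa using h
  · rintro Z ⟨p, hp, h⟩
    exact ⟨⟨p.code, by omega⟩, p, rfl, h⟩
  · rintro Z Z' k ⟨p, hp, h⟩ ⟨p', hp', h'⟩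
    obtain rfl := Prog.code_injective (hp.trans hp'.symm)
    choose τ t h1 h2 using h
    choose τ' t' h1' h2' using h'
    have h3 : ∀ c, τ c = τ' c := fun c => (h1 c).deterministic (h1' c)
    exact eq_of_isOptValue (v := fun x => τ (signVector x) 0 0) (fun x => h2 _)
      (fun x => by rw [h3]; exact h2' _)

/-! ## Hard problems -/

/-- The sets of `2^(d-1) + 1` vertices of the cube, among them the vertex `(1, …, 1)`. -/
def candidates (d : ℕ) : Finset (Finset (Fin d → Bool)) :=
  (Finset.powersetCard (2 ^ (d - 1)) (Finset.univ.erase fun _ => true)).image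
    (insert fun _ => true)

theorem mem_candidates {d : ℕ} {Z : Finset (Fin d → Bool)} (h : Z ∈ candidates d) :
    (fun _ => true) ∈ Z ∧ Z.card = 2 ^ (d - 1) + 1 := by
  obtain ⟨W, hW, rfl⟩ := Finset.mem_image.1 h
  obtain ⟨h1, h2⟩ := Finset.mem_powersetCard.1 hW
  refine ⟨Finset.mem_insert_self _ _, ?_⟩
  rw [Finset.card_insert_of_notMem, h2]
  intro h3
  exact (Finset.mem_erase.1 (h1 h3)).1 rfl

theorem card_candidates (d : ℕ) : (candidates d).card = (2 ^ d - 1).choose (2 ^ (d - 1)) := by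
  rw [candidates, Finset.card_image_of_injOn, Finset.card_powersetCard,
    Finset.card_erase_of_mem (Finset.mem_univ _)]
  · simp
  · intro W hW W' hW' h
    have key : ∀ {W : Finset (Fin d → Bool)}, W ∈ Finset.powersetCard (2 ^ (d - 1))
        (Finset.univ.erase fun _ => true) → (fun _ => true) ∉ W := fun hW h3 =>
      (Finset.mem_erase.1 ((Finset.mem_powersetCard.1 hW).1 h3)).1 rfl
    have h1 := congrArg (fun V => Finset.erase V fun _ => true) h
    simpa [Finset.erase_insert (key hW), Finset.erase_insert (key hW')] using h1

theorem candidates_nonempty {d : ℕ} (hd : 1 ≤ d) : (candidates d).Nonempty := by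
  rw [← Finset.card_pos, card_candidates]
  apply Nat.choose_pos
  have : 2 ^ d = 2 ^ (d - 1) * 2 := by rw [← pow_succ, Nat.sub_add_cancel hd]
  have : 0 < 2 ^ (d - 1) := by positivity
  omega

/-- With `m = 2^(d-1)` the count is half a central binomial coefficient, hence at least `4^m / (4
m)`, and `4 m ≤ 2^m` holds from `m = 4` on. -/
theorem two_pow_le_card_candidates {d : ℕ} (hd : 3 ≤ d) :
    2 ^ 2 ^ (d - 1) ≤ (candidates d).card := by
  rw [card_candidates]
  obtain ⟨m, hm⟩ : ∃ m, m = 2 ^ (d - 1) := ⟨_, rfl⟩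
  have h1 : 2 ^ d = m * 2 := by rw [hm, ← pow_succ]; congr 1; omega
  have h4 : 2 ^ 2 ≤ m := by rw [hm]; exact Nat.pow_le_pow_right (by norm_num) (by omega)
  rw [← hm, h1]
  obtain ⟨n, rfl⟩ : ∃ n, m = n + 1 := ⟨m - 1, by omega⟩
  have h2 := Nat.four_pow_le_two_mul_self_mul_centralBinom (n + 1) (by omega)
  have h3 : Nat.centralBinom (n + 1) = 2 * ((n + 1) * 2 - 1).choose (n + 1) := by
    rw [Nat.centralBinom, show 2 * (n + 1) = (2 * n + 1) + 1 by ring, Nat.choose_succ_succ,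
      show (n + 1) * 2 - 1 = 2 * n + 1 by omega, ← Nat.choose_symm_half n]
    ring
  have h5 : 4 * (n + 1) ≤ 2 ^ (n + 1) := by
    have h6 : 3 ≤ n := by omega
    clear h1 h2 h3 h4 hm
    induction n, h6 using Nat.le_induction with
    | base => norm_num
    | succ n hn ih => rw [pow_succ]; omega
  rw [h3, show 4 = 2 * 2 by norm_num, mul_pow] at h2
  have h6 : 0 < 2 ^ (n + 1) := by positivity
  refine Nat.le_of_mul_le_mul_left (h2.trans ?_) h6
  calc 2 * (n + 1) * (2 * ((n + 1) * 2 - 1).choose (n + 1))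
      = (4 * (n + 1)) * ((n + 1) * 2 - 1).choose (n + 1) := by ring
    _ ≤ _ := Nat.mul_le_mul_right _ h5

theorem pow_four_mul_le_two_pow {k : ℕ} (hk : 40 ≤ k) : 4096 * (k + 1) ^ 4 ≤ 2 ^ k := by
  induction k, hk using Nat.le_induction with
  | base => norm_num
  | succ k hk ih =>
    rw [pow_succ 2 k]
    have h1 : (k + 1 + 1) ^ 4 ≤ 2 * (k + 1) ^ 4 := by
      obtain ⟨j, rfl⟩ : ∃ j, k = j + 40 := ⟨k - 40, by omega⟩
      ring_nf
      nlinarith [sq_nonneg j]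
    omega

/-- The doubled term counts the circuits for indicator functions and for optimization, `d + 1`
counts the programs. For `k = d / 4` the exponent is at most `4^k + 2^k`, far below `2^(d-1)`
because `4 k ≤ d`. The bound `160` means `k ≥ 40`, where the induction in `pow_four_mul_le_two_pow`
starts. -/
theorem circuit_count_lt {d : ℕ} (hd : 160 ≤ d) :
    2 * (2 ^ (d / 4 + 1) * 2 ^ ((2 * d + 4) * 2 ^ (d / 4 + 1) + d * (d ^ 3 + d + 2))) + (d + 1) <
      2 ^ 2 ^ (d - 1) := by
  obtain ⟨k, hk⟩ : ∃ k, k = d / 4 := ⟨_, rfl⟩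
  rw [← hk]
  have hk40 : 40 ≤ k := by omega
  have hdk : d ≤ 4 * k + 3 := by omega
  have h4 := pow_four_mul_le_two_pow hk40
  have hdd : d < 2 ^ d := Nat.lt_two_pow_self
  set P := 2 ^ k with hP
  have h1 : (2 * d + 4) * 2 ^ (k + 1) ≤ 20 * (k + 1) * P := by
    rw [pow_succ, ← hP]
    nlinarith
  have h5 : k + 1 ≤ (k + 1) ^ 4 := Nat.le_self_pow (by norm_num) _
  have h2 : (2 * d + 4) * 2 ^ (k + 1) ≤ P * P :=
    h1.trans (Nat.mul_le_mul_right _ (by omega))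
  have h3 : d * (d ^ 3 + d + 2) ≤ 1024 * (k + 1) ^ 4 := by
    have h6 : d ≤ 4 * (k + 1) := by omega
    calc d * (d ^ 3 + d + 2) ≤ (4 * (k + 1)) * ((4 * (k + 1)) ^ 3 + 4 * (k + 1) + 2) := by gcongr
      _ ≤ (4 * (k + 1)) * ((4 * (k + 1)) ^ 3 + (4 * (k + 1)) ^ 3 + (4 * (k + 1)) ^ 3) := by
          have h7 : 4 * (k + 1) ≤ (4 * (k + 1)) ^ 3 := Nat.le_self_pow (by norm_num) _
          gcongr
          omega
      _ = 768 * (k + 1) ^ 4 := by ring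
      _ ≤ _ := by omega
  have h7 : P * P * 8 ≤ 2 ^ (d - 1) := by
    rw [hP, show 8 = 2 ^ 3 by norm_num, ← pow_add, ← pow_add]
    exact Nat.pow_le_pow_right (by norm_num) (by omega)
  have h8 : P ≤ P * P := Nat.le_mul_self P
  set E := (2 * d + 4) * 2 ^ (k + 1) + d * (d ^ 3 + d + 2) with hE
  have h9 : E + k + 1 + d + 4 ≤ 2 ^ (d - 1) := by omega
  have h10 : 2 * (2 ^ (k + 1) * 2 ^ E) ≤ 2 ^ (E + k + 1 + d + 2) := by
    rw [← pow_add, ← pow_succ']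
    exact Nat.pow_le_pow_right (by norm_num) (by omega)
  have h11 : 2 ^ d ≤ 2 ^ (E + k + 1 + d + 2) := Nat.pow_le_pow_right (by norm_num) (by omega)
  have h12 : 2 ^ (E + k + 1 + d + 4) = 2 ^ (E + k + 1 + d + 2) * 4 := by
    rw [show E + k + 1 + d + 4 = E + k + 1 + d + 2 + 2 from rfl, pow_add _ _ 2]; norm_num
  have h13 : 2 ^ (E + k + 1 + d + 4) ≤ 2 ^ 2 ^ (d - 1) := Nat.pow_le_pow_right (by norm_num) h9
  have h14 : 0 < 2 ^ (E + k + 1 + d + 2) := by positivity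
  omega

theorem exists_hard_candidate {d : ℕ} (hd : 160 ≤ d) : ∃ Z ∈ candidates d,
    Z ∉ easySets d (2 ^ (d / 4 + 1)) ∧ Z ∉ easyProblems d (2 ^ (d / 4 + 1)) ∧
      Z ∉ programmedProblems d := by
  by_contra! hcon
  have hsub : (candidates d : Set (Finset (Fin d → Bool))) ⊆
      easySets d (2 ^ (d / 4 + 1)) ∪ (easyProblems d (2 ^ (d / 4 + 1)) ∪ programmedProblems d) := by
    intro Z hZ
    by_cases h1 : Z ∈ easySets d (2 ^ (d / 4 + 1))
    · exact Or.inl h1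
    · by_cases h2 : Z ∈ easyProblems d (2 ^ (d / 4 + 1))
      · exact Or.inr (Or.inl h2)
      · exact Or.inr (Or.inr (hcon Z hZ h1 h2))
  have h1 := Set.ncard_le_ncard hsub (Set.toFinite _)
  rw [Set.ncard_coe_finset] at h1
  have h2 := Set.ncard_union_le (easySets d (2 ^ (d / 4 + 1)))
    (easyProblems d (2 ^ (d / 4 + 1)) ∪ programmedProblems d)
  have h3 := Set.ncard_union_le (easyProblems d (2 ^ (d / 4 + 1))) (programmedProblems d)
  -- All wires of the circuits considered can be addressed with `B = d` bits.
  have hB : d + 2 ^ (d / 4 + 1) ≤ 2 ^ d := by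
    obtain ⟨n, rfl⟩ : ∃ n, d = n + 1 := ⟨d - 1, by omega⟩
    have h4 : n < 2 ^ n := Nat.lt_two_pow_self
    have h5 : 2 ^ ((n + 1) / 4 + 1) ≤ 2 ^ n := Nat.pow_le_pow_right (by norm_num) (by omega)
    rw [pow_succ]
    omega
  have h4 := card_multiCircuit_le (k := d ^ 3 + d + 2) hB
  have h5 := ncard_easySets_le d (2 ^ (d / 4 + 1)) (d ^ 3 + d + 2) (by omega)
  have h6 := ncard_easyProblems_le d (2 ^ (d / 4 + 1))
  have h7 := ncard_programmedProblems_le d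
  have h8 := two_pow_le_card_candidates (d := d) (by omega)
  have h9 := circuit_count_lt hd
  omega

/-- Passage from the real exponent `d / 4` to the integer exponent, which rounds up. -/
theorem lt_two_pow_of_lt_rpow {d s : ℕ} (h : (s : ℝ) < (2 : ℝ) ^ ((1 / 4 : ℝ) * d)) :
    s < 2 ^ (d / 4 + 1) := by
  have h1 : (2 : ℝ) ^ ((1 / 4 : ℝ) * d) ≤ (2 : ℝ) ^ ((d / 4 + 1 : ℕ) : ℝ) := by
    refine Real.rpow_le_rpow_of_exponent_le (by norm_num) ?_
    have h2 : d ≤ 4 * (d / 4 + 1) := by omega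
    have h3 : (d : ℝ) ≤ 4 * ((d / 4 + 1 : ℕ) : ℝ) := by exact_mod_cast h2
    linarith
  rw [Real.rpow_natCast] at h1
  exact_mod_cast h.trans_le h1

end PolyOpt

/-! ### Assembly of the theorem -/

open PolyOpt

theorem theorem3 :
    ∃ (b : ∀ d : ℕ, (Fin d → Bool) → Bool) (g : ℕ → ℕ)
      (X : ∀ d : ℕ, Finset (Fin d → ℤ)) (Y : ∀ d : ℕ, Finset (Fin (2 * d) → ℤ)),
      -- `X` is the cyclic perturbation of the support of a hard Boolean function
      (∀ d, X d = cyclicPerturbation (support (b d))) ∧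
      RequiresExpCircuits b ∧
      -- `X` is intractable
      Intractable X ∧
      ¬ PolySolvable (fun d => d) X ∧
      -- `X` has polynomial encoding size and a simplicial convex hull with vertex set `X`
      (∃ A : ℝ, ∀ d : ℕ, 1 ≤ d → encSize (X d) ≤ A * (d : ℝ) ^ 3) ∧
      (∀ d : ℕ, 1 ≤ d → IsSimplicialPolytope (conv (X d)) ∧
        (conv (X d)).extremePoints ℝ = realPoints (X d)) ∧
      -- `Y` is a cyclic polytope problem, and it is polynomially solvable
      StrictMono g ∧
      PolyTimeComputable g ∧
      (∀ d : ℕ, 1 ≤ d → (g (X d).card : ℝ) = (2 : ℝ) ^ encSize (X d)) ∧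
      (∀ d, Y d = cyclicSet (2 * d) (X d).card g) ∧
      PolySolvable (fun d => 2 * d) Y ∧
      -- no monotone combinatorial characteristic of complexity is larger for `X` than for `Y`
      (∀ d : ℕ, 1 ≤ d →
        Nonempty (FaceLattice (conv (X d)) ↪o FaceLattice (conv (Y d))) ∧
        encSize (X d) ≤ encSize (Y d) ∧
        ∀ f : MonotoneCharacteristic, f.onProblem (X d) ≤ f.onProblem (Y d)) := by
  -- One set per dimension serves all claims. Below `160` any candidate will do, as the circuit
  -- bounds are asymptotic; in dimension `0` nothing is required.
  have hZ : ∀ d : ℕ, ∃ Z : Finset (Fin d → Bool), (1 ≤ d → Z ∈ candidates d) ∧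
      (160 ≤ d → Z ∉ easySets d (2 ^ (d / 4 + 1)) ∧ Z ∉ easyProblems d (2 ^ (d / 4 + 1)) ∧
        Z ∉ programmedProblems d) := by
    intro d
    by_cases h : 160 ≤ d
    · obtain ⟨Z, h1, h2⟩ := exists_hard_candidate h
      exact ⟨Z, fun _ => h1, fun _ => h2⟩
    · by_cases hd : 1 ≤ d
      · obtain ⟨Z, h1⟩ := candidates_nonempty hd
        exact ⟨Z, fun _ => h1, fun h' => absurd h' h⟩
      · exact ⟨∅, fun h' => absurd h' hd, fun h' => absurd h' h⟩
  choose Z hcand hhard using hZ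
  have htrue : ∀ d, 1 ≤ d → (fun _ => true) ∈ Z d := fun d hd => (mem_candidates (hcand d hd)).1
  have hcardZ : ∀ d, 1 ≤ d → (Z d).card = 2 ^ (d - 1) + 1 := fun d hd =>
    (mem_candidates (hcand d hd)).2
  have hcardX : ∀ d, (cyclicPerturbation (Z d)).card = (Z d).card := fun d =>
    card_cyclicPerturbation _
  have hsupport : ∀ d, support (fun x => decide (x ∈ Z d)) = Z d := by
    intro d; ext x; simp [support]
  have hlarge : ∀ d, 1 ≤ d → d + 1 ≤ (Z d).card := by
    intro d hd
    rw [hcardZ d hd]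
    have : d - 1 < 2 ^ (d - 1) := Nat.lt_two_pow_self
    omega
  have hnode : ∀ d, 1 ≤ d → nodeValue (Z d).card = maxNorm (cyclicPerturbation (Z d)) := by
    intro d hd
    rw [hcardZ d hd, nodeValue_eq_maxNorm hd (htrue d hd)]
  have hpos : ∀ d, 1 ≤ d → 0 < maxNorm (cyclicPerturbation (Z d)) := by
    intro d hd
    rw [maxNorm_cyclicPerturbation hd (htrue d hd)]; positivity
  have hsize : ∀ d, 1 ≤ d → encSize (cyclicPerturbation (Z d)) ≤
      encSize (cyclicSet (2 * d) (Z d).card nodeValue) := by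
    intro d hd
    refine encSize_le_encSize (hpos d hd) ?_
    rw [← hnode d hd]
    exact le_maxNorm_cyclicSet (by omega) (by have := hlarge d hd; omega) _
  have hsimp : ∀ d, 1 ≤ d → IsSimplicialPolytope (conv (cyclicPerturbation (Z d))) := fun d hd =>
    isSimplicialPolytope_cyclicPerturbation hd (hlarge d hd)
  refine ⟨fun d x => decide (x ∈ Z d), nodeValue, fun d => cyclicPerturbation (Z d),
    fun d => cyclicSet (2 * d) (Z d).card nodeValue, fun d => by rw [hsupport], ?_, ?_, ?_,
    ⟨2, fun d hd => encSize_cyclicPerturbation_le hd (htrue d hd)⟩,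
    fun d hd => ⟨hsimp d hd, extremePoints_conv_cyclicPerturbation _⟩, strictMono_nodeValue,
    polyTimeComputable_nodeValue, ?_, fun d => by rw [hcardX], ?_, fun d hd =>
    ⟨nonempty_faceLattice_embedding_cyclicSet hd strictMono_nodeValue, hsize d hd, fun f => ?_⟩⟩
  · refine ⟨1 / 4, by norm_num, Filter.eventually_atTop.2 ⟨160, fun d hd s C o h => ?_⟩⟩
    by_contra! hs
    exact (hhard d hd).1 ⟨s, lt_two_pow_of_lt_rpow hs, C, o, h⟩
  · refine ⟨1 / 4, by norm_num, Filter.eventually_atTop.2 ⟨160, fun d hd s C m out h => ?_⟩⟩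
    by_contra! hs
    exact (hhard d hd).2.1 ⟨s, lt_two_pow_of_lt_rpow hs, C, m, out, h⟩
  · rintro ⟨p, q, h⟩
    -- In this dimension the set was chosen to defeat all programs with numbers up to the dimension,
    -- `p` among them.
    have hd : 160 ≤ p.code + 160 := by omega
    refine (hhard _ hd).2.2 ⟨p, by omega, fun c => ?_⟩
    obtain ⟨τ, t, h1, h2, -⟩ := h _ (by omega) c
    exact ⟨τ, t, h1, h2⟩
  · intro d hd
    rw [hcardX, hnode d hd, two_rpow_encSize (hpos d hd)]
  · exact polySolvable_cyclicSet _ fun d hd => by rw [hcardZ d hd]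
  -- First the lattice is replaced at the fixed size `ES(X)`, with the number of vertices equal to
  -- the number of points; then the size is raised to `ES(Y)`.
  · have h1 := f.mono_lattice d _ (hsimp d hd) nodeValue strictMono_nodeValue
      (encSize (cyclicPerturbation (Z d)))
    have h2 : ((conv (cyclicPerturbation (Z d))).extremePoints ℝ).ncard = (Z d).card := by
      rw [extremePoints_conv_cyclicPerturbation, realPoints_cyclicPerturbation,
        Set.ncard_image_of_injective _ realPoint_injective, Set.ncard_coe_finset]
    rw [h2] at h1
    exact h1.trans (f.mono_size _ _ _ (hsize d hd))
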